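/- \textbf{Setting.} Built-in constraints are generated from atomic constraints (including equations) by $\wedge$ and $\exists_x$; their meaning is given by a first-order theory $CT$ that contains Clark's equality theory. "$\mathtt{false}$" means unsatisfiable in $CT$. User-defined (CHR) constraints are atoms $p(\bar t)$ whose predicates are not built-in; an identified CHR constraint $h\#i$ is a CHR constraint with an identifier $i$, $chr(h\#i)=h$ and $id(h\#i)=i$. A token is $r@i_1,\dots,i_l$ with $r$ a rule name; a token store is a finite set of tokens. An annotated rule $r@H_1\backslash H_2\Leftrightarrow D\,|\,\tilde A;T$ has a name $r$ (not necessarily unique), a non-empty head made of two sequences $H_1$ (kept) and $H_2$ (removed) of CHR constraints, a guard $D$ (a multiset of built-in constraints), a body $\tilde A$ of built-in and identified CHR constraints whose identifiers are positive and pairwise distinct, and a token store $T$ all of whose identifiers occur in $\tilde A$. An annotated program is a set $P$ of annotated rules (finiteness is not needed). $H=H'$ denotes the set of equations between corresponding arguments of two sequences of atoms and is defined only when lengths, predicates and arities agree. $inst(\tilde B,T,n)=(\tilde B',T',m)$ adds $n$ to every identifier, and $m$ is the greatest resulting identifier ($n$ if there is none); $clean(\tilde B,T)$ is the set of tokens of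 $T$ all of whose identifiers occur in $\tilde B$. \textbf{Semantics.} Configurations are $\langle\tilde S,C,T\rangle_n$ with $\tilde S$ the built-in and identified CHR constraints still to be treated, $C$ the built-in store, $T$ the token store and $n$ the counter. \emph{Solve}: $\langle\{c\}\cup\tilde G,C,T\rangle_n\to\langle\tilde G,C',T\rangle_n$ if $c$ is built-in and $CT\models c\wedge C\leftrightarrow C'$. \emph{Apply}: if $v@H_1'\backslash H_2'\Leftrightarrow D\,|\,\tilde B;T_v$ is a freshly renamed rule of $P$, $x=Fv(H_1',H_2')$, $CT\models C\to\exists_x((chr(\tilde H_1,\tilde H_2)=(H_1',H_2'))\wedge D)$, $v@id(\tilde H_1,\tilde H_2)\notin T$ and $(\tilde B',T_v',m)=inst(\tilde B,T_v,n)$, then $\langle\tilde H_1\cup\tilde H_2\cup\tilde G,C,T\rangle_n\to\langle\tilde B'\cup\tilde H_1\cup\tilde G,\ (chr(\tilde H_1,\tilde H_2)=(H_1',H_2'))\wedge C,\ T'\rangle_m$, where $T'=T\cup T_v'$, plus the token $v@id(\tilde H_1,\tilde H_2)$ if $\tilde H_2=\emptyset$. For a goal $G$ (a multiset of constraints) with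 $m$ CHR constraints, the initial configuration numbers these $1,\dots,m$ and is $\langle\tilde G,\mathtt{true},\emptyset\rangle_m$. The set $\mathcal{QA}'_P(G)$ of qualified answers consists of the formulas $\exists_{-Fv(G)}(K\wedge d)$, where $K=chr(\tilde K)$ and $\langle\tilde K,d,T\rangle_n$ is reachable from the initial configuration and has no successor, together with $\mathtt{false}$ if a configuration with an unsatisfiable built-in store is reachable. Answers are identified when they are equivalent in $CT$ (CHR predicates being uninterpreted and multiplicities in $K$ being counted). \textbf{Unfolding.} Let $r@H_1\backslash H_2\Leftrightarrow D\,|\,\tilde K,\tilde S_1,\tilde S_2,C;T$ with $C$ the built-in part of the body, and let $v@H_1'\backslash H_2'\Leftrightarrow D'\,|\,\tilde B;T'$ be a rule of $P$ renamed apart from it. Let $\theta$ be a substitution acting on the head variables of $v$ with $CT\models(C\wedge D)\to chr(\tilde S_1,\tilde S_2)=(H_1',H_2')\theta$, let $v@id(\tilde S_1,\tilde S_2)\notin T$, let $D''$ consist of those $c$ in $D'$ with $CT\not\models(C\wedge D)\to c\theta$, let $D\wedge D''\theta$ be satisfiable, and let $(\tilde B_1,T_1,m_1)=inst(\tilde B,T',m)$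 with $m$ the greatest identifier in the rule $r$. Then $r$ can be unfolded with $v$ using the atoms with identifiers $id(\tilde S_1,\tilde S_2)$, with the result $$r@H_1\backslash H_2\Leftrightarrow D,D''\theta\,|\,\tilde K,\tilde S_1,\tilde B_1,C,\ chr(\tilde S_1,\tilde S_2)=(H_1',H_2');\ T'',$$ where $T''=clean((\tilde K,\tilde S_1),T)\cup T_1$, plus the token $v@id(\tilde S_1)$ if $H_2'=\emptyset$. Here $\tilde B$ stands for the whole body of $v$, including its built-in constraints. $Unf_P(r)$ is the set of all results of unfolding $r$ with rules of $P$, and $U^+_P(r)$ is the set of all pairs $(v,(i_1,\dots,i_n))$ such that $r$ can be unfolded with $v$ using the atoms with identifiers $i_1,\dots,i_n$. \textbf{The set $U^\#_P(r)$.} For $r@H_1\backslash H_2\Leftrightarrow D\,|\,\tilde A;T$, a rule $v@H_1'\backslash H_2'\Leftrightarrow D'\,|\,\tilde B;T'$ of $P$, renamed apart from $r$, with $x=Fv(H_1',H_2')$, belongs to $U^\#_P(r)$ iff there is a conjunction $C'$ of built-in constraints with $Fv(C')\cap Fv(v)=\emptyset$ and $D\wedge C'$ satisfiable such that one of the following holds: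 (a) there are sequences $\tilde A_1,\tilde A_2$ of (different occurrences of) identified atoms of $\tilde A$ with $CT\models(D\wedge C')\to\exists_x((chr(\tilde A_1,\tilde A_2)=(H_1',H_2'))\wedge D')$, $v@id(\tilde A_1,\tilde A_2)\notin T$ and $(v,id(\tilde A_1,\tilde A_2))\notin U^+_P(r)$; (b) there are a non-empty multiset $\tilde A'$ of identified atoms of $\tilde A$, a non-empty multiset $H'$ of CHR constraints and sequences $K_1,K_2$ that together list $chr(\tilde A')$ and $H'$, with $CT\models(D\wedge C')\to\exists_x(((K_1,K_2)=(H_1',H_2'))\wedge D')$. \textbf{Theorem.} Let $P$ be an annotated program and let $r@H_1\backslash H_2\Leftrightarrow D\,|\,\tilde A;T$ be a rule of $P$ that can be safely replaced in $P$, that is: (i) $U^\#_P(r)=\emptyset$; (ii) $U^+_P(r)\neq\emptyset$; (iii) every rule in $Unf_P(r)$ has a guard $D^*$ with $CT\models D\leftrightarrow D^*$. Put $$P'=\bigl(P\setminus\{r@H_1\backslash H_2\Leftrightarrow D\,|\,\tilde A;T\}\bigr)\cup Unf_P(r).$$ Then $\mathcal{QA}'_P(G)=\mathcal{QA}'_{P'}(G)$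 for every goal $G$. -/

import Mathlib

universe u v w z

namespace CHR

/-- Variables. -/
abbrev Var : Type := ℕ

/-- Built-in constraints `c ::= d | c ∧ c | ∃ x, c` over a first-order language: the atomic ones are
the equations and the atoms of the relation symbols of the language. -/
inductive Builtin (L : FirstOrder.Language.{u, v}) : Type (max u v)
  | eq (s t : L.Term Var) : Builtin L
  | rel {n : ℕ} (R : L.Relations n) (ts : Fin n → L.Term Var) : Builtin L
  | and (c d : Builtin L) : Builtin L
  | ex (x : Var) (c : Builtin L) : Builtin L

namespace Builtin

variable {L : FirstOrder.Language.{u, v}}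

/-- Free variables. -/
def fv : Builtin L → Finset Var
  | eq s t => s.varFinset ∪ t.varFinset
  | rel _ ts => Finset.univ.biUnion fun i => (ts i).varFinset
  | and c d => c.fv ∪ d.fv
  | ex x c => c.fv.erase x

/-- Truth in a structure under a valuation of the variables. -/
def Realize {M : Type w} [L.Structure M] : Builtin L → (Var → M) → Prop
  | eq s t, a => s.realize a = t.realize a
  | rel R ts, a => FirstOrder.Language.Structure.RelMap R fun i => (ts i).realize a
  | and c d, a => c.Realize a ∧ d.Realize a
  | ex x c, a => ∃ m : M, c.Realize (Function.update a x m)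

/-- Action of a permutation of the variables (free and bound ones). -/
def rename (π : Equiv.Perm Var) : Builtin L → Builtin L
  | eq s t => eq (s.relabel π) (t.relabel π)
  | rel R ts => rel R fun i => (ts i).relabel π
  | and c d => and (c.rename π) (d.rename π)
  | ex x c => ex (π x) (c.rename π)

/-- Capture-avoiding substitution: a bound variable is replaced by one that is larger than every
variable of the terms substituted for the free variables in its scope. -/
def subst : Builtin L → (Var → L.Term Var) → Builtin L
  | eq s t, θ => eq (s.subst θ) (t.subst θ)
  | rel R ts, θ => rel R fun i => (ts i).subst θ
  | and c d, θ => and (c.subst θ) (d.subst θ)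
  | ex x c, θ =>
      let y : Var := ((c.fv.erase x).biUnion fun z => (θ z).varFinset).sup id + 1
      ex y (c.subst (Function.update θ x (FirstOrder.Language.Term.var y)))

end Builtin

/-- Multisets of built-in constraints, read as conjunctions; `0` is `true`. -/
abbrev Conj (L : FirstOrder.Language.{u, v}) : Type (max u v) := Multiset (Builtin L)

namespace Conj

variable {L : FirstOrder.Language.{u, v}}

def fv (C : Conj L) : Finset Var := (C.map Builtin.fv).toFinset.sup id

def Realize {M : Type w} [L.Structure M] (C : Conj L) (a : Var → M) : Prop :=
  ∀ c ∈ C, c.Realize a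

/-- `CT ⊨ C → D`. -/
def Entails (CT : L.Theory) (C D : Conj L) : Prop :=
  ∀ (M : FirstOrder.Language.Theory.ModelType.{u, v, max u v} CT) (a : Var → M), C.Realize a → D.Realize a

/-- `CT ⊨ C ↔ D`. -/
def Equivalent (CT : L.Theory) (C D : Conj L) : Prop :=
  Entails CT C D ∧ Entails CT D C

/-- `C` is satisfiable with respect to `CT`. Its negation is what is meant by `C` being `false`. -/
def Satisfiable (CT : L.Theory) (C : Conj L) : Prop :=
  ∃ (M : FirstOrder.Language.Theory.ModelType.{u, v, max u v} CT) (a : Var → M), C.Realize a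

end Conj

/-- The constraint theory `CT` contains Clark's equality theory: function symbols are injective, have
pairwise disjoint ranges, and `x = t` is false if `x` occurs in the term `t ≠ x`. -/
structure ContainsClarkEquality {L : FirstOrder.Language.{u, v}} (CT : L.Theory) : Prop where
  injective : ∀ (M : FirstOrder.Language.Theory.ModelType.{u, v, max u v} CT) (n : ℕ) (f : L.Functions n)
    (s t : Fin n → M),
    FirstOrder.Language.Structure.funMap f s = FirstOrder.Language.Structure.funMap f t → s = t
  distinct : ∀ (M : FirstOrder.Language.Theory.ModelType.{u, v, max u v} CT) (m n : ℕ) (f : L.Functions m)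
    (g : L.Functions n) (s : Fin m → M) (t : Fin n → M),
    FirstOrder.Language.Structure.funMap f s = FirstOrder.Language.Structure.funMap g t →
      (⟨m, f⟩ : Σ k, L.Functions k) = ⟨n, g⟩
  occurs : ∀ (M : FirstOrder.Language.Theory.ModelType.{u, v, max u v} CT) (x : Var) (t : L.Term Var)
    (a : Var → M), x ∈ t.varFinset → t ≠ FirstOrder.Language.Term.var x → a x ≠ t.realize a

/-- A CHR (user-defined) constraint `p(t₁, …, tₘ)`; `κ` is the type of user-defined predicates. -/
structure Atom (L : FirstOrder.Language.{u, v}) (κ : Type w) where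
  pred : κ
  args : List (L.Term Var)

namespace Atom

variable {L : FirstOrder.Language.{u, v}} {κ : Type w}

def vars (h : Atom L κ) : Finset Var := (h.args.map fun t => t.varFinset).foldr (· ∪ ·) ∅

def rename (π : Equiv.Perm Var) (h : Atom L κ) : Atom L κ :=
  ⟨h.pred, h.args.map fun t => t.relabel π⟩

def subst (θ : Var → L.Term Var) (h : Atom L κ) : Atom L κ :=
  ⟨h.pred, h.args.map fun t => t.subst θ⟩

end Atom

section Sequences

variable {L : FirstOrder.Language.{u, v}} {κ : Type w}

/-- Variables of a sequence of CHR constraints. -/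
def listVars (H : List (Atom L κ)) : Finset Var := (H.map Atom.vars).foldr (· ∪ ·) ∅

/-- The equation `H = H'` between two sequences of CHR constraints is defined. -/
def Comparable (H H' : List (Atom L κ)) : Prop :=
  List.Forall₂ (fun a b => a.pred = b.pred ∧ a.args.length = b.args.length) H H'

/-- The set of equations denoted by `H = H'`, for comparable sequences. -/
def eqns (H H' : List (Atom L κ)) : Conj L :=
  ((List.zipWith (fun a b => List.zipWith Builtin.eq a.args b.args) H H').flatten :
    List (Builtin L))

end Sequences

/-- An identified CHR constraint `h#i`. -/
abbrev IAtom (L : FirstOrder.Language.{u, v}) (κ : Type w) : Type (max u w) := Atom L κ × ℕ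

/-- A token `r@i₁, …, iₗ`. -/
abbrev Token (ν : Type z) : Type z := ν × List ℕ

/-- `chr(h#i) = h`, on sequences. -/
def chrs {L : FirstOrder.Language.{u, v}} {κ : Type w} (H : List (IAtom L κ)) : List (Atom L κ) :=
  H.map Prod.fst

/-- `id(h#i) = i`, on sequences. -/
def ids {L : FirstOrder.Language.{u, v}} {κ : Type w} (H : List (IAtom L κ)) : List ℕ :=
  H.map Prod.snd

/-- Annotated rules `name@keep \ remove ⇔ guard | chr, builtin; tokens`: the body consists of the
identified CHR constraints `chr` and the built-in constraints `builtin`. -/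
structure Rule (L : FirstOrder.Language.{u, v}) (κ : Type w) (ν : Type z) where
  name : ν
  keep : List (Atom L κ)
  remove : List (Atom L κ)
  guard : Conj L
  chr : Multiset (IAtom L κ)
  builtin : Conj L
  tokens : Finset (Token ν)

section Semantics

variable {L : FirstOrder.Language.{u, v}} {κ : Type w} {ν : Type z}

/-- Variables of a multiset of identified CHR constraints. -/
def storeVars (S : Multiset (IAtom L κ)) : Finset Var :=
  (S.map fun k => k.1.vars).toFinset.sup id

/-- The greatest identifier in a multiset of identified constraints and a token store (`0` if there
is none). -/
def maxId (S : Multiset (IAtom L κ)) (T : Finset (Token ν)) : ℕ :=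
  max (S.map Prod.snd).sup (T.sup fun t => t.2.toFinset.sup id)

namespace Rule

/-- Variables of the head. -/
def headVars (r : Rule L κ ν) : Finset Var := listVars (r.keep ++ r.remove)

/-- Free variables of a rule. -/
def vars (r : Rule L κ ν) : Finset Var :=
  r.headVars ∪ r.guard.fv ∪ storeVars r.chr ∪ r.builtin.fv

/-- The renamed version of a rule. -/
def rename (π : Equiv.Perm Var) (r : Rule L κ ν) : Rule L κ ν where
  name := r.name
  keep := r.keep.map (Atom.rename π)
  remove := r.remove.map (Atom.rename π)
  guard := r.guard.map (Builtin.rename π)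
  chr := r.chr.map fun k => (k.1.rename π, k.2)
  builtin := r.builtin.map (Builtin.rename π)
  tokens := r.tokens

/-- The conditions on annotated rules: non-empty head, pairwise distinct positive identifiers in the
body, and a local token store that mentions only identifiers of the body. -/
structure WellFormed (r : Rule L κ ν) : Prop where
  head_ne : r.keep ++ r.remove ≠ []
  ids_nodup : (r.chr.map Prod.snd).Nodup
  ids_pos : ∀ k ∈ r.chr, 0 < k.2
  tokens_ids : ∀ t ∈ r.tokens, ∀ i ∈ t.2, i ∈ r.chr.map Prod.snd

end Rule

/-- Annotated programs. -/
def IsAnnotatedProgram (P : Set (Rule L κ ν)) : Prop := ∀ r ∈ P, r.WellFormed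

/-- `CT ⊨ C → ∃ x, ((K₁, K₂) = (H₁, H₂) ∧ D)` where `H₁ \ H₂` is the head and `D` the guard of the
rule `r`, and `x` are the variables of the head. -/
def EntailsFiring (CT : L.Theory) (C : Conj L) (K₁ K₂ : List (Atom L κ)) (r : Rule L κ ν) : Prop :=
  Comparable K₁ r.keep ∧ Comparable K₂ r.remove ∧
  ∀ (M : FirstOrder.Language.Theory.ModelType.{u, v, max u v} CT) (a : Var → M), C.Realize a →
    ∃ b : Var → M, (∀ y, y ∉ r.headVars → b y = a y) ∧
      (eqns (K₁ ++ K₂) (r.keep ++ r.remove)).Realize b ∧ r.guard.Realize b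

variable [DecidableEq ν]

/-- `inst(B, T, n) = (B', T', m)`: all identifiers are incremented by `n`, and `m` is the greatest
resulting identifier (`n` if there is no identifier at all). -/
def inst (B : Multiset (IAtom L κ)) (T : Finset (Token ν)) (n : ℕ) :
    Multiset (IAtom L κ) × Finset (Token ν) × ℕ :=
  (B.map fun k => (k.1, k.2 + n), T.image fun t => (t.1, t.2.map (· + n)), n + maxId B T)

/-- `clean(B, T)`: the tokens of `T` all of whose identifiers occur in `B`. -/
def clean (B : Multiset (IAtom L κ)) (T : Finset (Token ν)) : Finset (Token ν) :=
  T.filter fun t => ∀ i ∈ t.2, i ∈ B.map Prod.snd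

/-- Configurations `⟨(chr, builtin), store, history⟩_counter`. -/
structure Config (L : FirstOrder.Language.{u, v}) (κ : Type w) (ν : Type z) where
  chr : Multiset (IAtom L κ)
  builtin : Conj L
  store : Conj L
  history : Finset (Token ν)
  counter : ℕ

def Config.vars (σ : Config L κ ν) : Finset Var :=
  storeVars σ.chr ∪ σ.builtin.fv ∪ σ.store.fv

/-- The token added when a rule fires: only if nothing is removed. -/
def firedToken (r : Rule L κ ν) (is : List ℕ) : Finset (Token ν) :=
  if r.remove = [] then {(r.name, is)} else ∅

/-- Transitions. A rule is used in a renamed version which is fresh with respect to the current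
configuration and to the set `V` of protected variables (the variables of the initial goal). -/
inductive Step (CT : L.Theory) (P : Set (Rule L κ ν)) (V : Finset Var) :
    Config L κ ν → Config L κ ν → Prop
  | solve (S : Multiset (IAtom L κ)) (c : Builtin L) (B C C' : Conj L) (T : Finset (Token ν)) (n : ℕ)
      (h : Conj.Equivalent CT (c ::ₘ C) C') :
      Step CT P V ⟨S, c ::ₘ B, C, T, n⟩ ⟨S, B, C', T, n⟩
  | apply (r₀ : Rule L κ ν) (hr : r₀ ∈ P) (π : Equiv.Perm Var) (r : Rule L κ ν)
      (hπ : r = r₀.rename π)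
      (H₁ H₂ : List (IAtom L κ)) (S : Multiset (IAtom L κ)) (B C : Conj L) (T : Finset (Token ν))
      (n : ℕ)
      (fresh : Disjoint r.vars (V ∪ Config.vars (⟨↑H₁ + ↑H₂ + S, B, C, T, n⟩ : Config L κ ν)))
      (fires : EntailsFiring CT C (chrs H₁) (chrs H₂) r)
      (token : (r.name, ids (H₁ ++ H₂)) ∉ T) :
      Step CT P V ⟨↑H₁ + ↑H₂ + S, B, C, T, n⟩
        ⟨(inst r.chr r.tokens n).1 + ↑H₁ + S,
          r.builtin + B,
          eqns (chrs (H₁ ++ H₂)) (r.keep ++ r.remove) + C,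
          T ∪ firedToken r (ids (H₁ ++ H₂)) ∪ (inst r.chr r.tokens n).2.1,
          (inst r.chr r.tokens n).2.2⟩

/-- Goals; the CHR constraints are listed in the order in which they are numbered. -/
structure Goal (L : FirstOrder.Language.{u, v}) (κ : Type w) where
  chr : List (Atom L κ)
  builtin : Conj L

def Goal.fv (G : Goal L κ) : Finset Var := listVars G.chr ∪ G.builtin.fv

/-- The initial configuration: the CHR constraints of the goal are numbered `1, …, m`. -/
def Goal.initial (ν : Type z) (G : Goal L κ) : Config L κ ν where
  chr := ↑(G.chr.zipIdx 1)
  builtin := G.builtin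
  store := 0
  history := ∅
  counter := G.chr.length

/-- A pair `(K, d)`, which stands for the formula `∃_{-V} (K ∧ d)`, where `V` is the set of
variables of the goal. -/
structure Answer (L : FirstOrder.Language.{u, v}) (κ : Type w) where
  chr : Multiset (Atom L κ)
  store : Conj L

/-- The meaning of `∃_{-V} (K ∧ d)` at a valuation `a`: the multisets of instances of `K` under the
valuations that satisfy `d` and agree with `a` on `V`. -/
def Answer.meaning (V : Finset Var) {M : Type*} [L.Structure M] (A : Answer L κ) (a : Var → M) :
    Set (Multiset (κ × List M)) :=
  {m | ∃ b : Var → M, (∀ x ∈ V, b x = a x) ∧ A.store.Realize b ∧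
    m = A.chr.map fun h => (h.pred, h.args.map fun t => t.realize b)}

/-- `∃_{-V} (K ∧ d)` and `∃_{-V} (K' ∧ d')` are equivalent in `CT`, where conjunctions of CHR
constraints count multiplicities. -/
def Answer.Equivalent (CT : L.Theory) (V : Finset Var) (A A' : Answer L κ) : Prop :=
  ∀ (M : FirstOrder.Language.Theory.ModelType.{u, v, max u v} CT) (a : Var → M),
    A.meaning V a = A'.meaning V a

/-- The qualified answers of a goal in an annotated program. Answers are identified when they are
equivalent, so the set is closed under equivalence; `false` is any answer with an unsatisfiable
built-in part. -/
def QA (CT : L.Theory) (P : Set (Rule L κ ν)) (G : Goal L κ) : Set (Answer L κ) :=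
  {A | ∃ σ : Config L κ ν, Relation.ReflTransGen (Step CT P G.fv) (G.initial ν) σ ∧
      (∀ σ', ¬ Step CT P G.fv σ σ') ∧
      A.Equivalent CT G.fv ⟨σ.chr.map Prod.fst, σ.store⟩} ∪
  {A | ∃ σ : Config L κ ν, Relation.ReflTransGen (Step CT P G.fv) (G.initial ν) σ ∧
      ¬ σ.store.Satisfiable CT ∧ ¬ A.store.Satisfiable CT}

/-- `r'` is the result of unfolding `r` with `v` (supposed to be renamed apart), where the sequences
`S₁`, `S₂` of atoms of the body of `r` match the two parts of the head of `v`. -/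
def UnfoldsTo (CT : L.Theory) (r v : Rule L κ ν) (S₁ S₂ : List (IAtom L κ)) (r' : Rule L κ ν) :
    Prop :=
  ∃ (K : Multiset (IAtom L κ)) (θ : Var → L.Term Var) (D'' : Conj L),
    r.chr = K + ↑S₁ + ↑S₂ ∧
    (∀ x, x ∉ v.headVars → θ x = FirstOrder.Language.Term.var x) ∧
    Comparable (chrs S₁) v.keep ∧ Comparable (chrs S₂) v.remove ∧
    Conj.Entails CT (r.builtin + r.guard)
      (eqns (chrs (S₁ ++ S₂)) ((v.keep ++ v.remove).map (Atom.subst θ))) ∧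
    (v.name, ids (S₁ ++ S₂)) ∉ r.tokens ∧
    (open Classical in
      D'' = v.guard.filter fun c => ¬ Conj.Entails CT (r.builtin + r.guard) {c.subst θ}) ∧
    Conj.Satisfiable CT (r.guard + D''.map fun c => c.subst θ) ∧
    r' =
      { name := r.name
        keep := r.keep
        remove := r.remove
        guard := r.guard + D''.map fun c => c.subst θ
        chr := K + ↑S₁ + (inst v.chr v.tokens (maxId r.chr r.tokens)).1
        builtin := v.builtin + r.builtin + eqns (chrs (S₁ ++ S₂)) (v.keep ++ v.remove)
        tokens := clean (K + ↑S₁) r.tokens ∪ (inst v.chr v.tokens (maxId r.chr r.tokens)).2.1 ∪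
          firedToken v (ids (S₁ ++ S₂)) }

/-- `v` is a version of a rule of `P`, renamed apart with respect to `r`. -/
def IsApartVariant (P : Set (Rule L κ ν)) (r v : Rule L κ ν) : Prop :=
  (∃ v₀ ∈ P, ∃ π : Equiv.Perm Var, v = v₀.rename π) ∧ Disjoint v.vars r.vars

/-- `Unf_P(r)`: all the rules obtained by unfolding `r` with a rule of `P`. -/
def Unf (CT : L.Theory) (P : Set (Rule L κ ν)) (r : Rule L κ ν) : Set (Rule L κ ν) :=
  {r' | ∃ v S₁ S₂, IsApartVariant P r v ∧ UnfoldsTo CT r v S₁ S₂ r'}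

/-- `U⁺_P(r)`: the rules with which `r` can be unfolded, with the identifiers of the atoms used. -/
def UPlus (CT : L.Theory) (P : Set (Rule L κ ν)) (r : Rule L κ ν) : Set (Rule L κ ν × List ℕ) :=
  {p | IsApartVariant P r p.1 ∧
    ∃ S₁ S₂ r', p.2 = ids (S₁ ++ S₂) ∧ UnfoldsTo CT r p.1 S₁ S₂ r'}

/-- `U^#_P(r)`: the rules which may fire, under some built-in store `C'`, by using atoms of the body
of `r` only, but not as an unfolding of `r`, or by using atoms of the body of `r` and further CHR
constraints. -/
def USharp (CT : L.Theory) (P : Set (Rule L κ ν)) (r : Rule L κ ν) : Set (Rule L κ ν) :=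
  {v | IsApartVariant P r v ∧
    ((∃ (A₁ A₂ : List (IAtom L κ)) (C' : Conj L),
        (↑A₁ + ↑A₂ : Multiset (IAtom L κ)) ≤ r.chr ∧
        Disjoint C'.fv v.vars ∧
        Conj.Satisfiable CT (r.guard + C') ∧
        EntailsFiring CT (r.guard + C') (chrs A₁) (chrs A₂) v ∧
        (v.name, ids (A₁ ++ A₂)) ∉ r.tokens ∧
        (v, ids (A₁ ++ A₂)) ∉ UPlus CT P r) ∨
      (∃ (A' : Multiset (IAtom L κ)) (H' : Multiset (Atom L κ)) (K₁ K₂ : List (Atom L κ))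
          (C' : Conj L),
        A' ≤ r.chr ∧ A' ≠ 0 ∧ H' ≠ 0 ∧
        Disjoint C'.fv v.vars ∧
        Conj.Satisfiable CT (r.guard + C') ∧
        A'.map Prod.fst + H' = ↑K₁ + ↑K₂ ∧
        EntailsFiring CT (r.guard + C') K₁ K₂ v))}

/-- The rule `r` can be safely replaced (by its unfolded version) in `P`. -/
structure SafelyReplaceable (CT : L.Theory) (P : Set (Rule L κ ν)) (r : Rule L κ ν) : Prop where
  mem : r ∈ P
  uSharp_empty : USharp CT P r = ∅
  uPlus_nonempty : (UPlus CT P r).Nonempty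
  guard_equiv : ∀ r' ∈ Unf CT P r, Conj.Equivalent CT r.guard r'.guard

end Semantics

end CHR

/-!
# Safe replacement of a CHR rule by its unfoldings

The two inclusions between the sets of qualified answers are proved by simulations. The operational
semantics is awkward for this purpose, since its transitions choose fresh variables and identifiers
and replace the built-in store by an equivalent one. The simulations therefore run on a machine
(`LStep`) that adds constraints literally to the store, records all variables and identifiers
ever used, and may rename a fired rule in any way that avoids those. Whether a rule can fire is
expressed without renaming the rule (`CanFire`). Configurations and machine states that agree up to
variables, identifiers and equivalence of the stores (`Sim`) fire the same rules and yield the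
same answers, so qualified answers can be computed by the machine (`mem_QA_iff_machine`).

Let `r'` be the unfolding of `r` with `v`. Firing `r'` has literally the same effect as firing `r`
and then `v` on the matched atoms of its body, except that the equations of the second firing are
still to be solved, and for tokens that mention atoms no longer present (`UnfoldsTo.fired`). The
relation `Ahead` between machine states absorbs both differences.

* Each answer of the unfolded program is one of `P` (`QA_unf_subset`). A firing of `r'` is replaced
  by a firing of `r`, the solving of the built-in constraints of its body, and a firing of `v`. The
  latter is possible because, by Clark's equality theory, the equations of the first firing
  determine the head variables of `r`, so the store entails the guard of `r` (`guard_of_eqns`);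
  together with the body this guard entails that `v` matches, because the unfolding does not
  strengthen the guard (`UnfoldsTo.canFire`). Final states stay final, since wherever `r` can fire,
  so can an unfolded rule, and there is one because `U⁺` is non-empty.

* Each answer of `P` is one of the unfolded program (`QA_subset_unf`). Consider a computation which
  fires `r`, and the first later firing, under a satisfiable store, which uses atoms of the body of
  `r`. As `U^#` is empty, it uses no other atoms and is an instance of an unfolding of `r`
  (`Pending.exists_unfoldsTo`). It commutes with the steps in between, as they use other atoms
  (`LState.fire_apply`), and the rule can fire directly after `r`. So the computation can be
  rearranged, without getting longer, such that the two firings are adjacent and may be replaced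
  by one firing of the unfolded rule (`Pending.exists_frontFiring`). If there is no such firing, the
  store becomes unsatisfiable: otherwise the last state would not be final, because some `v` with
  which `r` can be unfolded could still fire in it. In that case the answer is `false`, and firing
  `v` in addition does no harm.
-/

set_option linter.unusedSectionVars false

namespace CHR

/-! ### Renaming, substitution and truth -/

section Terms

variable {L : FirstOrder.Language.{u, v}}

theorem term_realize_congr {M : Type*} [L.Structure M] {a b : Var → M} (t : L.Term Var)
    (h : ∀ x ∈ t.varFinset, a x = b x) : t.realize a = t.realize b := by
  induction t with
  | var x => exact h x (by simp [FirstOrder.Language.Term.varFinset])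
  | func f ts ih =>
    simp only [FirstOrder.Language.Term.realize]
    congr 1
    funext i
    refine ih i fun x hx => h x ?_
    simp only [FirstOrder.Language.Term.varFinset, Finset.mem_biUnion, Finset.mem_univ, true_and]
    exact ⟨i, hx⟩

theorem term_varFinset_relabel (π : Equiv.Perm Var) (t : L.Term Var) :
    (t.relabel π).varFinset = t.varFinset.image π := by
  induction t with
  | var x => simp [FirstOrder.Language.Term.relabel, FirstOrder.Language.Term.varFinset]
  | func f ts ih =>
    simp only [FirstOrder.Language.Term.relabel, FirstOrder.Language.Term.varFinset,
      Finset.biUnion_image]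
    exact Finset.biUnion_congr rfl fun i _ => ih i

/-- Clark's axioms make terms injective in their variables. -/
theorem eq_of_term_realize_eq {CT : L.Theory} (hCT : ContainsClarkEquality CT)
    (M : FirstOrder.Language.Theory.ModelType.{u, v, max u v} CT) {a b : Var → M} (t : L.Term Var)
    (h : t.realize a = t.realize b) : ∀ x ∈ t.varFinset, a x = b x := by
  induction t with
  | var x =>
    intro y hy
    simp only [FirstOrder.Language.Term.varFinset, Finset.mem_singleton] at hy
    subst hy
    exact h
  | func f ts ih =>
    intro x hx
    simp only [FirstOrder.Language.Term.varFinset, Finset.mem_biUnion, Finset.mem_univ,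
      true_and] at hx
    obtain ⟨i, hi⟩ := hx
    exact ih i (congrFun (hCT.injective M _ f _ _ h) i) x hi

end Terms

namespace Builtin

variable {L : FirstOrder.Language.{u, v}}

theorem realize_congr {M : Type*} [L.Structure M] (c : Builtin L) :
    ∀ {a b : Var → M}, (∀ x ∈ c.fv, a x = b x) → (c.Realize a ↔ c.Realize b) := by
  induction c with
  | eq s t =>
    intro a b h
    simp only [fv, Finset.mem_union] at h
    simp only [Realize]
    rw [term_realize_congr s fun x hx => h x (Or.inl hx),
      term_realize_congr t fun x hx => h x (Or.inr hx)]
  | rel R ts =>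
    intro a b h
    simp only [fv, Finset.mem_biUnion, Finset.mem_univ, true_and] at h
    simp only [Realize]
    have : (fun i => (ts i).realize a) = fun i => (ts i).realize b :=
      funext fun i => term_realize_congr (ts i) fun x hx => h x ⟨i, hx⟩
    rw [this]
  | and c d ihc ihd =>
    intro a b h
    simp only [fv, Finset.mem_union] at h
    simp only [Realize]
    rw [ihc fun x hx => h x (Or.inl hx), ihd fun x hx => h x (Or.inr hx)]
  | ex x c ih =>
    intro a b h
    simp only [fv, Finset.mem_erase] at h
    simp only [Realize]
    refine exists_congr fun m => ih fun y hy => ?_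
    by_cases hyx : y = x
    · subst hyx; simp
    · simp [Function.update_of_ne hyx, h y ⟨hyx, hy⟩]

theorem fv_rename (π : Equiv.Perm Var) (c : Builtin L) : (c.rename π).fv = c.fv.image π := by
  induction c with
  | eq s t => simp [rename, fv, term_varFinset_relabel, Finset.image_union]
  | rel R ts =>
    simp only [rename, fv, Finset.biUnion_image]
    exact Finset.biUnion_congr rfl fun i _ => term_varFinset_relabel π (ts i)
  | and c d ihc ihd => simp [rename, fv, ihc, ihd, Finset.image_union]
  | ex x c ih => simp [rename, fv, ih, Finset.image_erase π.injective]

theorem realize_rename {M : Type*} [L.Structure M] (π : Equiv.Perm Var) (c : Builtin L) :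
    ∀ a : Var → M, (c.rename π).Realize a ↔ c.Realize (a ∘ π) := by
  induction c with
  | eq s t => intro a; simp [rename, Realize, FirstOrder.Language.Term.realize_relabel]
  | rel R ts => intro a; simp [rename, Realize, FirstOrder.Language.Term.realize_relabel]
  | and c d ihc ihd => intro a; simp [rename, Realize, ihc, ihd]
  | ex x c ih =>
    intro a
    simp only [rename, Realize, ih]
    refine exists_congr fun m => ?_
    have : Function.update a (π x) m ∘ π = Function.update (a ∘ π) x m := by
      funext y
      by_cases h : y = x
      · subst h; simp
      · simp [Function.update_of_ne h, Function.update_of_ne (π.injective.ne h)]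
    rw [this]

theorem rename_rename (π ρ : Equiv.Perm Var) (c : Builtin L) :
    (c.rename π).rename ρ = c.rename (π.trans ρ) := by
  induction c with
  | eq s t => simp [rename, FirstOrder.Language.Term.relabel_relabel]
  | rel R ts => simp [rename, FirstOrder.Language.Term.relabel_relabel]
  | and c d ihc ihd => simp [rename, ihc, ihd]
  | ex x c ih => simp [rename, ih]

/-- Substitution is capture-avoiding: the bound variable chosen by `Builtin.subst` does not occur in
the terms that are substituted in its scope. -/
theorem realize_subst {M : Type*} [L.Structure M] (c : Builtin L) :
    ∀ (θ : Var → L.Term Var) (a : Var → M),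
      (c.subst θ).Realize a ↔ c.Realize fun x => (θ x).realize a := by
  induction c with
  | eq s t => intro θ a; simp [subst, Realize, FirstOrder.Language.Term.realize_subst]
  | rel R ts => intro θ a; simp [subst, Realize, FirstOrder.Language.Term.realize_subst]
  | and c d ihc ihd => intro θ a; simp [subst, Realize, ihc, ihd]
  | ex x c ih =>
    intro θ a
    simp only [subst, Realize, ih]
    refine exists_congr fun m => realize_congr c fun z hz => ?_
    by_cases h : z = x
    · subst h; simp
    · rw [Function.update_of_ne h, Function.update_of_ne h]
      refine term_realize_congr _ fun w hw => Function.update_of_ne ?_ _ _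
      have hle : w ≤ ((c.fv.erase x).biUnion fun z => (θ z).varFinset).sup id :=
        Finset.le_sup (f := id)
          (Finset.mem_biUnion.2 ⟨z, Finset.mem_erase.2 ⟨h, hz⟩, hw⟩)
      exact Nat.ne_of_lt (Nat.lt_succ_of_le hle)

end Builtin

namespace Conj

variable {L : FirstOrder.Language.{u, v}}

theorem mem_fv {C : Conj L} {x : Var} : x ∈ C.fv ↔ ∃ c ∈ C, x ∈ c.fv := by
  simp only [fv, Finset.mem_sup, Multiset.mem_toFinset, Multiset.mem_map, id]
  constructor
  · rintro ⟨_, ⟨c, hc, rfl⟩, hx⟩; exact ⟨c, hc, hx⟩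
  · rintro ⟨c, hc, hx⟩; exact ⟨_, ⟨c, hc, rfl⟩, hx⟩

theorem realize_congr {M : Type*} [L.Structure M] {C : Conj L} {a b : Var → M}
    (h : ∀ x ∈ C.fv, a x = b x) : C.Realize a ↔ C.Realize b :=
  forall₂_congr fun c hc => Builtin.realize_congr c fun x hx => h x (mem_fv.2 ⟨c, hc, hx⟩)

theorem realize_add {M : Type*} [L.Structure M] {C D : Conj L} {a : Var → M} :
    (C + D).Realize a ↔ C.Realize a ∧ D.Realize a := by
  simp [Realize, Multiset.mem_add, or_imp, forall_and]

theorem realize_cons {M : Type*} [L.Structure M] {c : Builtin L} {C : Conj L} {a : Var → M} :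
    Realize (c ::ₘ C) a ↔ c.Realize a ∧ C.Realize a := by
  simp [Realize]

theorem realize_rename {M : Type*} [L.Structure M] (π : Equiv.Perm Var) {C : Conj L} {a : Var → M} :
    Realize (C.map (Builtin.rename π)) a ↔ C.Realize (a ∘ π) := by
  simp [Realize, Builtin.realize_rename]

theorem fv_rename (π : Equiv.Perm Var) (C : Conj L) :
    fv (C.map (Builtin.rename π)) = C.fv.image π := by
  ext x
  simp only [mem_fv, Finset.mem_image, Multiset.mem_map]
  constructor
  · rintro ⟨_, ⟨c, hc, rfl⟩, hx⟩
    rw [Builtin.fv_rename, Finset.mem_image] at hx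
    obtain ⟨y, hy, rfl⟩ := hx
    exact ⟨y, ⟨c, hc, hy⟩, rfl⟩
  · rintro ⟨y, ⟨c, hc, hy⟩, rfl⟩
    exact ⟨_, ⟨c, hc, rfl⟩, by rw [Builtin.fv_rename]; exact Finset.mem_image_of_mem _ hy⟩

theorem fv_add (C D : Conj L) : (C + D).fv = C.fv ∪ D.fv := by
  ext x
  simp only [mem_fv, Finset.mem_union, Multiset.mem_add]
  constructor
  · rintro ⟨c, hc | hc, hx⟩
    exacts [Or.inl ⟨c, hc, hx⟩, Or.inr ⟨c, hc, hx⟩]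
  · rintro (⟨c, hc, hx⟩ | ⟨c, hc, hx⟩)
    exacts [⟨c, Or.inl hc, hx⟩, ⟨c, Or.inr hc, hx⟩]

theorem fv_cons (c : Builtin L) (C : Conj L) : fv (c ::ₘ C) = c.fv ∪ C.fv := by
  ext x
  simp [mem_fv]

theorem rename_rename (π ρ : Equiv.Perm Var) (C : Conj L) :
    (C.map (Builtin.rename π)).map (Builtin.rename ρ) = C.map (Builtin.rename (π.trans ρ)) := by
  simp [Multiset.map_map, Builtin.rename_rename]

end Conj

namespace Atom

variable {L : FirstOrder.Language.{u, v}} {κ : Type w}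

/-- The ground atom denoted by a CHR constraint in a structure under a valuation. -/
def val {M : Type*} [L.Structure M] (a : Var → M) (h : Atom L κ) : κ × List M :=
  (h.pred, h.args.map fun t => t.realize a)

theorem mem_foldr_union {s : List (Finset Var)} {x : Var} :
    x ∈ s.foldr (· ∪ ·) ∅ ↔ ∃ t ∈ s, x ∈ t := by
  induction s with
  | nil => simp
  | cons t s ih => simp [ih]

theorem mem_vars {h : Atom L κ} {x : Var} : x ∈ h.vars ↔ ∃ t ∈ h.args, x ∈ t.varFinset := by
  simp [vars, mem_foldr_union]

theorem val_congr {M : Type*} [L.Structure M] {a b : Var → M} (h : Atom L κ)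
    (hab : ∀ x ∈ h.vars, a x = b x) : h.val a = h.val b := by
  simp only [val, Prod.mk.injEq, true_and]
  exact List.map_congr_left fun t ht =>
    term_realize_congr t fun x hx => hab x (mem_vars.2 ⟨t, ht, hx⟩)

theorem val_rename {M : Type*} [L.Structure M] (π : Equiv.Perm Var) (a : Var → M) (h : Atom L κ) :
    (h.rename π).val a = h.val (a ∘ π) := by
  simp [val, rename, FirstOrder.Language.Term.realize_relabel, Function.comp_def]

theorem val_subst {M : Type*} [L.Structure M] (θ : Var → L.Term Var) (a : Var → M) (h : Atom L κ) :
    (h.subst θ).val a = h.val fun x => (θ x).realize a := by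
  simp [val, subst, FirstOrder.Language.Term.realize_subst, Function.comp_def]

theorem vars_rename (π : Equiv.Perm Var) (h : Atom L κ) : (h.rename π).vars = h.vars.image π := by
  ext x
  simp only [mem_vars, rename, List.mem_map, Finset.mem_image]
  constructor
  · rintro ⟨_, ⟨t, ht, rfl⟩, hx⟩
    rw [term_varFinset_relabel, Finset.mem_image] at hx
    obtain ⟨y, hy, rfl⟩ := hx
    exact ⟨y, ⟨t, ht, hy⟩, rfl⟩
  · rintro ⟨y, ⟨t, ht, hy⟩, rfl⟩
    exact ⟨_, ⟨t, ht, rfl⟩, by rw [term_varFinset_relabel]; exact Finset.mem_image_of_mem _ hy⟩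

theorem rename_rename (π ρ : Equiv.Perm Var) (h : Atom L κ) :
    (h.rename π).rename ρ = h.rename (π.trans ρ) := by
  simp [rename]

theorem rename_symm (π : Equiv.Perm Var) (h : Atom L κ) : (h.rename π).rename π.symm = h := by
  obtain ⟨p, ts⟩ := h
  simp [rename]

theorem eq_of_val_eq {CT : L.Theory} (hCT : ContainsClarkEquality CT)
    (M : FirstOrder.Language.Theory.ModelType.{u, v, max u v} CT) {a b : Var → M} (h : Atom L κ)
    (hab : h.val a = h.val b) : ∀ x ∈ h.vars, a x = b x := by
  intro x hx
  obtain ⟨t, ht, hxt⟩ := mem_vars.1 hx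
  simp only [val, Prod.mk.injEq, true_and] at hab
  exact eq_of_term_realize_eq hCT M t (List.map_inj_left.1 hab t ht) x hxt

end Atom

section Sequences

variable {L : FirstOrder.Language.{u, v}} {κ : Type w}

theorem mem_listVars {H : List (Atom L κ)} {x : Var} : x ∈ listVars H ↔ ∃ h ∈ H, x ∈ h.vars := by
  simp [listVars, Atom.mem_foldr_union]

theorem vals_congr {M : Type*} [L.Structure M] {a b : Var → M} (H : List (Atom L κ))
    (hab : ∀ x ∈ listVars H, a x = b x) : H.map (Atom.val a) = H.map (Atom.val b) :=
  List.map_congr_left fun h hh => Atom.val_congr h fun x hx => hab x (mem_listVars.2 ⟨h, hh, hx⟩)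

theorem vals_rename {M : Type*} [L.Structure M] (π : Equiv.Perm Var) (a : Var → M)
    (H : List (Atom L κ)) :
    (H.map (Atom.rename π)).map (Atom.val a) = H.map (Atom.val (a ∘ π)) := by
  simp [Atom.val_rename]

theorem listVars_rename (π : Equiv.Perm Var) (H : List (Atom L κ)) :
    listVars (H.map (Atom.rename π)) = (listVars H).image π := by
  ext x
  simp only [mem_listVars, Finset.mem_image, List.mem_map]
  constructor
  · rintro ⟨_, ⟨h, hh, rfl⟩, hx⟩
    rw [Atom.vars_rename, Finset.mem_image] at hx
    obtain ⟨y, hy, rfl⟩ := hx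
    exact ⟨y, ⟨h, hh, hy⟩, rfl⟩
  · rintro ⟨y, ⟨h, hh, hy⟩, rfl⟩
    exact ⟨_, ⟨h, hh, rfl⟩, by rw [Atom.vars_rename]; exact Finset.mem_image_of_mem _ hy⟩

theorem eq_of_vals_eq {CT : L.Theory} (hCT : ContainsClarkEquality CT)
    (M : FirstOrder.Language.Theory.ModelType.{u, v, max u v} CT) {a b : Var → M}
        (H : List (Atom L κ))
    (hab : H.map (Atom.val a) = H.map (Atom.val b)) : ∀ x ∈ listVars H, a x = b x := by
  intro x hx
  obtain ⟨h, hh, hxh⟩ := mem_listVars.1 hx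
  exact Atom.eq_of_val_eq hCT M h (List.map_inj_left.1 hab h hh) x hxh

theorem realize_zipWith_eq {M : Type*} [L.Structure M] {a : Var → M} :
    ∀ {s t : List (L.Term Var)}, s.length = t.length →
      ((∀ c ∈ List.zipWith Builtin.eq s t, c.Realize a) ↔
        (s.map fun t => t.realize a) = t.map fun t => t.realize a)
  | [], [], _ => by simp
  | x :: s, y :: t, h => by
    have ih := realize_zipWith_eq (a := a) (s := s) (t := t) (by simpa using h)
    simp only [List.zipWith_cons_cons, List.forall_mem_cons, ih, List.map_cons, List.cons.injEq]
    simp [Builtin.Realize]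

theorem Comparable.append {H H' K K' : List (Atom L κ)} (h : Comparable H H')
    (k : Comparable K K') : Comparable (H ++ K) (H' ++ K') := List.rel_append h k

theorem Comparable.rename_right {H H' : List (Atom L κ)} (ρ : Equiv.Perm Var) :
    Comparable H (H'.map (Atom.rename ρ)) ↔ Comparable H H' := by
  simp [Comparable, List.forall₂_map_right_iff, Atom.rename]

theorem Comparable.rename_left {H H' : List (Atom L κ)} (ρ : Equiv.Perm Var) :
    Comparable (H.map (Atom.rename ρ)) H' ↔ Comparable H H' := by
  simp [Comparable, List.forall₂_map_left_iff, Atom.rename]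

/-- The equations between two comparable sequences hold iff the sequences have the same ground
instances. -/
theorem eqns_realize {M : Type*} [L.Structure M] {a : Var → M} {H H' : List (Atom L κ)}
    (h : Comparable H H') :
    (eqns H H').Realize a ↔ H.map (Atom.val a) = H'.map (Atom.val a) := by
  unfold Comparable at h
  induction h with
  | nil => simp [eqns, Conj.Realize]
  | @cons x y H H' hxy _ ih =>
    simp only [eqns, Conj.Realize, List.zipWith_cons_cons, List.flatten_cons, Multiset.mem_coe,
      List.mem_append, or_imp, forall_and] at ih ⊢
    rw [realize_zipWith_eq hxy.2, ih]
    simp [Atom.val, hxy.1]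

theorem eqns_rename (π : Equiv.Perm Var) (H H' : List (Atom L κ)) :
    (eqns H H').map (Builtin.rename π)
      = eqns (H.map (Atom.rename π)) (H'.map (Atom.rename π)) := by
  simp only [eqns, Multiset.map_coe, List.map_flatten, List.map_zipWith, List.zipWith_map]
  simp [Atom.rename, Builtin.rename, List.zipWith_map]

theorem fv_eqns_subset (H H' : List (Atom L κ)) : (eqns H H').fv ⊆ listVars H ∪ listVars H' := by
  intro x hx
  obtain ⟨c, hc, hx⟩ := Conj.mem_fv.1 hx
  simp only [eqns, Multiset.mem_coe, List.mem_flatten] at hc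
  obtain ⟨l, hl, hc⟩ := hc
  rw [← List.map_uncurry_zip_eq_zipWith, List.mem_map] at hl
  obtain ⟨⟨h, h'⟩, hh, rfl⟩ := hl
  simp only [Function.uncurry_apply_pair] at hc
  rw [← List.map_uncurry_zip_eq_zipWith, List.mem_map] at hc
  obtain ⟨⟨s, t⟩, hst, rfl⟩ := hc
  have h1 := List.of_mem_zip hh
  have h2 := List.of_mem_zip hst
  simp only [Function.uncurry_apply_pair, Builtin.fv, Finset.mem_union] at hx
  rw [Finset.mem_union, mem_listVars, mem_listVars]
  rcases hx with hx | hx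
  · exact Or.inl ⟨h, h1.1, Atom.mem_vars.2 ⟨s, h2.1, hx⟩⟩
  · exact Or.inr ⟨h', h1.2, Atom.mem_vars.2 ⟨t, h2.2, hx⟩⟩

/-- For comparable sequences no variable is lost in the equations. -/
theorem listVars_subset_fv_eqns {H H' : List (Atom L κ)} (h : Comparable H H') :
    listVars H ⊆ (eqns H H').fv ∧ listVars H' ⊆ (eqns H H').fv := by
  have key : ∀ {s t : List (L.Term Var)}, s.length = t.length →
      (∀ z ∈ s, ∃ c ∈ List.zipWith Builtin.eq s t, z.varFinset ⊆ c.fv) ∧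
      (∀ z ∈ t, ∃ c ∈ List.zipWith Builtin.eq s t, z.varFinset ⊆ c.fv) := by
    intro s
    induction s with
    | nil => intro t ht; cases t <;> simp_all
    | cons y s ih =>
      intro t ht
      cases t with
      | nil => simp at ht
      | cons z t =>
        have := ih (t := t) (by simpa using ht)
        simp only [List.zipWith_cons_cons, List.mem_cons]
        constructor
        · rintro q (rfl | hq)
          · exact ⟨_, Or.inl rfl, by simp [Builtin.fv]⟩
          · obtain ⟨c, hc, hq⟩ := this.1 q hq; exact ⟨c, Or.inr hc, hq⟩
        · rintro q (rfl | hq)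
          · exact ⟨_, Or.inl rfl, by simp [Builtin.fv]⟩
          · obtain ⟨c, hc, hq⟩ := this.2 q hq; exact ⟨c, Or.inr hc, hq⟩
  unfold Comparable at h
  induction h with
  | nil => simp [listVars]
  | @cons x y H H' hxy _ ih =>
    have e : eqns (x :: H) (y :: H')
        = (List.zipWith Builtin.eq x.args y.args : Conj L) + eqns H H' := by
      simp [eqns]
    have k := key hxy.2
    rw [e, Conj.fv_add]
    constructor
    · intro z hz
      obtain ⟨p, hp, hzp⟩ := mem_listVars.1 hz
      rcases List.mem_cons.1 hp with rfl | hp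
      · obtain ⟨t, ht, hz⟩ := Atom.mem_vars.1 hzp
        obtain ⟨c, hc, hs⟩ := k.1 t ht
        exact Finset.mem_union_left _ (Conj.mem_fv.2 ⟨c, by simpa using hc, hs hz⟩)
      · exact Finset.mem_union_right _ (ih.1 (mem_listVars.2 ⟨p, hp, hzp⟩))
    · intro z hz
      obtain ⟨p, hp, hzp⟩ := mem_listVars.1 hz
      rcases List.mem_cons.1 hp with rfl | hp
      · obtain ⟨t, ht, hz⟩ := Atom.mem_vars.1 hzp
        obtain ⟨c, hc, hs⟩ := k.2 t ht
        exact Finset.mem_union_left _ (Conj.mem_fv.2 ⟨c, by simpa using hc, hs hz⟩)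
      · exact Finset.mem_union_right _ (ih.2 (mem_listVars.2 ⟨p, hp, hzp⟩))

end Sequences

/-! ### Firing a rule, independently of the choice of fresh variables -/

section Firing

variable {L : FirstOrder.Language.{u, v}} {κ : Type w} {ν : Type z}

/-- Models of the constraint theory, as they are used by `Conj.Entails`. -/
abbrev Model (CT : L.Theory) := FirstOrder.Language.Theory.ModelType.{u, v, max u v} CT

theorem mem_storeVars {S : Multiset (IAtom L κ)} {x : Var} :
    x ∈ storeVars S ↔ ∃ k ∈ S, x ∈ k.1.vars := by
  simp only [storeVars, Finset.mem_sup, Multiset.mem_toFinset, Multiset.mem_map, id]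
  constructor
  · rintro ⟨_, ⟨c, hc, rfl⟩, hx⟩; exact ⟨c, hc, hx⟩
  · rintro ⟨c, hc, hx⟩; exact ⟨_, ⟨c, hc, rfl⟩, hx⟩

namespace Rule

/-- The variables of a rule that enter a configuration when the rule fires: the guard is not
counted. -/
def coreVars (r : Rule L κ ν) : Finset Var := r.headVars ∪ storeVars r.chr ∪ r.builtin.fv

/-- The identifiers of the body of a rule. -/
def idSet (r : Rule L κ ν) : Finset ℕ := (r.chr.map Prod.snd).toFinset

theorem coreVars_subset_vars (r : Rule L κ ν) : r.coreVars ⊆ r.vars := by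
  intro x
  simp only [coreVars, vars, Finset.mem_union]
  tauto

theorem mem_idSet {r : Rule L κ ν} {i : ℕ} : i ∈ r.idSet ↔ ∃ k ∈ r.chr, k.2 = i := by
  simp [idSet]

theorem WellFormed.mem_idSet {r : Rule L κ ν} (h : r.WellFormed) {t : Token ν} (ht : t ∈ r.tokens)
    {i : ℕ} (hi : i ∈ t.2) : i ∈ r.idSet := by
  simpa [idSet] using h.tokens_ids t ht i hi

theorem headVars_rename (r : Rule L κ ν) (π : Equiv.Perm Var) :
    (r.rename π).headVars = r.headVars.image π := by
  simp only [headVars, rename, ← List.map_append, listVars_rename]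

theorem storeVars_rename (r : Rule L κ ν) (π : Equiv.Perm Var) :
    storeVars (r.rename π).chr = (storeVars r.chr).image π := by
  ext x
  simp only [mem_storeVars, rename, Multiset.mem_map, Finset.mem_image]
  constructor
  · rintro ⟨_, ⟨k, hk, rfl⟩, hx⟩
    simp only [Atom.vars_rename, Finset.mem_image] at hx
    obtain ⟨y, hy, rfl⟩ := hx
    exact ⟨y, ⟨k, hk, hy⟩, rfl⟩
  · rintro ⟨y, ⟨k, hk, hy⟩, rfl⟩
    exact ⟨_, ⟨k, hk, rfl⟩, by
      simp only [Atom.vars_rename]; exact Finset.mem_image_of_mem _ hy⟩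

theorem vars_rename (r : Rule L κ ν) (π : Equiv.Perm Var) :
    (r.rename π).vars = r.vars.image π := by
  simp only [vars, headVars_rename, storeVars_rename, Finset.image_union]
  simp only [rename, Conj.fv_rename]

end Rule

/-- The head of a rule matches at least one atom. -/
theorem ids_ne_nil {H₁ H₂ : List (IAtom L κ)} {r : Rule L κ ν} (hr : r.WellFormed)
    (h₁ : Comparable (chrs H₁) r.keep) (h₂ : Comparable (chrs H₂) r.remove) :
    CHR.ids (H₁ ++ H₂) ≠ [] := by
  intro h0
  have h1 := h₁.length_eq
  have h2 := h₂.length_eq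
  have h0' := congrArg List.length h0
  simp only [CHR.ids, chrs, List.length_map, List.length_append, List.length_nil] at h0' h1 h2
  refine hr.head_ne (List.append_eq_nil_iff.2 ⟨List.length_eq_zero_iff.1 ?_,
    List.length_eq_zero_iff.1 ?_⟩) <;> omega

/-- The criterion for the firing of a rule `r` on `K₁`, `K₂` under the store `C`, stated without
reference to a renaming of `r`: the variables of `r` are valued separately from those of `C`. The
variables of the guard outside the head are universally quantified, as `CT ⊨ C → ∃ x, …` demands. -/
def CanFire (CT : L.Theory) (C : Conj L) (K₁ K₂ : List (Atom L κ)) (r : Rule L κ ν) : Prop :=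
  Comparable K₁ r.keep ∧ Comparable K₂ r.remove ∧
  ∀ (M : Model CT) (a : Var → M), C.Realize a → ∀ u : Var → M,
    ∃ b : Var → M, (∀ y ∈ r.guard.fv, y ∉ r.headVars → b y = u y) ∧
      (K₁ ++ K₂).map (Atom.val a) = (r.keep ++ r.remove).map (Atom.val b) ∧ r.guard.Realize b

theorem CanFire.mono {CT : L.Theory} {C D : Conj L} {K₁ K₂ : List (Atom L κ)} {r : Rule L κ ν}
    (h : CanFire CT C K₁ K₂ r) (hD : ∀ (M : Model CT) (a : Var → M), D.Realize a → C.Realize a) :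
    CanFire CT D K₁ K₂ r :=
  ⟨h.1, h.2.1, fun M a ha => h.2.2 M a (hD M a ha)⟩

theorem canFire_rename {CT : L.Theory} {C : Conj L} {K₁ K₂ : List (Atom L κ)} {r : Rule L κ ν}
    (π : Equiv.Perm Var) : CanFire CT C K₁ K₂ (r.rename π) ↔ CanFire CT C K₁ K₂ r := by
  have hh := r.headVars_rename π
  unfold CanFire
  rw [hh]
  simp only [Rule.rename, Conj.fv_rename, Comparable.rename_right, ← List.map_append, vals_rename,
    Conj.realize_rename]
  refine and_congr_right fun _ => and_congr_right fun _ => forall₃_congr fun M a _ => ?_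
  constructor
  · intro h u
    obtain ⟨b, h1, h2, h3⟩ := h (u ∘ π.symm)
    refine ⟨b ∘ π, fun y hy hn => ?_, h2, h3⟩
    have := h1 (π y) (Finset.mem_image_of_mem _ hy) (by simpa using hn)
    simpa using this
  · intro h u
    obtain ⟨b, h1, h2, h3⟩ := h (u ∘ π)
    have hb : (b ∘ π.symm) ∘ π = b := by funext y; simp
    refine ⟨b ∘ π.symm, fun y hy hn => ?_, by rw [hb]; exact h2, by rw [hb]; exact h3⟩
    obtain ⟨x, hx, rfl⟩ := Finset.mem_image.1 hy
    have := h1 x hx fun h' => hn (Finset.mem_image_of_mem _ h')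
    simpa using this

theorem CanFire.rename_store {CT : L.Theory} {C : Conj L} {K₁ K₂ : List (Atom L κ)}
    {r : Rule L κ ν} (h : CanFire CT C K₁ K₂ r) (ρ : Equiv.Perm Var) :
    CanFire CT (C.map (Builtin.rename ρ)) (K₁.map (Atom.rename ρ)) (K₂.map (Atom.rename ρ)) r := by
  refine ⟨(Comparable.rename_left ρ).2 h.1, (Comparable.rename_left ρ).2 h.2.1, fun M a ha u => ?_⟩
  rw [← List.map_append, vals_rename]
  exact h.2.2 M _ ((Conj.realize_rename ρ).1 ha) u

/-- For a fresh rule, `CanFire` is the condition of the operational semantics. -/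
theorem entailsFiring_iff_canFire {CT : L.Theory} {C : Conj L} {K₁ K₂ : List (Atom L κ)}
    {r : Rule L κ ν} (hC : Disjoint r.vars C.fv) (hK : Disjoint r.vars (listVars (K₁ ++ K₂))) :
    EntailsFiring CT C K₁ K₂ r ↔ CanFire CT C K₁ K₂ r := by
  classical
  have hhv : ∀ x ∈ r.headVars, x ∈ r.vars := fun x hx => by simp [Rule.vars, hx]
  have hgv : ∀ x ∈ r.guard.fv, x ∈ r.vars := fun x hx => by simp [Rule.vars, hx]
  rw [Finset.disjoint_left] at hC hK
  constructor
  · rintro ⟨h1, h2, h⟩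
    refine ⟨h1, h2, fun M a ha u => ?_⟩
    obtain ⟨b, hb, hbe, hbg⟩ := h M (fun y => if y ∈ r.vars then u y else a y)
      ((Conj.realize_congr fun x hx => by
        have : x ∉ r.vars := fun h' => hC h' hx
        simp [this]).1 ha)
    refine ⟨b, fun y hy hn => by simpa [hgv y hy] using hb y hn, ?_, hbg⟩
    rw [← (eqns_realize (h1.append h2)).1 hbe]
    refine vals_congr _ fun x hx => ?_
    have hxv : x ∉ r.vars := fun h' => hK h' hx
    simpa [hxv] using (hb x fun h' => hxv (hhv x h')).symm
  · rintro ⟨h1, h2, h⟩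
    refine ⟨h1, h2, fun M a ha => ?_⟩
    obtain ⟨b, hb, hbe, hbg⟩ := h M a ha a
    refine ⟨fun y => if y ∈ r.headVars then b y else a y, fun y hy => by simp [hy], ?_, ?_⟩
    · rw [eqns_realize (h1.append h2)]
      have e1 : (K₁ ++ K₂).map (Atom.val fun y => if y ∈ r.headVars then b y else a y)
          = (K₁ ++ K₂).map (Atom.val a) := vals_congr _ fun x hx => by
        have : x ∉ r.headVars := fun h' => hK (hhv x h') hx
        simp [this]
      have e2 : (r.keep ++ r.remove).map (Atom.val fun y => if y ∈ r.headVars then b y else a y)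
          = (r.keep ++ r.remove).map (Atom.val b) := vals_congr _ fun x hx => by
        have : x ∈ r.headVars := hx
        simp [this]
      rw [e1, e2, hbe]
    · refine (Conj.realize_congr fun x hx => ?_).1 hbg
      by_cases hxh : x ∈ r.headVars
      · simp [hxh]
      · simp [hxh, hb x hx hxh]

/-- A configuration without its counter. -/
structure State (L : FirstOrder.Language.{u, v}) (κ : Type w) (ν : Type z) where
  chr : Multiset (IAtom L κ)
  builtin : Conj L
  store : Conj L
  history : Finset (Token ν)

/-- The free variables of a state. -/
def State.vars (s : State L κ ν) : Finset Var := storeVars s.chr ∪ s.builtin.fv ∪ s.store.fv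

/-- The instance of an identified atom under a renaming of variables and a map of identifiers. -/
def instAtom (π : Equiv.Perm Var) (ι : ℕ → ℕ) (k : IAtom L κ) : IAtom L κ := (k.1.rename π, ι k.2)

variable [DecidableEq ν]

/-- The effect of firing `r` on `H₁`, `H₂` with the variables of `r` renamed by `π` and the
identifiers of its body renamed by `ι`. -/
def fired (r : Rule L κ ν) (π : Equiv.Perm Var) (ι : ℕ → ℕ) (H₁ H₂ : List (IAtom L κ))
    (S : Multiset (IAtom L κ)) (B C : Conj L) (T : Finset (Token ν)) : State L κ ν where
  chr := r.chr.map (instAtom π ι) + ↑H₁ + S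
  builtin := r.builtin.map (Builtin.rename π) + B
  store := eqns (chrs (H₁ ++ H₂)) ((r.keep ++ r.remove).map (Atom.rename π)) + C
  history := T ∪ firedToken r (ids (H₁ ++ H₂)) ∪ r.tokens.image fun t => (t.1, t.2.map ι)

/-- The variables and identifiers chosen for the rule `r` are fresh for the state `s` and the
protected variables `V`. -/
structure FreshFor (V : Finset Var) (s : State L κ ν) (r : Rule L κ ν) (π : Equiv.Perm Var)
    (ι : ℕ → ℕ) : Prop where
  vars : ∀ x ∈ r.coreVars, π x ∉ V ∪ s.vars
  inj : Set.InjOn ι r.idSet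
  ids : ∀ i ∈ r.idSet, ∀ k ∈ s.chr, k.2 ≠ ι i
  tokens : ∀ i ∈ r.idSet, ∀ t ∈ s.history, ι i ∉ t.2

end Firing

/-! ### States that agree up to variables, identifiers and equivalence of the stores -/

section Simulation

variable {L : FirstOrder.Language.{u, v}} {κ : Type w} {ν : Type z}

/-- Two identifiers belong to corresponding atoms. -/
def IdRel (A : Multiset (IAtom L κ × IAtom L κ)) (i j : ℕ) : Prop :=
  ∃ p ∈ A, p.1.2 = i ∧ p.2.2 = j

/-- The valuations `a`, `b` give the same values to the variables of `V` and to corresponding atoms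
and built-in constraints. -/
def Agree (V : Finset Var) (A : Multiset (IAtom L κ × IAtom L κ))
    (B : Multiset (Builtin L × Builtin L)) {M : Type*} [L.Structure M] (a b : Var → M) : Prop :=
  (∀ x ∈ V, a x = b x) ∧ (∀ p ∈ A, p.1.1.val a = p.2.1.val b) ∧
    ∀ q ∈ B, q.1.Realize a ↔ q.2.Realize b

/-- The multisets `A` and `B` match the atoms and the pending built-in constraints of `s` with those
of `t` in such a way that whatever holds of `s` is matched by `t`. -/
structure HalfMatch (CT : L.Theory) (V : Finset Var) (A : Multiset (IAtom L κ × IAtom L κ))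
    (B : Multiset (Builtin L × Builtin L)) (s t : State L κ ν) : Prop where
  chr_left : s.chr = A.map Prod.fst
  chr_right : t.chr = A.map Prod.snd
  builtin_left : s.builtin = B.map Prod.fst
  builtin_right : t.builtin = B.map Prod.snd
  comparable : ∀ p ∈ A, p.1.1.pred = p.2.1.pred ∧ p.1.1.args.length = p.2.1.args.length
  ids_left : (s.chr.map Prod.snd).Nodup
  forth : ∀ (M : Model CT) (a : Var → M), s.store.Realize a →
    ∃ b : Var → M, t.store.Realize b ∧ Agree V A B a b
  history : ∀ (name : ν) (l l' : List ℕ), l ≠ [] → List.Forall₂ (IdRel A) l l' →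
    (name, l) ∈ s.history → (name, l') ∈ t.history

/-- A matching that works in both directions. -/
def Matches (CT : L.Theory) (V : Finset Var) (A : Multiset (IAtom L κ × IAtom L κ))
    (B : Multiset (Builtin L × Builtin L)) (s t : State L κ ν) : Prop :=
  HalfMatch CT V A B s t ∧ HalfMatch CT V (A.map Prod.swap) (B.map Prod.swap) t s

/-- `s` and `t` are the same up to the choice of variables and identifiers and up to equivalence of
the stores (projected to the variables that matter). -/
def Sim (CT : L.Theory) (V : Finset Var) (s t : State L κ ν) : Prop :=
  ∃ A B, Matches CT V A B s t

theorem Sim.symm {CT : L.Theory} {V : Finset Var} {s t : State L κ ν} (h : Sim CT V s t) :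
    Sim CT V t s := by
  obtain ⟨A, B, h1, h2⟩ := h
  exact ⟨A.map Prod.swap, B.map Prod.swap, h2, by simpa using h1⟩

theorem Sim.refl (CT : L.Theory) (V : Finset Var) (s : State L κ ν)
    (hs : (s.chr.map Prod.snd).Nodup) : Sim CT V s s := by
  have key : HalfMatch CT V (s.chr.map fun k => (k, k)) (s.builtin.map fun c => (c, c)) s s := by
    refine ⟨by simp, by simp, by simp, by simp, ?_, hs, ?_, ?_⟩
    · intro p hp
      obtain ⟨k, _, rfl⟩ := Multiset.mem_map.1 hp
      exact ⟨rfl, rfl⟩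
    · intro M a ha
      refine ⟨a, ha, fun _ _ => rfl, fun p hp => ?_, fun q hq => ?_⟩
      · obtain ⟨k, _, rfl⟩ := Multiset.mem_map.1 hp; rfl
      · obtain ⟨k, _, rfl⟩ := Multiset.mem_map.1 hq; rfl
    · intro name l l' _ hl h
      have : l = l' := by
        rw [← List.forall₂_eq_eq_eq]
        refine hl.imp fun i j hij => ?_
        obtain ⟨p, hp, rfl, rfl⟩ := hij
        obtain ⟨k, _, rfl⟩ := Multiset.mem_map.1 hp; rfl
      exact this ▸ h
  refine ⟨_, _, key, ?_⟩
  simpa [Multiset.map_map, Function.comp_def] using key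

theorem forall₂_imp_of_mem {α β : Type*} {R Q : α → β → Prop} {l : List α} {l' : List β}
    (h : List.Forall₂ R l l') (hQ : ∀ a ∈ l, ∀ b ∈ l', R a b → Q a b) : List.Forall₂ Q l l' := by
  induction h with
  | nil => exact List.Forall₂.nil
  | cons hab _ ih =>
    refine List.Forall₂.cons (hQ _ (by simp) _ (by simp) hab) (ih fun a ha b hb => hQ a ?_ b ?_)
    · exact List.mem_cons_of_mem _ ha
    · exact List.mem_cons_of_mem _ hb

theorem exists_list_of_map_eq {α β : Type*} (f : α → β) :
    ∀ (l : List β) (S : Multiset β) (A : Multiset α), A.map f = ↑l + S →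
      ∃ (l' : List α) (A' : Multiset α), A = ↑l' + A' ∧ l'.map f = l ∧ A'.map f = S
  | [], S, A, h => ⟨[], A, by simp, rfl, by simpa using h⟩
  | x :: l, S, A, h => by
    have hx : x ∈ A.map f := by rw [h]; simp
    obtain ⟨p, hp, rfl⟩ := Multiset.mem_map.1 hx
    obtain ⟨A', rfl⟩ := Multiset.exists_cons_of_mem hp
    obtain ⟨l', A'', rfl, h1, h2⟩ := exists_list_of_map_eq f l S A' (by
      rw [Multiset.map_cons, ← Multiset.cons_coe, Multiset.cons_add] at h
      exact (Multiset.cons_inj_right _).1 h)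
    exact ⟨p :: l', A'', by rw [← Multiset.cons_coe, Multiset.cons_add], by simp [h1], h2⟩

/-- Identifiers of the left state determine the matched pair. -/
theorem HalfMatch.rightUnique {CT : L.Theory} {V : Finset Var}
    {A : Multiset (IAtom L κ × IAtom L κ)} {B : Multiset (Builtin L × Builtin L)}
    {s t : State L κ ν} (h : HalfMatch CT V A B s t) : Relator.RightUnique (IdRel A) := by
  have hn := h.ids_left
  rw [h.chr_left, Multiset.map_map] at hn
  rintro i j j' ⟨p, hp, hp1, hp2⟩ ⟨q, hq, hq1, hq2⟩
  have : p = q := Multiset.inj_on_of_nodup_map hn p hp q hq (by simp [hp1, hq1])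
  rw [← hp2, ← hq2, this]

theorem CanFire.of_halfMatch {CT : L.Theory} {V : Finset Var} {h₁ h₂ : List (IAtom L κ × IAtom L κ)}
    {A : Multiset (IAtom L κ × IAtom L κ)} {B : Multiset (Builtin L × Builtin L)}
    {s t : State L κ ν} (h : HalfMatch CT V (Multiset.ofList h₁ + Multiset.ofList h₂ + A) B s t)
    {r : Rule L κ ν}
    (hf : CanFire CT t.store (chrs (h₁.map Prod.snd)) (chrs (h₂.map Prod.snd)) r) :
    CanFire CT s.store (chrs (h₁.map Prod.fst)) (chrs (h₂.map Prod.fst)) r := by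
  have hc : ∀ l : List (IAtom L κ × IAtom L κ), 
      (∀ p ∈ l, p ∈ (Multiset.ofList h₁ + Multiset.ofList h₂ + A)) →
      ∀ K, Comparable (chrs (l.map Prod.snd)) K → Comparable (chrs (l.map Prod.fst)) K := by
    intro l hl K hK
    simp only [Comparable, chrs, List.forall₂_map_left_iff] at hK ⊢
    refine forall₂_imp_of_mem hK fun p hp k _ hk => ?_
    have := h.comparable p (hl p hp)
    exact ⟨this.1.trans hk.1, this.2.trans hk.2⟩
  refine ⟨hc _ (fun p hp => by simp [hp]) _ hf.1, hc _ (fun p hp => by simp [hp]) _ hf.2.1,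
    fun M a ha u => ?_⟩
  obtain ⟨b, hb, hab⟩ := h.forth M a ha
  obtain ⟨b', h1, h2, h3⟩ := hf.2.2 M b hb u
  refine ⟨b', h1, ?_, h3⟩
  rw [← h2]
  simp only [chrs, List.map_append, List.map_map]
  congr 1 <;> exact List.map_congr_left fun p hp => hab.2.1 p (by simp [hp])

theorem nodup_ids_fired {r : Rule L κ ν} (hr : r.WellFormed) {π : Equiv.Perm Var} {ι : ℕ → ℕ}
    (hι : Set.InjOn ι r.idSet) {H₁ : List (IAtom L κ)} {S : Multiset (IAtom L κ)}
    (hn : ((Multiset.ofList H₁ + S).map Prod.snd).Nodup)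
    (hd : ∀ i ∈ r.idSet, ∀ k ∈ (Multiset.ofList H₁ + S), k.2 ≠ ι i) :
    ((r.chr.map (instAtom π ι) + ↑H₁ + S).map Prod.snd).Nodup := by
  rw [add_assoc, Multiset.map_add, Multiset.nodup_add]
  refine ⟨?_, hn, ?_⟩
  · have : (r.chr.map (instAtom π ι)).map Prod.snd = (r.chr.map Prod.snd).map ι := by
      simp only [Multiset.map_map]; rfl
    rw [this]
    refine Multiset.Nodup.map_on (fun i hi j hj hij => hι ?_ ?_ hij) hr.ids_nodup
    · simpa [Rule.idSet] using hi
    · simpa [Rule.idSet] using hj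
  · rw [Multiset.disjoint_left]
    intro i hi hi'
    simp only [Multiset.mem_map, Multiset.map_map, Function.comp_apply, instAtom] at hi hi'
    obtain ⟨k, hk, rfl⟩ := hi
    obtain ⟨k', hk', h⟩ := hi'
    exact hd k.2 (Rule.mem_idSet.2 ⟨k, hk, rfl⟩) k' hk' h

/-- The atoms of the body of `r`, instantiated in two ways. -/
def instPairs (r : Rule L κ ν) (π π' : Equiv.Perm Var) (ι ι' : ℕ → ℕ) :
    Multiset (IAtom L κ × IAtom L κ) :=
  r.chr.map fun k => (instAtom π ι k, instAtom π' ι' k)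

variable [DecidableEq ν]

/-- Firing the same rule on corresponding atoms preserves a matching, whatever fresh variables and
identifiers are chosen on the two sides. -/
theorem HalfMatch.fired {CT : L.Theory} {V : Finset Var} {h₁ h₂ : List (IAtom L κ × IAtom L κ)}
    {A : Multiset (IAtom L κ × IAtom L κ)} {B : Multiset (Builtin L × Builtin L)}
    {s t : State L κ ν} (h : HalfMatch CT V (Multiset.ofList h₁ + Multiset.ofList h₂ + A) B s t)
    {r : Rule L κ ν}
    (hr : r.WellFormed)
    (hc : Comparable (chrs ((h₁ ++ h₂).map Prod.fst)) (r.keep ++ r.remove))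
    (hc' : Comparable (chrs ((h₁ ++ h₂).map Prod.snd)) (r.keep ++ r.remove))
    {π π' : Equiv.Perm Var} {ι ι' : ℕ → ℕ} (hs : FreshFor V s r π ι) (ht : FreshFor V t r π' ι') :
    HalfMatch CT V (instPairs r π π' ι ι' + Multiset.ofList h₁ + A)
      (r.builtin.map (fun c => (c.rename π, c.rename π')) + B)
      (CHR.fired r π ι (h₁.map Prod.fst) (h₂.map Prod.fst) (A.map Prod.fst) s.builtin s.store
        s.history)
      (CHR.fired r π' ι' (h₁.map Prod.snd) (h₂.map Prod.snd) (A.map Prod.snd) t.builtin t.store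
        t.history) := by
  classical
  have hids : ∀ {i j : ℕ}, IdRel (Multiset.ofList h₁ + Multiset.ofList h₂ + A) i j →
      ∀ m ∈ r.idSet, i ≠ ι m := by
    rintro i j ⟨p, hp, rfl, _⟩ m hm
    exact hs.ids m hm p.1 (by rw [h.chr_left]; exact Multiset.mem_map_of_mem _ hp)
  have hrel : ∀ {i j : ℕ}, IdRel (instPairs r π π' ι ι' + Multiset.ofList h₁ + A) i j →
      (∃ m ∈ r.idSet, i = ι m ∧ j = ι' m) ∨
        IdRel (Multiset.ofList h₁ + Multiset.ofList h₂ + A) i j := by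
    rintro i j ⟨p, hp, rfl, rfl⟩
    simp only [Multiset.mem_add, instPairs, Multiset.mem_map, or_assoc] at hp
    rcases hp with ⟨k, hk, rfl⟩ | hp | hp
    · exact Or.inl ⟨k.2, Rule.mem_idSet.2 ⟨k, hk, rfl⟩, rfl, rfl⟩
    · exact Or.inr ⟨p, by simp only [Multiset.mem_add]; tauto, rfl, rfl⟩
    · exact Or.inr ⟨p, by simp only [Multiset.mem_add]; tauto, rfl, rfl⟩
  have hnew : ∀ {i j : ℕ}, IdRel (instPairs r π π' ι ι' + Multiset.ofList h₁ + A) i j →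
      ∀ m ∈ r.idSet, i = ι m →
      j = ι' m := by
    intro i j hij m hm him
    rcases hrel hij with ⟨m', hm', h1, h2⟩ | hij
    · rw [h2, hs.inj hm hm' (him.symm.trans h1)]
    · exact absurd him (hids hij m hm)
  refine ⟨?_, ?_, ?_, ?_, ?_, ?_, ?_, ?_⟩
  · simp [CHR.fired, instPairs, Multiset.map_map]
  · simp [CHR.fired, instPairs, Multiset.map_map]
  · simp [CHR.fired, Multiset.map_map, h.builtin_left]
  · simp [CHR.fired, Multiset.map_map, h.builtin_right]
  · intro p hp
    simp only [Multiset.mem_add, instPairs, Multiset.mem_map, or_assoc] at hp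
    rcases hp with ⟨k, hk, rfl⟩ | hp | hp
    · simp [instAtom, Atom.rename]
    · exact h.comparable p (by simp only [Multiset.mem_add]; tauto)
    · exact h.comparable p (by simp only [Multiset.mem_add]; tauto)
  · refine nodup_ids_fired hr hs.inj ?_ fun i hi k hk => hs.ids i hi k ?_
    · refine Multiset.nodup_of_le (Multiset.map_le_map ?_) h.ids_left
      rw [h.chr_left, Multiset.map_add, Multiset.map_add, Multiset.map_coe, Multiset.map_coe,
        add_right_comm]
      exact Multiset.le_add_right _ _
    · rw [h.chr_left, Multiset.map_add, Multiset.map_add, Multiset.map_coe, Multiset.map_coe]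
      simp only [Multiset.mem_add] at hk ⊢
      tauto
  · intro M a ha
    obtain ⟨hae, has⟩ := Conj.realize_add.1 ha
    obtain ⟨b₀, hb₀, hV, hA, hB⟩ := h.forth M a has
    set b : Var → M := fun y => if π'.symm y ∈ r.coreVars then a (π (π'.symm y)) else b₀ y with hb
    have hbnew : ∀ x ∈ r.coreVars, (b ∘ π') x = (a ∘ π) x := fun x hx => by simp [hb, hx]
    have hbold : ∀ y ∈ V ∪ t.vars, b₀ y = b y := by
      intro y hy
      have : π'.symm y ∉ r.coreVars := fun h' => ht.vars _ h' (by simpa using hy)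
      simp [hb, this]
    have hbatom : ∀ p ∈ (Multiset.ofList h₁ + Multiset.ofList h₂ + A),
        p.1.1.val a = p.2.1.val b := by
      intro p hp
      rw [hA p hp]
      refine Atom.val_congr _ fun x hx => hbold x ?_
      have : x ∈ storeVars t.chr :=
        mem_storeVars.2 ⟨p.2, by rw [h.chr_right]; exact Multiset.mem_map_of_mem _ hp, hx⟩
      simp [State.vars, this]
    refine ⟨b, Conj.realize_add.2 ⟨?_, ?_⟩, ?_, ?_, ?_⟩
    · rw [← List.map_append, eqns_realize ((Comparable.rename_right _).2 hc), vals_rename] at hae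
      rw [← List.map_append, eqns_realize ((Comparable.rename_right _).2 hc'), vals_rename]
      rw [vals_congr (a := b ∘ π') (b := a ∘ π) (r.keep ++ r.remove) fun x hx => hbnew x (by
        simp only [Rule.coreVars, Finset.mem_union]; exact Or.inl (Or.inl hx)), ← hae]
      simp only [chrs, List.map_map]
      refine (List.map_congr_left fun p hp => hbatom p ?_).symm
      simp only [Multiset.mem_add, Multiset.mem_coe]
      rw [List.mem_append] at hp
      tauto
    · refine (Conj.realize_congr fun x hx => hbold x ?_).1 hb₀
      simp [State.vars, hx]
    · intro x hx
      rw [hV x hx]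
      exact hbold x (by simp [hx])
    · intro p hp
      simp only [Multiset.mem_add, instPairs, Multiset.mem_map, or_assoc] at hp
      rcases hp with ⟨k, hk, rfl⟩ | hp | hp
      · simp only [instAtom, Atom.val_rename]
        refine (Atom.val_congr _ fun x hx => hbnew x ?_).symm
        have : x ∈ storeVars r.chr := mem_storeVars.2 ⟨k, hk, hx⟩
        simp [Rule.coreVars, this]
      · exact hbatom p (by simp only [Multiset.mem_add]; tauto)
      · exact hbatom p (by simp only [Multiset.mem_add]; tauto)
    · intro q hq
      rcases Multiset.mem_add.1 hq with hq | hq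
      · obtain ⟨c, hc, rfl⟩ := Multiset.mem_map.1 hq
        simp only [Builtin.realize_rename]
        refine (Builtin.realize_congr c fun x hx => hbnew x ?_).symm
        have : x ∈ r.builtin.fv := Conj.mem_fv.2 ⟨c, hc, hx⟩
        simp [Rule.coreVars, this]
      · rw [hB q hq]
        refine Builtin.realize_congr _ fun x hx => hbold x ?_
        have : x ∈ t.builtin.fv := Conj.mem_fv.2
          ⟨q.2, by rw [h.builtin_right]; exact Multiset.mem_map_of_mem _ hq, hx⟩
        simp [State.vars, this]
  · intro name l l' hl hll ht'
    simp only [CHR.fired, Finset.mem_union, Finset.mem_image, Prod.mk.injEq] at ht' ⊢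
    rcases ht' with (ht' | ht') | ⟨t, htr, rfl, rfl⟩
    · refine Or.inl (Or.inl (h.history name l l' hl ?_ ht'))
      refine forall₂_imp_of_mem hll fun i hi j _ hij => ?_
      rcases hrel hij with ⟨m, hm, rfl, _⟩ | hij
      · exact absurd hi (hs.tokens m hm _ ht')
      · exact hij
    · refine Or.inl (Or.inr ?_)
      unfold firedToken at ht' ⊢
      split at ht'
      · rename_i hrem
        rw [if_pos hrem]
        simp only [Finset.mem_singleton, Prod.mk.injEq] at ht' ⊢
        obtain ⟨rfl, rfl⟩ := ht'
        refine ⟨rfl, List.right_unique_forall₂' h.rightUnique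
          (forall₂_imp_of_mem hll fun i hi j _ hij => ?_) ?_⟩
        · rcases hrel hij with ⟨m, hm, rfl, _⟩ | hij
          · exfalso
            rw [← List.map_append] at hi
            simp only [CHR.ids, List.map_map, List.mem_map] at hi
            obtain ⟨p, hp, hp'⟩ := hi
            refine hs.ids m hm p.1 ?_ hp'
            rw [h.chr_left]
            refine Multiset.mem_map_of_mem _ ?_
            simp only [Multiset.mem_add, Multiset.mem_coe]
            rw [List.mem_append] at hp
            tauto
          · exact hij
        · rw [← List.map_append, ← List.map_append]
          simp only [CHR.ids, List.map_map, List.forall₂_map_left_iff, List.forall₂_map_right_iff,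
            List.forall₂_same]
          intro p hp
          refine ⟨p, ?_, rfl, rfl⟩
          simp only [Multiset.mem_add, Multiset.mem_coe]
          rw [List.mem_append] at hp
          tauto
      · simp at ht'
    · refine Or.inr ⟨t, htr, rfl, ?_⟩
      rw [← List.forall₂_eq_eq_eq]
      rw [List.forall₂_map_left_iff] at hll ⊢
      refine forall₂_imp_of_mem hll fun i hi j _ hij => (hnew hij i ?_ rfl).symm
      exact hr.mem_idSet htr hi

/-- A firing in a state can be copied, with any fresh variables and identifiers, in a similar
state. -/
theorem Sim.fired {CT : L.Theory} {V : Finset Var} {s t : State L κ ν} (h : Sim CT V s t)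
    {r : Rule L κ ν} (hr : r.WellFormed) {H₁ H₂ : List (IAtom L κ)} {S : Multiset (IAtom L κ)}
    (hchr : s.chr = ↑H₁ + ↑H₂ + S) (hf : CanFire CT s.store (chrs H₁) (chrs H₂) r)
    (htok : (r.name, ids (H₁ ++ H₂)) ∉ s.history) :
    ∃ (H₁' H₂' : List (IAtom L κ)) (S' : Multiset (IAtom L κ)), t.chr = ↑H₁' + ↑H₂' + S' ∧
      CanFire CT t.store (chrs H₁') (chrs H₂') r ∧ (r.name, ids (H₁' ++ H₂')) ∉ t.history ∧
      ∀ (π π' : Equiv.Perm Var) (ι ι' : ℕ → ℕ), FreshFor V s r π ι → FreshFor V t r π' ι' →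
        Sim CT V (CHR.fired r π ι H₁ H₂ S s.builtin s.store s.history)
          (CHR.fired r π' ι' H₁' H₂' S' t.builtin t.store t.history) := by
  obtain ⟨A, B, h1, h2⟩ := h
  have e := h1.chr_left.symm.trans hchr
  rw [add_assoc] at e
  obtain ⟨h₁, A', rfl, rfl, e'⟩ := exists_list_of_map_eq Prod.fst H₁ _ A e
  obtain ⟨h₂, A, rfl, rfl, rfl⟩ := exists_list_of_map_eq Prod.fst H₂ _ A' e'
  rw [← add_assoc] at h1 h2
  simp only [Multiset.map_add, Multiset.map_coe] at h2
  have hf' := CanFire.of_halfMatch (h₁ := h₁.map Prod.swap) (h₂ := h₂.map Prod.swap) h2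
    (by simpa [Function.comp_def] using hf)
  refine ⟨h₁.map Prod.snd, h₂.map Prod.snd, A.map Prod.snd, by simp [h1.chr_right],
    by simpa [Function.comp_def] using hf', fun hm => htok ?_, fun π π' ι ι' hs ht => ?_⟩
  · refine h2.history _ (ids (h₁.map Prod.snd ++ h₂.map Prod.snd)) _ ?_ ?_ hm
    · exact ids_ne_nil hr (by simpa [Function.comp_def] using hf'.1)
        (by simpa [Function.comp_def] using hf'.2.1)
    · simp only [← List.map_append, CHR.ids, List.map_map, List.forall₂_map_left_iff,
        List.forall₂_map_right_iff, List.forall₂_same]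
      intro p hp
      refine ⟨p.swap, ?_, rfl, rfl⟩
      rw [List.mem_append] at hp
      simp only [Multiset.mem_add, Multiset.mem_coe, List.mem_map]
      rcases hp with hp | hp
      · exact Or.inl (Or.inl ⟨p, hp, rfl⟩)
      · exact Or.inl (Or.inr ⟨p, hp, rfl⟩)
  · have hc : Comparable (chrs ((h₁ ++ h₂).map Prod.fst)) (r.keep ++ r.remove) := by
      simpa [chrs] using hf.1.append hf.2.1
    have hc' : Comparable (chrs ((h₁ ++ h₂).map Prod.snd)) (r.keep ++ r.remove) := by
      simpa [chrs, Function.comp_def] using hf'.1.append hf'.2.1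
    have g1 := h1.fired hr hc hc' hs ht
    have g2 := HalfMatch.fired (h₁ := h₁.map Prod.swap) (h₂ := h₂.map Prod.swap) h2 hr
      (by simpa [Function.comp_def] using hc') (by simpa [Function.comp_def] using hc) ht hs
    refine ⟨_, _, g1, ?_⟩
    simpa [Function.comp_def, Multiset.map_map, instPairs] using g2

end Simulation

/-! ### A machine without reuse of variables and identifiers -/

section Machine

variable {L : FirstOrder.Language.{u, v}} {κ : Type w} {ν : Type z}

/-- A state together with the variables and the identifiers used so far. -/
structure LState (L : FirstOrder.Language.{u, v}) (κ : Type w) (ν : Type z)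
    extends State L κ ν where
  usedVars : Finset Var
  usedIds : Finset ℕ

/-- The configuration without its counter. -/
def Config.state (σ : Config L κ ν) : State L κ ν := ⟨σ.chr, σ.builtin, σ.store, σ.history⟩

theorem mem_ids_append {H₁ H₂ : List (IAtom L κ)} {i : ℕ} :
    i ∈ ids (H₁ ++ H₂) ↔ ∃ k, (k ∈ H₁ ∨ k ∈ H₂) ∧ k.2 = i := by
  simp [CHR.ids, or_and_right, exists_or]

theorem listVars_chrs_subset {H₁ H₂ : List (IAtom L κ)} {S : Multiset (IAtom L κ)} :
    listVars (chrs (H₁ ++ H₂)) ⊆ storeVars (Multiset.ofList H₁ + Multiset.ofList H₂ + S) := by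
  intro x hx
  obtain ⟨h, hh, hx⟩ := mem_listVars.1 hx
  obtain ⟨k, hk, rfl⟩ := List.mem_map.1 hh
  refine mem_storeVars.2 ⟨k, ?_, hx⟩
  rw [List.mem_append] at hk
  simp only [Multiset.mem_add, Multiset.mem_coe]
  exact Or.inl hk

theorem mem_firedToken {r : Rule L κ ν} {is : List ℕ} {t : Token ν} (h : t ∈ firedToken r is) :
    t = (r.name, is) := by
  unfold firedToken at h
  split at h
  · exact Finset.mem_singleton.1 h
  · simp at h

theorem firedToken_rename (r : Rule L κ ν) (π : Equiv.Perm Var) (is : List ℕ) :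
    firedToken (r.rename π) is = firedToken r is := by
  simp [firedToken, Rule.rename]

variable [DecidableEq ν]

/-- Transitions of a machine in which a constraint is solved by adding it literally to the store,
and in which a rule `r` is used with variables and identifiers never used before. The freshness is
demanded, and recorded, for the variables in `fr r` and for the identifiers in `fi r`. -/
inductive LStep (CT : L.Theory) (fr : Rule L κ ν → Finset Var) (fi : Rule L κ ν → Finset ℕ)
    (P : Set (Rule L κ ν)) : LState L κ ν → LState L κ ν → Prop
  | solve (S : Multiset (IAtom L κ)) (c : Builtin L) (B C : Conj L) (T : Finset (Token ν))
      (U : Finset Var) (I : Finset ℕ) :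
      LStep CT fr fi P ⟨⟨S, c ::ₘ B, C, T⟩, U, I⟩ ⟨⟨S, B, c ::ₘ C, T⟩, U, I⟩
  | apply (r : Rule L κ ν) (hr : r ∈ P) (π : Equiv.Perm Var) (ι : ℕ → ℕ) (H₁ H₂ : List (IAtom L κ))
      (S : Multiset (IAtom L κ)) (B C : Conj L) (T : Finset (Token ν)) (U : Finset Var)
      (I : Finset ℕ) (hvars : ∀ x ∈ fr r, π x ∉ U) (hinj : Set.InjOn ι (fi r))
      (hids : ∀ i ∈ fi r, ι i ∉ I) (can : CanFire CT C (chrs H₁) (chrs H₂) r)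
      (htok : (r.name, ids (H₁ ++ H₂)) ∉ T) :
      LStep CT fr fi P ⟨⟨Multiset.ofList H₁ + Multiset.ofList H₂ + S, B, C, T⟩, U, I⟩
        ⟨fired r π ι H₁ H₂ S B C T, U ∪ (fr r).image π, I ∪ (fi r).image ι⟩

/-- At least the variables and identifiers that enter the state are recorded. -/
structure IsPolicy (fr : Rule L κ ν → Finset Var) (fi : Rule L κ ν → Finset ℕ) : Prop where
  vars : ∀ r, r.coreVars ⊆ fr r
  ids : ∀ r, r.idSet ⊆ fi r

/-- The invariants of the machine: everything in the state has been recorded as used, and the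
identifiers in the store are pairwise distinct. -/
structure LGood (V : Finset Var) (l : LState L κ ν) : Prop where
  protected_vars : V ⊆ l.usedVars
  vars : l.toState.vars ⊆ l.usedVars
  nodup : (l.chr.map Prod.snd).Nodup
  ids : ∀ k ∈ l.chr, k.2 ∈ l.usedIds
  tokens : ∀ t ∈ l.history, ∀ i ∈ t.2, i ∈ l.usedIds

/-- The variables in a state after a firing. -/
theorem vars_fired_subset {r : Rule L κ ν} {π : Equiv.Perm Var} {ι : ℕ → ℕ}
    {H₁ H₂ : List (IAtom L κ)} {S : Multiset (IAtom L κ)} {B C : Conj L} {T : Finset (Token ν)} :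
    (fired r π ι H₁ H₂ S B C T).vars
      ⊆ (⟨Multiset.ofList H₁ + Multiset.ofList H₂ + S, B, C, T⟩ : State L κ ν).vars ∪
        r.coreVars.image π := by
  intro x hx
  simp only [fired, State.vars, Conj.fv_add, Conj.fv_rename, Finset.mem_union] at hx
  rw [Finset.mem_union]
  have hH : ∀ k, (k ∈ H₁ ∨ k ∈ S) → x ∈ k.1.vars →
      x ∈ (⟨Multiset.ofList H₁ + Multiset.ofList H₂ + S, B, C, T⟩ : State L κ ν).vars := by
    intro k hk hx
    have : x ∈ storeVars (Multiset.ofList H₁ + Multiset.ofList H₂ + S) :=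
      mem_storeVars.2 ⟨k, by simp only [Multiset.mem_add, Multiset.mem_coe]; tauto, hx⟩
    simp only [State.vars, Finset.mem_union, this, true_or]
  rcases hx with (hx | hx | hx) | hx | hx
  · obtain ⟨k, hk, hx⟩ := mem_storeVars.1 hx
    simp only [Multiset.mem_add, Multiset.mem_map, Multiset.mem_coe] at hk
    rcases hk with (⟨k, hk, rfl⟩ | hk) | hk
    · right
      simp only [instAtom, Atom.vars_rename] at hx
      refine Finset.image_subset_image (fun y hy => ?_) hx
      have : y ∈ storeVars r.chr := mem_storeVars.2 ⟨k, hk, hy⟩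
      simp [Rule.coreVars, this]
    · exact Or.inl (hH k (Or.inl hk) hx)
    · exact Or.inl (hH k (Or.inr hk) hx)
  · right
    refine Finset.image_subset_image (fun y hy => ?_) hx
    simp [Rule.coreVars, hy]
  · left; simp [State.vars, hx]
  · rcases Finset.mem_union.1 (fv_eqns_subset _ _ hx) with hx | hx
    · left
      have := listVars_chrs_subset (S := S) hx
      simp only [State.vars, Finset.mem_union, this, true_or]
    · right
      rw [listVars_rename] at hx
      refine Finset.image_subset_image (fun y hy => ?_) hx
      simp only [Rule.coreVars, Finset.mem_union]
      exact Or.inl (Or.inl hy)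
  · left; simp [State.vars, hx]

/-- The invariants are kept by a firing with fresh variables and identifiers. -/
theorem LGood.fired {V : Finset Var} {r : Rule L κ ν} (hr : r.WellFormed) {π : Equiv.Perm Var}
    {ι : ℕ → ℕ} {H₁ H₂ : List (IAtom L κ)} {S : Multiset (IAtom L κ)} {B C : Conj L}
    {T : Finset (Token ν)} {U U' : Finset Var} {I I' : Finset ℕ}
    (h : LGood V ⟨⟨Multiset.ofList H₁ + Multiset.ofList H₂ + S, B, C, T⟩, U, I⟩)
    (hinj : Set.InjOn ι r.idSet)
    (hids : ∀ i ∈ r.idSet, ι i ∉ I) (hU : U ⊆ U') (hI : I ⊆ I') (hU' : r.coreVars.image π ⊆ U')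
    (hI' : r.idSet.image ι ⊆ I') : LGood V ⟨fired r π ι H₁ H₂ S B C T, U', I'⟩ := by
  have hk : ∀ k, (k ∈ H₁ ∨ k ∈ H₂ ∨ k ∈ S) → k.2 ∈ I := fun k hk =>
    h.ids k (by simp only [Multiset.mem_add, Multiset.mem_coe]; tauto)
  refine ⟨h.protected_vars.trans hU, fun x hx => ?_, ?_, fun k hk' => ?_, fun t ht i hi => ?_⟩
  · rcases Finset.mem_union.1 (vars_fired_subset hx) with hx | hx
    · exact hU (h.vars hx)
    · exact hU' hx
  · refine nodup_ids_fired hr hinj ?_ fun i hi k hk' => ?_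
    · refine Multiset.nodup_of_le (Multiset.map_le_map ?_) h.nodup
      show _ ≤ (Multiset.ofList H₁ + Multiset.ofList H₂ + S : Multiset (IAtom L κ))
      rw [add_right_comm]
      exact Multiset.le_add_right _ _
    · intro he
      refine hids i hi (he ▸ hk k ?_)
      simp only [Multiset.mem_add, Multiset.mem_coe] at hk'
      tauto
  · simp only [CHR.fired, Multiset.mem_add, Multiset.mem_map, Multiset.mem_coe] at hk'
    rcases hk' with (⟨k, hk', rfl⟩ | hk') | hk'
    · exact hI' (Finset.mem_image_of_mem _ (Rule.mem_idSet.2 ⟨k, hk', rfl⟩))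
    · exact hI (hk k (by tauto))
    · exact hI (hk k (by tauto))
  · simp only [CHR.fired, Finset.mem_union, Finset.mem_image] at ht
    rcases ht with (ht | ht) | ⟨t, ht, rfl⟩
    · exact hI (h.tokens t ht i hi)
    · obtain rfl := mem_firedToken ht
      obtain ⟨k, hk', rfl⟩ := mem_ids_append.1 hi
      exact hI (hk k (by tauto))
    · obtain ⟨j, hj, rfl⟩ := List.mem_map.1 hi
      exact hI' (Finset.mem_image_of_mem _ (hr.mem_idSet ht hj))

theorem LGood.step {CT : L.Theory} {V : Finset Var} {P : Set (Rule L κ ν)}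
    (hP : IsAnnotatedProgram P) {fr : Rule L κ ν → Finset Var} {fi : Rule L κ ν → Finset ℕ}
    (hp : IsPolicy fr fi) {l l' : LState L κ ν} (h : LGood V l) (hs : LStep CT fr fi P l l') :
    LGood V l' := by
  cases hs with
  | solve S c B C T U I =>
    refine ⟨h.protected_vars, fun x hx => h.vars ?_, h.nodup, h.ids, h.tokens⟩
    simp only [State.vars, Conj.fv_cons, Finset.mem_union] at hx ⊢
    tauto
  | apply r hr π ι H₁ H₂ S B C T U I hvars hinj hids can htok =>
    exact h.fired (hP r hr) (hinj.mono (hp.ids r)) (fun i hi => hids i (hp.ids r hi))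
      Finset.subset_union_left Finset.subset_union_left
      ((Finset.image_subset_image (hp.vars r)).trans Finset.subset_union_right)
      ((Finset.image_subset_image (hp.ids r)).trans Finset.subset_union_right)

theorem exists_fresh_perm (s U : Finset Var) : ∃ π : Equiv.Perm Var, ∀ x ∈ s, π x ∉ U := by
  let N : ℕ := (s ∪ U).sup id + 1
  have hN : ∀ x ∈ s ∪ U, (show ℕ from x) < N := fun x hx =>
    Nat.lt_succ_of_le (Finset.le_sup (f := id) hx)
  let f : ℕ → ℕ := fun x => if x < N then x + N else if x < 2 * N then x - N else x
  have hf : Function.Involutive f := by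
    intro x
    simp only [f]
    split_ifs <;> omega
  refine ⟨hf.toPerm, fun x hx hU => ?_⟩
  have h1 := hN x (Finset.mem_union_left _ hx)
  have h2 := hN _ (Finset.mem_union_right _ hU)
  simp only [Function.Involutive.coe_toPerm, f] at h2
  rw [if_pos h1] at h2
  have : (show ℕ from x) + N < N := h2
  omega

/-! ### Qualified answers computed by the machine -/

/-- No transition is possible in a configuration with this state. -/
def State.Final (CT : L.Theory) (P : Set (Rule L κ ν)) (s : State L κ ν) : Prop :=
  s.builtin = 0 ∧ ∀ r ∈ P, ∀ (H₁ H₂ : List (IAtom L κ)) (S : Multiset (IAtom L κ)),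
    s.chr = Multiset.ofList H₁ + Multiset.ofList H₂ + S → CanFire CT s.store (chrs H₁) (chrs H₂) r →
      (r.name, ids (H₁ ++ H₂)) ∈ s.history

/-- `A` is a qualified answer read off from the state `s`. -/
def State.IsAnswer (CT : L.Theory) (P : Set (Rule L κ ν)) (V : Finset Var) (s : State L κ ν)
    (A : Answer L κ) : Prop :=
  (s.Final CT P ∧ A.Equivalent CT V ⟨s.chr.map Prod.fst, s.store⟩) ∨
    (¬ s.store.Satisfiable CT ∧ ¬ A.store.Satisfiable CT)

theorem HalfMatch.meaning_subset {CT : L.Theory} {V : Finset Var}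
    {A : Multiset (IAtom L κ × IAtom L κ)} {B : Multiset (Builtin L × Builtin L)}
    {s t : State L κ ν} (h : HalfMatch CT V A B s t) (M : Model CT) (a : Var → M) :
    Answer.meaning V (⟨s.chr.map Prod.fst, s.store⟩ : Answer L κ) a
      ⊆ Answer.meaning V (⟨t.chr.map Prod.fst, t.store⟩ : Answer L κ) a := by
  rintro m ⟨b, hb, hs, rfl⟩
  obtain ⟨b', ht, hV, hA, _⟩ := h.forth M b hs
  refine ⟨b', fun x hx => (hV x hx).symm.trans (hb x hx), ht, ?_⟩
  simp only [h.chr_left, h.chr_right, Multiset.map_map]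
  exact Multiset.map_congr rfl fun p hp => hA p hp

theorem Sim.isAnswer {CT : L.Theory} {V : Finset Var} {P : Set (Rule L κ ν)}
    (hP : IsAnnotatedProgram P) {s t : State L κ ν} (h : Sim CT V s t) {A : Answer L κ}
    (hA : s.IsAnswer CT P V A) : t.IsAnswer CT P V A := by
  obtain ⟨Q, B, h1, h2⟩ := id h
  rcases hA with ⟨⟨hb, hf⟩, hA⟩ | ⟨hs, hA⟩
  · refine Or.inl ⟨⟨?_, fun r hr H₁ H₂ S hchr hcan => ?_⟩, fun M a => ?_⟩
    · have := h1.builtin_left.symm.trans hb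
      rw [Multiset.map_eq_zero] at this
      simp [h1.builtin_right, this]
    · by_contra htok
      obtain ⟨H₁', H₂', S', hchr', hcan', htok', _⟩ := h.symm.fired (hP r hr) hchr hcan htok
      exact htok' (hf r hr H₁' H₂' S' hchr' hcan')
    · rw [hA M a]
      exact (h1.meaning_subset M a).antisymm (h2.meaning_subset M a)
  · refine Or.inr ⟨?_, hA⟩
    rintro ⟨M, a, ha⟩
    obtain ⟨b, hb, _⟩ := h2.forth M a ha
    exact hs ⟨M, b, hb⟩

theorem HalfMatch.solve {CT : L.Theory} {V : Finset Var}
    {A : Multiset (IAtom L κ × IAtom L κ)} {B : Multiset (Builtin L × Builtin L)}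
    {c c' : Builtin L} {s t : State L κ ν} (h : HalfMatch CT V A ((c, c') ::ₘ B) s t)
    {C C' : Conj L} (hC : Conj.Equivalent CT (c ::ₘ s.store) C)
    (hC' : Conj.Equivalent CT (c' ::ₘ t.store) C') :
    HalfMatch CT V A B ⟨s.chr, B.map Prod.fst, C, s.history⟩
      ⟨t.chr, B.map Prod.snd, C', t.history⟩ := by
  refine ⟨h.chr_left, h.chr_right, rfl, rfl, h.comparable, h.ids_left, fun M a ha => ?_, h.history⟩
  obtain ⟨hc, hs⟩ := Conj.realize_cons.1 (hC.2 M a ha)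
  obtain ⟨b, hb, hV, hA, hB⟩ := h.forth M a hs
  refine ⟨b, hC'.1 M b (Conj.realize_cons.2 ⟨?_, hb⟩), hV, hA, fun q hq => hB q (by simp [hq])⟩
  exact (hB (c, c') (by simp)).1 hc

theorem Sim.solve {CT : L.Theory} {V : Finset Var} {S : Multiset (IAtom L κ)} {c : Builtin L}
    {B C C₁ : Conj L} {T : Finset (Token ν)} {t : State L κ ν}
    (h : Sim CT V ⟨S, c ::ₘ B, C, T⟩ t) (hC : Conj.Equivalent CT (c ::ₘ C) C₁) :
    ∃ c' B', t.builtin = c' ::ₘ B' ∧ ∀ C', Conj.Equivalent CT (c' ::ₘ t.store) C' →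
      Sim CT V ⟨S, B, C₁, T⟩ ⟨t.chr, B', C', t.history⟩ := by
  obtain ⟨A, Q, h1, h2⟩ := h
  have hc : c ∈ Q.map Prod.fst := by rw [← h1.builtin_left]; simp
  obtain ⟨⟨c, c'⟩, hq, rfl⟩ := Multiset.mem_map.1 hc
  obtain ⟨Q, rfl⟩ := Multiset.exists_cons_of_mem hq
  have hB : B = Q.map Prod.fst := by
    have := h1.builtin_left
    simpa using this
  refine ⟨c', Q.map Prod.snd, by simp [h1.builtin_right], fun C' hC' => ⟨A, Q, ?_, ?_⟩⟩
  · simpa [hB] using h1.solve hC hC'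
  · rw [Multiset.map_cons] at h2
    simpa [hB, Multiset.map_map] using HalfMatch.solve h2 hC' hC

/-- The identifiers in a configuration do not exceed its counter. -/
structure Config.Bounded (σ : Config L κ ν) : Prop where
  ids : ∀ k ∈ σ.chr, k.2 ≤ σ.counter
  tokens : ∀ t ∈ σ.history, ∀ i ∈ t.2, i ≤ σ.counter

theorem le_maxId_of_mem {S : Multiset (IAtom L κ)} {T : Finset (Token ν)} {k : IAtom L κ}
    (hk : k ∈ S) : k.2 ≤ maxId S T :=
  le_max_of_le_left (Multiset.le_sup (Multiset.mem_map_of_mem _ hk))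

theorem le_maxId_of_mem_tokens {S : Multiset (IAtom L κ)} {T : Finset (Token ν)} {t : Token ν}
    (ht : t ∈ T) {i : ℕ} (hi : i ∈ t.2) : i ≤ maxId S T := by
  have h1 : i ≤ t.2.toFinset.sup id := Finset.le_sup (f := id) (by simpa using hi)
  have h2 : t.2.toFinset.sup id ≤ T.sup fun t => t.2.toFinset.sup id :=
    Finset.le_sup (f := fun t : Token ν => t.2.toFinset.sup id) ht
  exact le_max_of_le_right (h1.trans h2)

theorem Config.Bounded.step {CT : L.Theory} {V : Finset Var} {P : Set (Rule L κ ν)}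
    {σ σ' : Config L κ ν} (h : σ.Bounded) (hs : Step CT P V σ σ') : σ'.Bounded := by
  cases hs with
  | solve S c B C C' T n hC => exact ⟨h.ids, h.tokens⟩
  | apply r₀ hr π r hπ H₁ H₂ S B C T n fresh fires token =>
    have hk : ∀ k, (k ∈ H₁ ∨ k ∈ H₂ ∨ k ∈ S) → k.2 ≤ n := fun k hk =>
      h.ids k (by simp only [Multiset.mem_add, Multiset.mem_coe]; tauto)
    constructor
    · intro k hk'
      simp only [inst, Multiset.mem_add, Multiset.mem_map, Multiset.mem_coe] at hk' ⊢
      rcases hk' with (⟨k, hk', rfl⟩ | hk') | hk'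
      · have := le_maxId_of_mem (T := r.tokens) hk'
        show k.2 + n ≤ _
        omega
      · exact (hk k (by tauto)).trans (Nat.le_add_right _ _)
      · exact (hk k (by tauto)).trans (Nat.le_add_right _ _)
    · intro t ht i hi
      simp only [inst, Finset.mem_union, Finset.mem_image] at ht ⊢
      rcases ht with (ht | ht) | ⟨t, ht, rfl⟩
      · exact (h.tokens t ht i hi).trans (Nat.le_add_right _ _)
      · obtain rfl := mem_firedToken ht
        obtain ⟨k, hk', rfl⟩ := mem_ids_append.1 hi
        exact (hk k (by tauto)).trans (Nat.le_add_right _ _)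
      · obtain ⟨j, hj, rfl⟩ := List.mem_map.1 hi
        have := le_maxId_of_mem_tokens (S := r.chr) ht hj
        omega

theorem freshFor_of_bounded {V : Finset Var} {σ : Config L κ ν} (h : σ.Bounded)
    {r : Rule L κ ν} (hr : r.WellFormed) {π : Equiv.Perm Var}
    (hfresh : Disjoint (r.rename π).vars (V ∪ σ.vars)) :
    FreshFor V σ.state r π (· + σ.counter) := by
  have hpos : ∀ i ∈ r.idSet, 0 < i := fun i hi => by
    obtain ⟨k, hk, rfl⟩ := Rule.mem_idSet.1 hi
    exact hr.ids_pos k hk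
  refine ⟨fun x hx => ?_, fun i _ j _ hij => Nat.add_right_cancel hij, fun i hi k hk he => ?_,
    fun i hi t ht hm => ?_⟩
  · refine Finset.disjoint_left.1 hfresh ?_
    rw [Rule.vars_rename]
    exact Finset.mem_image_of_mem _ (r.coreVars_subset_vars hx)
  · have := h.ids k hk
    have := hpos i hi
    omega
  · have := h.tokens t ht _ hm
    have := hpos i hi
    omega

theorem LGood.freshFor {V : Finset Var} {l : LState L κ ν} (h : LGood V l) {r : Rule L κ ν}
    {π : Equiv.Perm Var} {ι : ℕ → ℕ} (hvars : ∀ x ∈ r.coreVars, π x ∉ l.usedVars)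
    (hinj : Set.InjOn ι r.idSet) (hids : ∀ i ∈ r.idSet, ι i ∉ l.usedIds) :
    FreshFor V l.toState r π ι := by
  refine ⟨fun x hx hm => hvars x hx ?_, hinj, fun i hi k hk he => hids i hi (he ▸ h.ids k hk),
    fun i hi t ht hm => hids i hi (h.tokens t ht _ hm)⟩
  rcases Finset.mem_union.1 hm with hm | hm
  exacts [h.protected_vars hm, h.vars hm]

/-- The criterion `CanFire` at a configuration, in terms of a fresh renamed version. -/
theorem entailsFiring_rename_iff {CT : L.Theory} {V : Finset Var} {H₁ H₂ : List (IAtom L κ)}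
    {S : Multiset (IAtom L κ)} {B C : Conj L} {T : Finset (Token ν)} {n : ℕ} {r : Rule L κ ν}
    {π : Equiv.Perm Var} (hfresh : Disjoint (r.rename π).vars
      (V ∪ Config.vars
        (⟨Multiset.ofList H₁ + Multiset.ofList H₂ + S, B, C, T, n⟩ : Config L κ ν))) :
    EntailsFiring CT C (chrs H₁) (chrs H₂) (r.rename π)
      ↔ CanFire CT C (chrs H₁) (chrs H₂) r := by
  rw [← canFire_rename π, entailsFiring_iff_canFire]
  · refine hfresh.mono_right fun x hx => ?_
    simp [Config.vars, hx]
  · refine hfresh.mono_right fun x hx => ?_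
    have : x ∈ storeVars (Multiset.ofList H₁ + Multiset.ofList H₂ + S) :=
      listVars_chrs_subset (by simpa [chrs] using hx)
    simp only [Config.vars, Finset.mem_union, this, true_or, or_true]

theorem state_apply {r : Rule L κ ν} {π : Equiv.Perm Var} {H₁ H₂ : List (IAtom L κ)}
    {S : Multiset (IAtom L κ)} {B C : Conj L} {T : Finset (Token ν)} {n m : ℕ} :
    Config.state ⟨(inst (r.rename π).chr (r.rename π).tokens n).1 + Multiset.ofList H₁ + S,
        (r.rename π).builtin + B,
        eqns (chrs (H₁ ++ H₂)) ((r.rename π).keep ++ (r.rename π).remove) + C,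
        T ∪ firedToken (r.rename π) (ids (H₁ ++ H₂))
          ∪ (inst (r.rename π).chr (r.rename π).tokens n).2.1, m⟩
      = fired r π (· + n) H₁ H₂ S B C T := by
  rw [firedToken_rename]
  simp only [Config.state, fired, inst, Rule.rename, List.map_append, Multiset.map_map]
  rfl

theorem exists_apply_of_canFire {CT : L.Theory} {V : Finset Var} {P : Set (Rule L κ ν)}
    {r : Rule L κ ν} (hr : r ∈ P) {H₁ H₂ : List (IAtom L κ)} {S : Multiset (IAtom L κ)}
    {B C : Conj L} {T : Finset (Token ν)} {n : ℕ}
    (hcan : CanFire CT C (chrs H₁) (chrs H₂) r) (htok : (r.name, ids (H₁ ++ H₂)) ∉ T) :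
    ∃ (π : Equiv.Perm Var) (σ' : Config L κ ν),
      Step CT P V ⟨Multiset.ofList H₁ + Multiset.ofList H₂ + S, B, C, T, n⟩ σ' ∧
      Disjoint (r.rename π).vars
        (V ∪ Config.vars
          (⟨Multiset.ofList H₁ + Multiset.ofList H₂ + S, B, C, T, n⟩ : Config L κ ν)) ∧
      σ'.state = fired r π (· + n) H₁ H₂ S B C T := by
  obtain ⟨π, hπ⟩ := exists_fresh_perm r.vars
    (V ∪ Config.vars (⟨Multiset.ofList H₁ + Multiset.ofList H₂ + S, B, C, T, n⟩ : Config L κ ν))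
  have hfresh : Disjoint (r.rename π).vars
      (V ∪ Config.vars
        (⟨Multiset.ofList H₁ + Multiset.ofList H₂ + S, B, C, T, n⟩ : Config L κ ν)) := by
    rw [Finset.disjoint_left, Rule.vars_rename]
    intro x hx
    obtain ⟨y, hy, rfl⟩ := Finset.mem_image.1 hx
    exact hπ y hy
  exact ⟨π, _, Step.apply r hr π _ rfl H₁ H₂ S B C T n hfresh
    ((entailsFiring_rename_iff hfresh).2 hcan) htok, hfresh, state_apply⟩

theorem final_iff {CT : L.Theory} {V : Finset Var} {P : Set (Rule L κ ν)} {σ : Config L κ ν} :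
    (∀ σ', ¬ Step CT P V σ σ') ↔ σ.state.Final CT P := by
  obtain ⟨Q, B, C, T, n⟩ := σ
  constructor
  · intro h
    refine ⟨?_, fun r hr H₁ H₂ S hchr hcan => ?_⟩
    · by_contra hB
      obtain ⟨c, hc⟩ := Multiset.exists_mem_of_ne_zero hB
      obtain ⟨B', rfl⟩ := Multiset.exists_cons_of_mem (show c ∈ B from hc)
      exact h _ (Step.solve Q c B' C _ T n ⟨fun _ _ h => h, fun _ _ h => h⟩)
    · by_contra htok
      simp only [Config.state] at hchr
      subst hchr
      obtain ⟨_, σ', hs, _⟩ := exists_apply_of_canFire (V := V) (S := S) (B := B) (n := n) hr hcan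
        htok
      exact h σ' hs
  · rintro ⟨hB, hf⟩ σ' hs
    cases hs with
    | solve S c B C C' T n h => simp [Config.state] at hB
    | apply r₀ hr π r hπ H₁ H₂ S B C T n fresh fires token =>
      subst hπ
      exact token (hf r₀ hr H₁ H₂ S rfl ((entailsFiring_rename_iff fresh).1 fires))

theorem mem_QA_iff {CT : L.Theory} {P : Set (Rule L κ ν)} {G : Goal L κ} {A : Answer L κ} :
    A ∈ QA CT P G ↔ ∃ σ : Config L κ ν, Relation.ReflTransGen (Step CT P G.fv) (G.initial ν) σ ∧
      σ.state.IsAnswer CT P G.fv A := by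
  constructor
  · rintro (⟨σ, h1, h2, h3⟩ | ⟨σ, h1, h2, h3⟩)
    · exact ⟨σ, h1, Or.inl ⟨final_iff.1 h2, h3⟩⟩
    · exact ⟨σ, h1, Or.inr ⟨h2, h3⟩⟩
  · rintro ⟨σ, h1, ⟨h2, h3⟩ | ⟨h2, h3⟩⟩
    · exact Or.inl ⟨σ, h1, final_iff.2 h2, h3⟩
    · exact Or.inr ⟨σ, h1, h2, h3⟩

/-- A transition of the operational semantics is simulated by the machine. -/
theorem Step.exists_lstep {CT : L.Theory} {V : Finset Var} {P : Set (Rule L κ ν)}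
    (hP : IsAnnotatedProgram P) {fr : Rule L κ ν → Finset Var} {fi : Rule L κ ν → Finset ℕ}
    (hp : IsPolicy fr fi) {σ σ' : Config L κ ν} (hs : Step CT P V σ σ') (hσ : σ.Bounded)
    {l : LState L κ ν} (hl : LGood V l) (h : Sim CT V σ.state l.toState) :
    ∃ l', LStep CT fr fi P l l' ∧ Sim CT V σ'.state l'.toState := by
  obtain ⟨⟨Q, B₁, C₁, T₁⟩, U, I⟩ := l
  cases hs with
  | solve S c B C C' T n hC =>
    obtain ⟨c', B', hB', hsim⟩ := h.solve hC
    simp only at hB' hsim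
    subst hB'
    exact ⟨_, LStep.solve Q c' B' C₁ T₁ U I, hsim _ ⟨fun _ _ h => h, fun _ _ h => h⟩⟩
  | apply r₀ hr π r hπ H₁ H₂ S B C T n fresh fires token =>
    subst hπ
    have hcan := (entailsFiring_rename_iff fresh).1 fires
    obtain ⟨H₁', H₂', S', hchr, hcan', htok', hsim⟩ := h.fired (hP r₀ hr) rfl hcan token
    obtain ⟨π', hπ'⟩ := exists_fresh_perm (fr r₀) U
    simp only at hchr
    subst hchr
    have hinj : ∀ s : Set ℕ, Set.InjOn (· + (I.sup id + 1)) s := fun s i _ j _ hij =>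
      Nat.add_right_cancel hij
    have hids : ∀ i : ℕ, i + (I.sup id + 1) ∉ I := fun i hi => by
      have : i + (I.sup id + 1) ≤ I.sup id := Finset.le_sup (f := id) hi
      omega
    refine ⟨_, LStep.apply r₀ hr π' (· + (I.sup id + 1)) H₁' H₂' S' B₁ C₁ T₁ U I hπ' (hinj _)
      (fun i _ => hids i) hcan' htok', ?_⟩
    rw [state_apply]
    exact hsim _ _ _ _ (freshFor_of_bounded hσ (hP r₀ hr) fresh)
      (hl.freshFor (fun x hx => hπ' x (hp.vars r₀ hx)) (hinj _) fun i _ => hids i)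

/-- A transition of the machine is simulated by the operational semantics. -/
theorem LStep.exists_step {CT : L.Theory} {V : Finset Var} {P : Set (Rule L κ ν)}
    (hP : IsAnnotatedProgram P) {fr : Rule L κ ν → Finset Var} {fi : Rule L κ ν → Finset ℕ}
    (hp : IsPolicy fr fi) {l l' : LState L κ ν} (hs : LStep CT fr fi P l l') (hl : LGood V l)
    {σ : Config L κ ν} (hσ : σ.Bounded) (h : Sim CT V l.toState σ.state) :
    ∃ σ', Step CT P V σ σ' ∧ Sim CT V l'.toState σ'.state := by
  obtain ⟨Q, B₁, C₁, T₁, n⟩ := σ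
  cases hs with
  | solve S c B C T U I =>
    obtain ⟨c', B', hB', hsim⟩ := h.solve ⟨fun _ _ h => h, fun _ _ h => h⟩
    simp only [Config.state] at hB' hsim
    subst hB'
    exact ⟨_, Step.solve Q c' B' C₁ _ T₁ n ⟨fun _ _ h => h, fun _ _ h => h⟩,
      hsim _ ⟨fun _ _ h => h, fun _ _ h => h⟩⟩
  | apply r hr π ι H₁ H₂ S B C T U I hvars hinj hids can htok =>
    obtain ⟨H₁', H₂', S', hchr, hcan', htok', hsim⟩ := h.fired (hP r hr) rfl can htok
    simp only [Config.state] at hchr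
    subst hchr
    obtain ⟨π', σ', hstep, hfresh, hσ'⟩ := exists_apply_of_canFire (V := V) (S := S') (B := B₁)
      (n := n) hr hcan' htok'
    refine ⟨σ', hstep, ?_⟩
    rw [hσ']
    exact hsim _ _ _ _ (hl.freshFor (fun x hx => hvars x (hp.vars r hx)) (hinj.mono (hp.ids r))
      fun i hi => hids i (hp.ids r hi)) (freshFor_of_bounded hσ (hP r hr) hfresh)

/-- The initial state of the machine for a goal. -/
def Goal.linit (ν : Type z) [DecidableEq ν] (G : Goal L κ) : LState L κ ν where
  toState := (G.initial ν).state
  usedVars := G.fv ∪ (G.initial ν).state.vars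
  usedIds := Finset.range (G.chr.length + 1)

theorem mem_zipIdx_le {l : List (Atom L κ)} {k : IAtom L κ} (hk : k ∈ l.zipIdx 1) :
    k.2 ≤ l.length := by
  have := List.snd_lt_add_of_mem_zipIdx hk
  omega

theorem Goal.bounded (G : Goal L κ) : (G.initial ν).Bounded :=
  ⟨fun _ hk => mem_zipIdx_le (by simpa [Goal.initial] using hk), by simp [Goal.initial]⟩

theorem Goal.lgood (G : Goal L κ) : LGood G.fv (G.linit ν) := by
  refine ⟨Finset.subset_union_left, Finset.subset_union_right, ?_, fun k hk => ?_, ?_⟩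
  · simp only [Goal.linit, Config.state, Goal.initial, Multiset.map_coe, Multiset.coe_nodup,
      List.zipIdx_map_snd]
    exact List.nodup_range'
  · have := mem_zipIdx_le (l := G.chr) (k := k)
      (by simpa [Goal.linit, Config.state, Goal.initial] using hk)
    simp only [Goal.linit, Finset.mem_range]
    omega
  · simp [Goal.linit, Config.state, Goal.initial]

/-- The qualified answers may be computed by the machine. -/
theorem mem_QA_iff_machine {CT : L.Theory} {P : Set (Rule L κ ν)} (hP : IsAnnotatedProgram P)
    {fr : Rule L κ ν → Finset Var} {fi : Rule L κ ν → Finset ℕ} (hp : IsPolicy fr fi)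
    {G : Goal L κ} {A : Answer L κ} :
    A ∈ QA CT P G ↔ ∃ l, Relation.ReflTransGen (LStep CT fr fi P) (G.linit ν) l ∧
      l.toState.IsAnswer CT P G.fv A := by
  have h0 : Sim CT G.fv (G.initial ν).state (G.linit ν).toState := Sim.refl _ _ _ G.lgood.nodup
  rw [mem_QA_iff]
  constructor
  · rintro ⟨σ, hσ, hA⟩
    have : ∃ l, Relation.ReflTransGen (LStep CT fr fi P) (G.linit ν) l ∧
        Sim CT G.fv σ.state l.toState ∧ σ.Bounded ∧ LGood G.fv l := by
      clear hA
      induction hσ with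
      | refl => exact ⟨_, .refl, h0, G.bounded, G.lgood⟩
      | tail _ hs ih =>
        obtain ⟨l, hl, hsim, hb, hg⟩ := ih
        obtain ⟨l', hl', hsim'⟩ := hs.exists_lstep hP hp hb hg hsim
        exact ⟨l', hl.tail hl', hsim', hb.step hs, hg.step hP hp hl'⟩
    obtain ⟨l, hl, hsim, _⟩ := this
    exact ⟨l, hl, hsim.isAnswer hP hA⟩
  · rintro ⟨l, hl, hA⟩
    have : ∃ σ, Relation.ReflTransGen (Step CT P G.fv) (G.initial ν) σ ∧
        Sim CT G.fv l.toState σ.state ∧ σ.Bounded ∧ LGood G.fv l := by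
      clear hA
      induction hl with
      | refl => exact ⟨_, .refl, h0.symm, G.bounded, G.lgood⟩
      | tail _ hs ih =>
        obtain ⟨σ, hσ, hsim, hb, hg⟩ := ih
        obtain ⟨σ', hσ', hsim'⟩ := hs.exists_step hP hp hg hb hsim
        exact ⟨σ', hσ.tail hσ', hsim', hb.step hσ', hg.step hP hp hs⟩
    obtain ⟨σ, hσ, hsim, _⟩ := this
    exact ⟨σ, hσ, hsim.isAnswer hP hA⟩

end Machine

/-! ### Configurations that have solved more constraints -/

section Ahead

variable {L : FirstOrder.Language.{u, v}} {κ : Type w} {ν : Type z}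

/-- Two token stores contain the same tokens all of whose identifiers occur in `S`; only such tokens
can still prevent a rule from firing. -/
def LiveAgree (S : Multiset (IAtom L κ)) (T T' : Finset (Token ν)) : Prop :=
  ∀ (name : ν) (l : List ℕ), l ≠ [] → (∀ i ∈ l, ∃ k ∈ S, k.2 = i) →
    ((name, l) ∈ T ↔ (name, l) ∈ T')

theorem LiveAgree.symm {S : Multiset (IAtom L κ)} {T T' : Finset (Token ν)}
    (h : LiveAgree S T T') : LiveAgree S T' T := fun n l h1 h2 => (h n l h1 h2).symm

theorem LiveAgree.trans {S : Multiset (IAtom L κ)} {T T' T'' : Finset (Token ν)}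
    (h : LiveAgree S T T') (h' : LiveAgree S T' T'') : LiveAgree S T T'' :=
  fun n l h1 h2 => (h n l h1 h2).trans (h' n l h1 h2)

/-- `τ` has solved a part `X` of the constraints that are still pending in `σ`, and has used no
variables or identifiers that are unused in `σ`. -/
structure Ahead (σ τ : LState L κ ν) : Prop where
  chr : τ.chr = σ.chr
  solved : ∃ X : Conj L, σ.builtin = X + τ.builtin ∧ τ.store = X + σ.store
  live : LiveAgree σ.chr σ.history τ.history
  usedVars : τ.usedVars ⊆ σ.usedVars
  usedIds : τ.usedIds ⊆ σ.usedIds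

theorem Ahead.refl (σ : LState L κ ν) : Ahead σ σ :=
  ⟨rfl, ⟨0, by simp, by simp⟩, fun _ _ _ _ => Iff.rfl, Finset.Subset.refl _, Finset.Subset.refl _⟩

theorem Ahead.store_realize {σ τ : LState L κ ν} (h : Ahead σ τ) {M : Type*} [L.Structure M]
    {a : Var → M} (ha : τ.store.Realize a) : σ.store.Realize a := by
  obtain ⟨X, _, hX⟩ := h.solved
  rw [hX, Conj.realize_add] at ha
  exact ha.2

theorem CanFire.ids_ne_nil {CT : L.Theory} {C : Conj L} {H₁ H₂ : List (IAtom L κ)}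
    {r : Rule L κ ν} (hr : r.WellFormed) (h : CanFire CT C (chrs H₁) (chrs H₂) r) :
    CHR.ids (H₁ ++ H₂) ≠ [] := CHR.ids_ne_nil hr h.1 h.2.1

theorem live_ids {H₁ H₂ : List (IAtom L κ)} {S : Multiset (IAtom L κ)} :
    ∀ i ∈ CHR.ids (H₁ ++ H₂), ∃ k ∈ (Multiset.ofList H₁ + Multiset.ofList H₂ + S), k.2 = i := by
  intro i hi
  obtain ⟨k, hk, rfl⟩ := mem_ids_append.1 hi
  exact ⟨k, by simp only [Multiset.mem_add, Multiset.mem_coe]; exact Or.inl hk, rfl⟩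

variable [DecidableEq ν]

/-- Agreement of the token stores on live tokens is kept by a firing. -/
theorem LiveAgree.fired {r : Rule L κ ν} {π : Equiv.Perm Var} {ι : ℕ → ℕ}
    {H₁ H₂ : List (IAtom L κ)} {S : Multiset (IAtom L κ)} {B B' C C' : Conj L}
    {T T' : Finset (Token ν)} (h : LiveAgree (Multiset.ofList H₁ + Multiset.ofList H₂ + S) T T')
    (hT : ∀ i ∈ r.idSet, ∀ t ∈ T, ι i ∉ t.2) (hT' : ∀ i ∈ r.idSet, ∀ t ∈ T', ι i ∉ t.2) :
    LiveAgree (fired r π ι H₁ H₂ S B C T).chr (fired r π ι H₁ H₂ S B C T).history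
      (fired r π ι H₁ H₂ S B' C' T').history := by
  intro name l hl hlive
  simp only [CHR.fired, Finset.mem_union]
  refine or_congr_left (or_congr_left ?_)
  by_cases hnew : ∃ m ∈ r.idSet, ι m ∈ l
  · obtain ⟨m, hm, hml⟩ := hnew
    exact iff_of_false (fun ht => hT m hm _ ht hml) fun ht => hT' m hm _ ht hml
  · refine h name l hl fun i hi => ?_
    obtain ⟨k, hk, rfl⟩ := hlive i hi
    simp only [CHR.fired, Multiset.mem_add, Multiset.mem_map, Multiset.mem_coe] at hk
    rcases hk with (⟨k, hk, rfl⟩ | hk) | hk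
    · exact absurd ⟨k.2, Rule.mem_idSet.2 ⟨k, hk, rfl⟩, hi⟩ hnew
    · exact ⟨k, by simp only [Multiset.mem_add, Multiset.mem_coe]; tauto, rfl⟩
    · exact ⟨k, by simp only [Multiset.mem_add, Multiset.mem_coe]; tauto, rfl⟩

/-- What `σ` solves has been solved before by a state ahead of it, or can be solved now. -/
theorem Ahead.solve {CT : L.Theory} {fr : Rule L κ ν → Finset Var} {fi : Rule L κ ν → Finset ℕ}
    {P : Set (Rule L κ ν)} {S : Multiset (IAtom L κ)} {c : Builtin L} {B C : Conj L}
    {T : Finset (Token ν)} {U : Finset Var} {I : Finset ℕ} {τ : LState L κ ν}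
    (h : Ahead ⟨⟨S, c ::ₘ B, C, T⟩, U, I⟩ τ) :
    ∃ τ', Relation.ReflTransGen (LStep CT fr fi P) τ τ' ∧
      Ahead ⟨⟨S, B, c ::ₘ C, T⟩, U, I⟩ τ' := by
  obtain ⟨⟨Q, B', C', T'⟩, U', I'⟩ := τ
  obtain ⟨hQ, ⟨X, hB, hC⟩, hlive, hU, hI⟩ := h
  simp only at hQ hB hC hlive hU hI
  have hc : c ∈ X + B' := by rw [← hB]; simp
  rcases Multiset.mem_add.1 hc with hc | hc
  · obtain ⟨X', rfl⟩ := Multiset.exists_cons_of_mem hc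
    rw [Multiset.cons_add, Multiset.cons_inj_right] at hB
    refine ⟨_, .refl, hQ, ⟨X', hB, ?_⟩, hlive, hU, hI⟩
    simp only [hC, Multiset.cons_add, Multiset.add_cons]
  · obtain ⟨B'', rfl⟩ := Multiset.exists_cons_of_mem hc
    rw [Multiset.add_cons, Multiset.cons_inj_right] at hB
    refine ⟨_, .single (LStep.solve Q c B'' C' T' U' I'), hQ, ⟨X, hB, ?_⟩, hlive, hU, hI⟩
    simp only [hC, Multiset.add_cons]

/-- A firing of `r` in `σ` can be repeated in a state ahead of `σ`. -/
theorem Ahead.can {CT : L.Theory} {H₁ H₂ : List (IAtom L κ)} {S : Multiset (IAtom L κ)}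
    {B C B' C' : Conj L} {T T' : Finset (Token ν)} {U U' : Finset Var} {I I' : Finset ℕ}
    {Q : Multiset (IAtom L κ)}
    (h : Ahead ⟨⟨Multiset.ofList H₁ + Multiset.ofList H₂ + S, B, C, T⟩, U, I⟩
      ⟨⟨Q, B', C', T'⟩, U', I'⟩) {r : Rule L κ ν} (hr : r.WellFormed)
    (hcan : CanFire CT C (chrs H₁) (chrs H₂) r) (htok : (r.name, CHR.ids (H₁ ++ H₂)) ∉ T) :
    CanFire CT C' (chrs H₁) (chrs H₂) r ∧ (r.name, CHR.ids (H₁ ++ H₂)) ∉ T' :=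
  ⟨hcan.mono fun M _ ha => h.store_realize (M := M) ha,
    fun ht => htok ((h.live _ _ (hcan.ids_ne_nil hr) live_ids).2 ht)⟩

theorem Ahead.fired {V V' : Finset Var} {H₁ H₂ : List (IAtom L κ)} {S : Multiset (IAtom L κ)}
    {B C B' C' : Conj L} {T T' : Finset (Token ν)} {U U' : Finset Var} {I I' : Finset ℕ}
    {Q : Multiset (IAtom L κ)}
    (h : Ahead ⟨⟨Multiset.ofList H₁ + Multiset.ofList H₂ + S, B, C, T⟩, U, I⟩
      ⟨⟨Q, B', C', T'⟩, U', I'⟩)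
    (hσ : LGood V ⟨⟨Multiset.ofList H₁ + Multiset.ofList H₂ + S, B, C, T⟩, U, I⟩)
    (hτ : LGood V' ⟨⟨Q, B', C', T'⟩, U', I'⟩) {r : Rule L κ ν} {π : Equiv.Perm Var} {ι : ℕ → ℕ}
    (hι : ∀ i ∈ r.idSet, ι i ∉ I) {U₁ U₁' : Finset Var} {I₁ I₁' : Finset ℕ} (hU : U₁' ⊆ U₁)
    (hI : I₁' ⊆ I₁) :
    Ahead ⟨CHR.fired r π ι H₁ H₂ S B C T, U₁, I₁⟩
      ⟨CHR.fired r π ι H₁ H₂ S B' C' T', U₁', I₁'⟩ := by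
  obtain ⟨hQ, ⟨X, hB, hC⟩, hlive, _, hI0⟩ := h
  simp only at hQ hB hC hlive hI0
  refine ⟨rfl, ⟨X, ?_, ?_⟩, ?_, hU, hI⟩
  · simp only [CHR.fired, hB]; abel
  · simp only [CHR.fired, hC]; abel
  · exact hlive.fired (fun i hi t ht hm => hι i hi (hσ.tokens t ht _ hm))
      fun i hi t ht hm => hι i hi (hI0 (hτ.tokens t ht _ hm))

theorem reflTransGen_solve {CT : L.Theory} {fr : Rule L κ ν → Finset Var}
    {fi : Rule L κ ν → Finset ℕ} {P : Set (Rule L κ ν)} (S : Multiset (IAtom L κ)) (X B : Conj L)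
    (T : Finset (Token ν)) (U : Finset Var) (I : Finset ℕ) : ∀ C : Conj L,
    Relation.ReflTransGen (LStep CT fr fi P) ⟨⟨S, X + B, C, T⟩, U, I⟩
      ⟨⟨S, B, X + C, T⟩, U, I⟩ := by
  induction X using Multiset.induction_on with
  | empty => intro C; simpa using Relation.ReflTransGen.refl
  | cons c X ih =>
    intro C
    have e : c ::ₘ X + C = X + c ::ₘ C := by rw [Multiset.cons_add, Multiset.add_cons]
    rw [e, Multiset.cons_add]
    exact .head (LStep.solve S c (X + B) C T U I) (ih _)

theorem LGood.steps {CT : L.Theory} {V : Finset Var} {P : Set (Rule L κ ν)}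
    (hP : IsAnnotatedProgram P) {fr : Rule L κ ν → Finset Var} {fi : Rule L κ ν → Finset ℕ}
    (hp : IsPolicy fr fi) {l l' : LState L κ ν} (h : LGood V l)
    (hs : Relation.ReflTransGen (LStep CT fr fi P) l l') : LGood V l' := by
  induction hs with
  | refl => exact h
  | tail _ hs ih => exact ih.step hP hp hs

/-- Answers are preserved when passing to a state that is ahead, possibly with another program
whose firings are covered by the first one. -/
theorem Ahead.isAnswer {CT : L.Theory} {P P' : Set (Rule L κ ν)} {V : Finset Var}
    {σ τ : LState L κ ν} (h : Ahead σ τ) {A : Answer L κ} (hA : σ.toState.IsAnswer CT P V A)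
    (hP : ∀ r' ∈ P', r'.WellFormed ∧ ∀ (C : Conj L) (K₁ K₂ : List (Atom L κ)),
      CanFire CT C K₁ K₂ r' → ∃ r ∈ P, r.name = r'.name ∧ CanFire CT C K₁ K₂ r) :
    τ.toState.IsAnswer CT P' V A := by
  rcases hA with ⟨⟨hB, hf⟩, hA⟩ | ⟨hs, hA⟩
  · obtain ⟨X, hX, hX'⟩ := h.solved
    rw [hB] at hX
    obtain ⟨rfl, hτ⟩ := add_eq_zero.1 hX.symm
    rw [zero_add] at hX'
    refine Or.inl ⟨⟨hτ, fun r' hr' H₁ H₂ S hchr hcan => ?_⟩, ?_⟩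
    · obtain ⟨hw, hr'⟩ := hP r' hr'
      obtain ⟨r, hr, hname, hcan'⟩ := hr' _ _ _ hcan
      rw [hX'] at hcan'
      have := hf r hr H₁ H₂ S (h.chr ▸ hchr) hcan'
      rw [hname] at this
      refine (h.live _ _ (hcan.ids_ne_nil hw) ?_).1 this
      rw [← h.chr, hchr]
      exact live_ids
    · rw [h.chr, hX']
      exact hA
  · refine Or.inr ⟨?_, hA⟩
    rintro ⟨M, a, ha⟩
    exact hs ⟨M, a, h.store_realize ha⟩

end Ahead

/-! ### The effect of an unfolded rule -/

section Unfolding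

variable {L : FirstOrder.Language.{u, v}} {κ : Type w} {ν : Type z}

theorem Comparable.subst_right {H H' : List (Atom L κ)} (θ : Var → L.Term Var) :
    Comparable H (H'.map (Atom.subst θ)) ↔ Comparable H H' := by
  simp [Comparable, List.forall₂_map_right_iff, Atom.subst]

theorem vals_subst {M : Type*} [L.Structure M] (θ : Var → L.Term Var) (a : Var → M)
    (H : List (Atom L κ)) :
    (H.map (Atom.subst θ)).map (Atom.val a) = H.map (Atom.val fun x => (θ x).realize a) := by
  simp [Atom.val_subst]

/-- By Clark's equality theory, the equations between the matched atoms and the head of a fired rule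
determine the values of the head variables, so that the store entails the guard. -/
theorem guard_of_eqns {CT : L.Theory} (hCT : ContainsClarkEquality CT) {C : Conj L}
    {K₁ K₂ : List (Atom L κ)} {r : Rule L κ ν} (h : CanFire CT C K₁ K₂ r) (π : Equiv.Perm Var)
    (M : Model CT) (a : Var → M)
    (ha : (eqns (K₁ ++ K₂) ((r.keep ++ r.remove).map (Atom.rename π))).Realize a)
    (hC : C.Realize a) : r.guard.Realize (a ∘ π) := by
  rw [eqns_realize ((Comparable.rename_right _).2 (h.1.append h.2.1)), vals_rename] at ha
  obtain ⟨b, hb, hh, hg⟩ := h.2.2 M a hC (a ∘ π)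
  have := eq_of_vals_eq hCT M _ (ha.symm.trans hh)
  refine (Conj.realize_congr fun x hx => ?_).1 hg
  by_cases hxh : x ∈ r.headVars
  · exact (this x hxh).symm
  · exact hb x hx hxh

variable [DecidableEq ν]

/-- Once the guard and the built-in constraints of the body of `r` hold, the rule `v` used in an
unfolding of `r` can fire, provided that the unfolding does not strengthen the guard. -/
theorem UnfoldsTo.canFire {CT : L.Theory} {r v r' : Rule L κ ν} {S₁ S₂ : List (IAtom L κ)}
    (h : UnfoldsTo CT r v S₁ S₂ r') (hg : Conj.Equivalent CT r.guard r'.guard)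
    (hapart : Disjoint v.vars r.vars) {C : Conj L} {ρ : Equiv.Perm Var}
    (hC : ∀ (M : Model CT) (a : Var → M), C.Realize a → (r.builtin + r.guard).Realize (a ∘ ρ)) :
    CanFire CT C ((chrs S₁).map (Atom.rename ρ)) ((chrs S₂).map (Atom.rename ρ)) v := by
  classical
  obtain ⟨K, θ, D'', hchr, hθ, hc₁, hc₂, heq, _, hD, _, rfl⟩ := h
  refine ⟨(Comparable.rename_left _).2 hc₁, (Comparable.rename_left _).2 hc₂,
    fun M a ha u => ?_⟩
  -- Outside the rule `r` the valuation follows `u`, which is free on the guard of `v`.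
  set a' : Var → M := fun x => if x ∈ r.vars then a (ρ x) else u x with ha'
  have hr : ∀ x ∈ r.vars, (a ∘ ρ) x = a' x := fun x hx => by simp [ha', hx]
  have hbg : (r.builtin + r.guard).Realize a' := by
    refine (Conj.realize_congr fun x hx => hr x ?_).1 (hC M a ha)
    simp only [Conj.fv_add, Finset.mem_union] at hx
    simp only [Rule.vars, Finset.mem_union]
    tauto
  have hD' : ∀ c ∈ v.guard, (c.subst θ).Realize a' := by
    intro c hcv
    by_cases hce : Conj.Entails CT (r.builtin + r.guard) {c.subst θ}
    · exact hce M a' hbg _ (by simp)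
    · have hg' := hg.1 M a' (Conj.realize_add.1 hbg).2
      refine hg' _ (Multiset.mem_add.2 (Or.inr (Multiset.mem_map.2 ⟨c, ?_, rfl⟩)))
      rw [hD]
      exact Multiset.mem_filter.2 ⟨hcv, hce⟩
  refine ⟨fun x => (θ x).realize a', fun y hy hn => ?_, ?_, fun c hcv => ?_⟩
  · have hyr : y ∉ r.vars := Finset.disjoint_left.1 hapart (by simp [Rule.vars, hy])
    simp [hθ y hn, ha', hyr]
  · have hE := heq M a' hbg
    rw [eqns_realize ((Comparable.subst_right θ).2 (by simpa [chrs] using hc₁.append hc₂)),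
      vals_subst] at hE
    rw [← List.map_append, vals_rename, ← hE]
    have hchrs : chrs (S₁ ++ S₂) = chrs S₁ ++ chrs S₂ := by simp [chrs]
    rw [hchrs]
    refine (vals_congr (chrs S₁ ++ chrs S₂) fun x hx => hr x ?_)
    have hx' : x ∈ storeVars r.chr := by
      rw [hchr, add_assoc, add_comm K]
      exact listVars_chrs_subset (by simpa [chrs] using hx)
    simp [Rule.vars, hx']
  · exact (Builtin.realize_subst c θ a').1 (hD' c hcv)

theorem Rule.coreVars_rename (r : Rule L κ ν) (π : Equiv.Perm Var) :
    (r.rename π).coreVars = r.coreVars.image π := by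
  simp only [coreVars, headVars_rename, storeVars_rename, Finset.image_union]
  simp only [rename, Conj.fv_rename]

theorem Rule.WellFormed.rename {r : Rule L κ ν} (h : r.WellFormed) (π : Equiv.Perm Var) :
    (r.rename π).WellFormed := by
  refine ⟨?_, ?_, ?_, ?_⟩
  · have := h.head_ne
    simp only [Rule.rename, ← List.map_append]
    simpa using this
  · simpa [Rule.rename, Multiset.map_map] using h.ids_nodup
  · intro k hk
    obtain ⟨k', hk', rfl⟩ := Multiset.mem_map.1 hk
    exact h.ids_pos k' hk'
  · intro t ht i hi
    have := h.tokens_ids t ht i hi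
    simpa [Rule.rename, Multiset.map_map] using this

theorem UnfoldsTo.head {CT : L.Theory} {r v r' : Rule L κ ν} {S₁ S₂ : List (IAtom L κ)}
    (h : UnfoldsTo CT r v S₁ S₂ r') :
    r'.name = r.name ∧ r'.keep = r.keep ∧ r'.remove = r.remove := by
  obtain ⟨_, _, _, _, _, _, _, _, _, _, _, rfl⟩ := h
  exact ⟨rfl, rfl, rfl⟩

theorem UnfoldsTo.guard_entails {CT : L.Theory} {r v r' : Rule L κ ν} {S₁ S₂ : List (IAtom L κ)}
    (h : UnfoldsTo CT r v S₁ S₂ r') : Conj.Entails CT r'.guard r.guard := by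
  obtain ⟨_, _, _, _, _, _, _, _, _, _, _, rfl⟩ := h
  exact fun M a ha => (Conj.realize_add.1 ha).1

/-- A rule can fire wherever a rule with the same head and a stronger guard can. -/
theorem CanFire.of_guard {CT : L.Theory} {C : Conj L} {K₁ K₂ : List (Atom L κ)}
    {r r' : Rule L κ ν} (h : CanFire CT C K₁ K₂ r) (hk : r'.keep = r.keep)
    (hr : r'.remove = r.remove) (hg : Conj.Entails CT r.guard r'.guard) :
    CanFire CT C K₁ K₂ r' := by
  classical
  have hh : r'.headVars = r.headVars := by simp [Rule.headVars, hk, hr]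
  refine ⟨hk ▸ h.1, hr ▸ h.2.1, fun M a ha u => ?_⟩
  obtain ⟨b, hb, he, hbg⟩ := h.2.2 M a ha u
  -- Off the variables of `r`, the valuation `b` may be changed to `u`.
  set b' : Var → M := fun x => if x ∈ r.headVars then b x else u x with hb'
  have hbb : ∀ x ∈ r.headVars ∪ r.guard.fv, b x = b' x := by
    intro x hx
    by_cases hxh : x ∈ r.headVars
    · simp [hb', hxh]
    · simp [hb', hxh, hb x (by simpa [hxh] using hx) hxh]
  refine ⟨b', fun y _ hn => ?_, ?_, hg M b' ?_⟩
  · rw [hh] at hn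
    simp [hb', hn]
  · rw [he, hk, hr]
    exact vals_congr _ fun x hx => hbb x (Finset.mem_union_left _ hx)
  · exact (Conj.realize_congr fun x hx => hbb x (Finset.mem_union_right _ hx)).1 hbg

/-- The core variables of an unfolded rule are those of the two rules it comes from. -/
theorem UnfoldsTo.coreVars {CT : L.Theory} {r v r' : Rule L κ ν} {S₁ S₂ : List (IAtom L κ)}
    (h : UnfoldsTo CT r v S₁ S₂ r') : r'.coreVars = r.coreVars ∪ v.coreVars := by
  obtain ⟨K, θ, D'', hchr, _, hc₁, hc₂, _, _, _, _, rfl⟩ := h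
  have hc : Comparable (chrs (S₁ ++ S₂)) (v.keep ++ v.remove) := by
    simpa [chrs] using hc₁.append hc₂
  obtain ⟨hs₁, hs₂⟩ := listVars_subset_fv_eqns hc
  have hs₃ := fv_eqns_subset (chrs (S₁ ++ S₂)) (v.keep ++ v.remove)
  have hS : ∀ k, (k ∈ S₁ ∨ k ∈ S₂) → ∀ x ∈ k.1.vars, x ∈ listVars (chrs (S₁ ++ S₂)) :=
    fun k hk x hx => mem_listVars.2 ⟨k.1, List.mem_map_of_mem (List.mem_append.2 hk), hx⟩
  have hr : ∀ x, x ∈ listVars (chrs (S₁ ++ S₂)) → x ∈ storeVars r.chr := by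
    intro x hx
    rw [hchr, add_assoc, add_comm K]
    exact listVars_chrs_subset hx
  have e1 : storeVars r.chr ⊆ storeVars (K + Multiset.ofList S₁ +
      (inst v.chr v.tokens (maxId r.chr r.tokens)).1) ∪
        (eqns (chrs (S₁ ++ S₂)) (v.keep ++ v.remove)).fv := by
    intro x hx
    obtain ⟨k, hk, hx⟩ := mem_storeVars.1 hx
    rw [hchr] at hk
    simp only [Multiset.mem_add, Multiset.mem_coe] at hk
    rw [Finset.mem_union]
    rcases hk with (hk | hk) | hk
    · exact Or.inl (mem_storeVars.2 ⟨k, by simp [hk], hx⟩)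
    · exact Or.inr (hs₁ (hS k (Or.inl hk) x hx))
    · exact Or.inr (hs₁ (hS k (Or.inr hk) x hx))
  have e2 : storeVars (K + Multiset.ofList S₁ +
      (inst v.chr v.tokens (maxId r.chr r.tokens)).1) ⊆ storeVars r.chr ∪ storeVars v.chr := by
    intro x hx
    obtain ⟨k, hk, hx⟩ := mem_storeVars.1 hx
    simp only [Multiset.mem_add, Multiset.mem_coe, inst, Multiset.mem_map] at hk
    rw [Finset.mem_union]
    rcases hk with (hk | hk) | ⟨k, hk, rfl⟩
    · exact Or.inl (mem_storeVars.2 ⟨k, by simp [hchr, hk], hx⟩)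
    · exact Or.inl (mem_storeVars.2 ⟨k, by simp [hchr, hk], hx⟩)
    · exact Or.inr (mem_storeVars.2 ⟨k, hk, hx⟩)
  have e3 : storeVars v.chr ⊆ storeVars (K + Multiset.ofList S₁ +
      (inst v.chr v.tokens (maxId r.chr r.tokens)).1) := by
    intro x hx
    obtain ⟨k, hk, hx⟩ := mem_storeVars.1 hx
    refine mem_storeVars.2 ⟨(k.1, k.2 + maxId r.chr r.tokens), ?_, hx⟩
    simp only [Multiset.mem_add, inst, Multiset.mem_map]
    exact Or.inr ⟨k, hk, rfl⟩
  have hv : listVars (v.keep ++ v.remove) = v.headVars := rfl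
  rw [hv] at hs₂ hs₃
  have e1' := fun x hx => Finset.mem_union.1 (@e1 x hx)
  have e2' := fun x hx => Finset.mem_union.1 (@e2 x hx)
  have e4 := fun x hx => Finset.mem_union.1 (@hs₃ x hx)
  ext x
  simp only [Rule.coreVars, Conj.fv_add, Finset.mem_union]
  constructor
  · rintro ((hx | hx) | (hx | hx) | hx)
    · exact Or.inl (Or.inl (Or.inl hx))
    · rcases e2' x hx with hx | hx
      exacts [Or.inl (Or.inl (Or.inr hx)), Or.inr (Or.inl (Or.inr hx))]
    · exact Or.inr (Or.inr hx)
    · exact Or.inl (Or.inr hx)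
    · rcases e4 x hx with hx | hx
      exacts [Or.inl (Or.inl (Or.inr (hr x hx))), Or.inr (Or.inl (Or.inl hx))]
  · rintro (((hx | hx) | hx) | (hx | hx) | hx)
    · exact Or.inl (Or.inl hx)
    · rcases e1' x hx with hx | hx
      exacts [Or.inl (Or.inr hx), Or.inr (Or.inr hx)]
    · exact Or.inr (Or.inl (Or.inr hx))
    · exact Or.inr (Or.inr (hs₂ hx))
    · exact Or.inl (Or.inr (e3 hx))
    · exact Or.inr (Or.inl (Or.inl hx))

theorem UnfoldsTo.mem_idSet {CT : L.Theory} {r v r' : Rule L κ ν} {S₁ S₂ : List (IAtom L κ)}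
    (h : UnfoldsTo CT r v S₁ S₂ r') {i : ℕ} (hi : i ∈ r'.idSet) :
    i ∈ r.idSet ∨ ∃ j ∈ v.idSet, i = j + maxId r.chr r.tokens := by
  obtain ⟨K, θ, D'', hchr, _, _, _, _, _, _, _, rfl⟩ := h
  obtain ⟨k, hk, rfl⟩ := Rule.mem_idSet.1 hi
  simp only [Multiset.mem_add, Multiset.mem_coe, inst, Multiset.mem_map] at hk
  rcases hk with hk | ⟨k, hk, rfl⟩
  · refine Or.inl (Rule.mem_idSet.2 ⟨k, ?_, rfl⟩)
    rw [hchr, Multiset.mem_add, Multiset.mem_add]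
    exact Or.inl hk
  · exact Or.inr ⟨k.2, Rule.mem_idSet.2 ⟨k, hk, rfl⟩, rfl⟩

theorem UnfoldsTo.shift_mem_idSet {CT : L.Theory} {r v r' : Rule L κ ν} {S₁ S₂ : List (IAtom L κ)}
    (h : UnfoldsTo CT r v S₁ S₂ r') {j : ℕ} (hj : j ∈ v.idSet) :
    j + maxId r.chr r.tokens ∈ r'.idSet := by
  obtain ⟨K, θ, D'', hchr, _, _, _, _, _, _, _, rfl⟩ := h
  obtain ⟨k, hk, rfl⟩ := Rule.mem_idSet.1 hj
  refine Rule.mem_idSet.2 ⟨(k.1, k.2 + maxId r.chr r.tokens), ?_, rfl⟩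
  simp only [Multiset.mem_add, inst, Multiset.mem_map]
  exact Or.inr ⟨k, hk, rfl⟩

theorem le_maxId_of_mem_idSet {r : Rule L κ ν} {i : ℕ} (hi : i ∈ r.idSet) :
    i ≤ maxId r.chr r.tokens := by
  obtain ⟨k, hk, rfl⟩ := Rule.mem_idSet.1 hi
  exact le_maxId_of_mem hk

theorem Rule.WellFormed.pos {r : Rule L κ ν} (h : r.WellFormed) {i : ℕ} (hi : i ∈ r.idSet) :
    0 < i := by
  obtain ⟨k, hk, rfl⟩ := Rule.mem_idSet.1 hi
  exact h.ids_pos k hk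

theorem UnfoldsTo.wellFormed {CT : L.Theory} {r v r' : Rule L κ ν} {S₁ S₂ : List (IAtom L κ)}
    (h : UnfoldsTo CT r v S₁ S₂ r') (hr : r.WellFormed) (hv : v.WellFormed) :
    r'.WellFormed := by
  obtain ⟨K, θ, D'', hchr, _, _, hc₂, _, _, _, _, rfl⟩ := h
  have hsub : (K + Multiset.ofList S₁) ≤ r.chr := hchr ▸ Multiset.le_add_right _ _
  refine ⟨hr.head_ne, ?_, ?_, ?_⟩
  · simp only [inst]
    rw [Multiset.map_add, Multiset.nodup_add]
    refine ⟨Multiset.nodup_of_le (Multiset.map_le_map hsub) hr.ids_nodup, ?_, ?_⟩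
    · have : ((v.chr.map fun k => (k.1, k.2 + maxId r.chr r.tokens)).map Prod.snd)
          = (v.chr.map Prod.snd).map (· + maxId r.chr r.tokens) := by
        simp [Multiset.map_map]
      rw [this]
      exact hv.ids_nodup.map fun i j hij => Nat.add_right_cancel hij
    · rw [Multiset.disjoint_left]
      intro i hi hi'
      obtain ⟨k, hk, rfl⟩ := Multiset.mem_map.1 hi
      simp only [Multiset.map_map, Multiset.mem_map, Function.comp_apply] at hi'
      obtain ⟨k', hk', he⟩ := hi'
      have h1 := hv.ids_pos k' hk'
      have h2 := le_maxId_of_mem (T := r.tokens) (Multiset.mem_of_le hsub hk)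
      omega
  · intro k hk
    simp only [inst, Multiset.mem_add (t := Multiset.map _ _), Multiset.mem_map] at hk
    rcases hk with hk | ⟨k, hk, rfl⟩
    · exact hr.ids_pos k (Multiset.mem_of_le hsub hk)
    · exact Nat.add_pos_left (hv.ids_pos k hk) _
  · intro t ht i hi
    simp only [inst, Finset.mem_union, clean, Finset.mem_filter, Finset.mem_image] at ht
    simp only [inst]
    rw [Multiset.map_add, Multiset.mem_add]
    rcases ht with (ht | ⟨t, ht, rfl⟩) | ht
    · exact Or.inl (ht.2 i hi)
    · obtain ⟨j, hj, rfl⟩ := List.mem_map.1 hi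
      obtain ⟨k, hk, rfl⟩ := Multiset.mem_map.1 (hv.tokens_ids t ht j hj)
      refine Or.inr ?_
      simp only [Multiset.map_map, Multiset.mem_map, Function.comp_apply]
      exact ⟨k, hk, rfl⟩
    · obtain hrem : v.remove = [] := by
        unfold firedToken at ht
        split at ht
        · assumption
        · simp at ht
      obtain rfl := mem_firedToken ht
      have hS₂ : S₂ = [] := by
        rw [hrem] at hc₂
        have := hc₂.length_eq
        simp only [chrs, List.length_map, List.length_nil] at this
        exact List.length_eq_zero_iff.1 this
      subst hS₂
      obtain ⟨k, hk, rfl⟩ := mem_ids_append.1 hi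
      refine Or.inl (Multiset.mem_map_of_mem _ ?_)
      simp only [Multiset.mem_add, Multiset.mem_coe]
      simp only [List.not_mem_nil, or_false] at hk
      exact Or.inr hk

theorem chrs_map_instAtom (π : Equiv.Perm Var) (ι : ℕ → ℕ) (S : List (IAtom L κ)) :
    chrs (S.map (instAtom π ι)) = (chrs S).map (Atom.rename π) := by
  simp [chrs, instAtom]

theorem ids_map_instAtom (π : Equiv.Perm Var) (ι : ℕ → ℕ) (S : List (IAtom L κ)) :
    CHR.ids (S.map (instAtom π ι)) = (CHR.ids S).map ι := by
  simp [CHR.ids, instAtom]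

/-- Firing an unfolded rule `r'` and firing first `r` and then, on the instances of `S₁`, `S₂`, the
rule `v₀`, give the same atoms, the same live tokens and the same built-in constraints, except
that the equations of the second firing are pending in the first case. -/
theorem UnfoldsTo.fired {CT : L.Theory} {r v₀ r' : Rule L κ ν} {πv : Equiv.Perm Var}
    {S₁ S₂ : List (IAtom L κ)} (h : UnfoldsTo CT r (v₀.rename πv) S₁ S₂ r') (hr : r.WellFormed)
    (hv : v₀.WellFormed) (ρ : Equiv.Perm Var) {ι ι' ιw : ℕ → ℕ} (H₁ H₂ : List (IAtom L κ))
    (S : Multiset (IAtom L κ)) (B C : Conj L) (T : Finset (Token ν))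
    (hι : ∀ i ∈ r.idSet, ι' i = ι i)
    (hιw : ∀ j ∈ v₀.idSet, ι' (j + maxId r.chr r.tokens) = ιw j)
    (hinj : Set.InjOn ι r.idSet) (hne : ∀ i ∈ r.idSet, ∀ j ∈ v₀.idSet, ι i ≠ ιw j)
    (hold : ∀ i ∈ r.idSet, ∀ k, k ∈ H₁ ∨ k ∈ S → k.2 ≠ ι i) :
    ∃ K, r.chr = K + ↑S₁ + ↑S₂ ∧
      (fired r' ρ ι' H₁ H₂ S B C T).chr
        = v₀.chr.map (instAtom (πv.trans ρ) ιw) + ↑(S₁.map (instAtom ρ ι))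
          + (K.map (instAtom ρ ι) + (↑H₁ + S)) ∧
      (fired r' ρ ι' H₁ H₂ S B C T).builtin
        = eqns (chrs (S₁.map (instAtom ρ ι) ++ S₂.map (instAtom ρ ι)))
            ((v₀.keep ++ v₀.remove).map (Atom.rename (πv.trans ρ)))
          + (v₀.builtin.map (Builtin.rename (πv.trans ρ)) +
            (r.builtin.map (Builtin.rename ρ) + B)) ∧
      LiveAgree (fired r' ρ ι' H₁ H₂ S B C T).chr (fired r' ρ ι' H₁ H₂ S B C T).history
        ((fired r ρ ι H₁ H₂ S B C T).history
          ∪ firedToken v₀ (CHR.ids (S₁.map (instAtom ρ ι) ++ S₂.map (instAtom ρ ι)))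
          ∪ v₀.tokens.image fun t => (t.1, t.2.map ιw)) := by
  obtain ⟨K, θ, D'', hchr, _, _, _, _, _, _, _, rfl⟩ := h
  have hmem : ∀ k ∈ r.chr, k.2 ∈ r.idSet := fun k hk => Rule.mem_idSet.2 ⟨k, hk, rfl⟩
  have hinst : ∀ k ∈ r.chr, instAtom ρ ι' k = instAtom ρ ι k := fun k hk => by
    simp [instAtom, hι _ (hmem k hk)]
  have hchr' : ((K + Multiset.ofList S₁ + (inst (v₀.rename πv).chr (v₀.rename πv).tokens
      (maxId r.chr r.tokens)).1).map (instAtom ρ ι'))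
      = K.map (instAtom ρ ι) + ↑(S₁.map (instAtom ρ ι))
        + v₀.chr.map (instAtom (πv.trans ρ) ιw) := by
    rw [Multiset.map_add, Multiset.map_add, Multiset.map_coe]
    congr 1
    · congr 1
      · exact Multiset.map_congr rfl fun k hk => hinst k (by simp [hchr, hk])
      · rw [List.map_congr_left fun k hk => hinst k (by simp [hchr, hk])]
    · simp only [inst, Rule.rename, Multiset.map_map]
      refine Multiset.map_congr rfl fun k hk => ?_
      simp only [Function.comp_apply, instAtom, Atom.rename_rename]
      rw [hιw _ (Rule.mem_idSet.2 ⟨k, hk, rfl⟩)]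
  refine ⟨K, hchr, ?_, ?_, ?_⟩
  · simp only [CHR.fired, hchr']
    abel
  · simp only [CHR.fired, Multiset.map_add, eqns_rename, Rule.rename, Conj.rename_rename,
      ← List.map_append]
    rw [chrs_map_instAtom]
    simp only [List.map_map]
    have : Atom.rename ρ ∘ Atom.rename πv = (Atom.rename (πv.trans ρ) : Atom L κ → Atom L κ) :=
      funext fun h => Atom.rename_rename πv ρ h
    rw [this]
    abel
  · have htok : ∀ t ∈ r.tokens, t.2.map ι' = t.2.map ι := fun t ht =>
      List.map_congr_left fun i hi => hι i (hr.mem_idSet ht hi)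
    have hvtok : ∀ t ∈ v₀.tokens,
        (t.2.map (· + maxId r.chr r.tokens)).map ι' = t.2.map ιw := fun t ht => by
      rw [List.map_map]
      exact List.map_congr_left fun i hi => hιw i (hv.mem_idSet ht hi)
    have hids : (CHR.ids (S₁ ++ S₂)).map ι'
        = CHR.ids (S₁.map (instAtom ρ ι) ++ S₂.map (instAtom ρ ι)) := by
      rw [← List.map_append, ids_map_instAtom]
      refine List.map_congr_left fun i hi => hι i ?_
      obtain ⟨k, hk, rfl⟩ := mem_ids_append.1 hi
      refine hmem k ?_
      rw [hchr]
      simp only [Multiset.mem_add, Multiset.mem_coe]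
      tauto
    intro name l hl hlive
    simp only [CHR.fired, Finset.image_union, Finset.mem_union]
    have e1 : (name, l) ∈ (firedToken (v₀.rename πv) (CHR.ids (S₁ ++ S₂))).image
          (fun t => (t.1, t.2.map ι')) ↔ (name, l) ∈
          firedToken v₀ (CHR.ids (S₁.map (instAtom ρ ι) ++ S₂.map (instAtom ρ ι))) := by
      rw [firedToken_rename]
      unfold firedToken
      split
      · simp [hids]
      · simp
    have e2 : (name, l) ∈ (inst (v₀.rename πv).chr (v₀.rename πv).tokens
          (maxId r.chr r.tokens)).2.1.image (fun t => (t.1, t.2.map ι')) ↔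
        (name, l) ∈ v₀.tokens.image fun t => (t.1, t.2.map ιw) := by
      simp only [inst, Rule.rename, Finset.image_image, Finset.mem_image, Function.comp_apply]
      refine exists_congr fun t => and_congr_right fun ht => ?_
      rw [hvtok t ht]
    have e3 : (name, l) ∈ (clean (K + Multiset.ofList S₁) r.tokens).image
        (fun t => (t.1, t.2.map ι')) ↔
        (name, l) ∈ r.tokens.image fun t => (t.1, t.2.map ι) := by
      simp only [Finset.mem_image, clean, Finset.mem_filter]
      constructor
      · rintro ⟨t, ⟨ht, _⟩, he⟩
        exact ⟨t, ht, by rw [← htok t ht]; exact he⟩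
      · rintro ⟨t, ht, he⟩
        refine ⟨t, ⟨ht, fun i hi => ?_⟩, by rw [htok t ht]; exact he⟩
        simp only [Prod.mk.injEq] at he
        have hir : i ∈ r.idSet := hr.mem_idSet ht hi
        obtain ⟨k, hk, hki⟩ := hlive (ι i) (by rw [← he.2]; exact List.mem_map_of_mem hi)
        simp only [CHR.fired, hchr', Multiset.mem_add, Multiset.mem_map, Multiset.mem_coe,
          List.mem_map] at hk
        have hcase : ∀ k' ∈ r.chr, (instAtom ρ ι k').2 = ι i → k'.2 = i := fun k' hk' he' =>
          hinj (hmem k' hk') hir he'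
        rcases hk with (((⟨k', hk', rfl⟩ | ⟨k', hk', rfl⟩) | ⟨k', hk', rfl⟩) | hk) | hk
        · rw [← hcase k' (by simp [hchr, hk']) hki]
          exact Multiset.mem_map_of_mem _ (Multiset.mem_add.2 (Or.inl hk'))
        · rw [← hcase k' (by simp [hchr, hk']) hki]
          exact Multiset.mem_map_of_mem _ (Multiset.mem_add.2 (Or.inr (by simpa using hk')))
        · exact absurd hki.symm (hne i hir _ (Rule.mem_idSet.2 ⟨k', hk', rfl⟩))
        · exact absurd hki (hold i hir k (Or.inl hk))
        · exact absurd hki (hold i hir k (Or.inr hk))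
    rw [e1, e2, e3]
    have e4 : ∀ is, (name, l) ∈ firedToken
        { name := r.name, keep := r.keep, remove := r.remove,
          guard := r.guard + D''.map fun c => c.subst θ,
          chr := K + Multiset.ofList S₁ + (inst (v₀.rename πv).chr (v₀.rename πv).tokens
            (maxId r.chr r.tokens)).1,
          builtin := (v₀.rename πv).builtin + r.builtin +
            eqns (chrs (S₁ ++ S₂)) ((v₀.rename πv).keep ++ (v₀.rename πv).remove),
          tokens := clean (K + Multiset.ofList S₁) r.tokens ∪
              (inst (v₀.rename πv).chr (v₀.rename πv).tokens
              (maxId r.chr r.tokens)).2.1 ∪ firedToken (v₀.rename πv) (CHR.ids (S₁ ++ S₂)) } is ↔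
        (name, l) ∈ firedToken r is := fun is => Iff.rfl
    rw [e4]
    constructor
    · rintro ((h | h) | (h | h) | h)
      exacts [Or.inl (Or.inl (Or.inl (Or.inl h))), Or.inl (Or.inl (Or.inl (Or.inr h))),
        Or.inl (Or.inl (Or.inr h)), Or.inr h, Or.inl (Or.inr h)]
    · rintro ((((h | h) | h) | h) | h)
      exacts [Or.inl (Or.inl h), Or.inl (Or.inr h), Or.inr (Or.inl (Or.inl h)), Or.inr (Or.inr h),
        Or.inr (Or.inl (Or.inr h))]

end Unfolding

/-! ### Simulation of the unfolded program by the original one -/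

section Soundness

variable {L : FirstOrder.Language.{u, v}} {κ : Type w} {ν : Type z}

theorem list_eq_of_map_eq {α β : Type*} {f : α → β} {s : Set α} (hf : Set.InjOn f s)
    {l l' : List α} (hl : ∀ x ∈ l, x ∈ s) (hl' : ∀ x ∈ l', x ∈ s) (h : l.map f = l'.map f) :
    l = l' := by
  rw [← List.forall₂_eq_eq_eq] at h ⊢
  rw [List.forall₂_map_left_iff, List.forall₂_map_right_iff] at h
  exact forall₂_imp_of_mem h fun a ha b hb hab => hf (hl a ha) (hl' b hb) hab

variable [DecidableEq ν]

/-- The live tokens that mention only atoms of the body of a rule just fired are the local tokens of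
the rule. -/
theorem mem_tokens_of_mem_fired {r : Rule L κ ν} (hr : r.WellFormed) {π : Equiv.Perm Var}
    {ι : ℕ → ℕ} {H₁ H₂ : List (IAtom L κ)} {S : Multiset (IAtom L κ)} {B C : Conj L}
    {T : Finset (Token ν)} (hinj : Set.InjOn ι r.idSet)
    (hT : ∀ i ∈ r.idSet, ∀ t ∈ T, ι i ∉ t.2)
    (hH : ∀ i ∈ r.idSet, ∀ k, k ∈ H₁ ∨ k ∈ H₂ → k.2 ≠ ι i) {name : ν} {l : List ℕ} (hl : l ≠ [])
    (hlr : ∀ i ∈ l, i ∈ r.idSet) (h : (name, l.map ι) ∈ (fired r π ι H₁ H₂ S B C T).history) :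
    (name, l) ∈ r.tokens := by
  obtain ⟨i, hi⟩ := List.exists_mem_of_ne_nil l hl
  have hil : ι i ∈ l.map ι := List.mem_map_of_mem hi
  simp only [fired, Finset.mem_union, Finset.mem_image] at h
  rcases h with (h | h) | ⟨t, ht, h⟩
  · exact absurd hil (hT i (hlr i hi) _ h)
  · have := mem_firedToken h
    simp only [Prod.mk.injEq] at this
    rw [this.2] at hil
    obtain ⟨k, hk, hki⟩ := mem_ids_append.1 hil
    exact absurd hki (hH i (hlr i hi) k hk)
  · simp only [Prod.mk.injEq] at h
    have : t.2 = l := list_eq_of_map_eq hinj (fun j hj => hr.mem_idSet ht hj) hlr h.2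
    rw [← h.1, ← this]
    exact ht

theorem isAnnotatedProgram_unf {CT : L.Theory} {P : Set (Rule L κ ν)} (hP : IsAnnotatedProgram P)
    {r : Rule L κ ν} (hr : r ∈ P) : IsAnnotatedProgram ((P \ {r}) ∪ Unf CT P r) := by
  rintro r' (hr' | ⟨v, S₁, S₂, ⟨⟨v₀, hv₀, π, rfl⟩, _⟩, hu⟩)
  · exact hP r' hr'.1
  · exact hu.wellFormed (hP r hr) ((hP v₀ hv₀).rename π)

theorem UnfoldsTo.mem_unf {CT : L.Theory} {P : Set (Rule L κ ν)} {r v r' : Rule L κ ν}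
    {S₁ S₂ : List (IAtom L κ)} (h : UnfoldsTo CT r v S₁ S₂ r') (hv : IsApartVariant P r v) :
    r' ∈ Unf CT P r := ⟨v, S₁, S₂, hv, h⟩

theorem UnfoldsTo.ids_mem {CT : L.Theory} {r v r' : Rule L κ ν}
    {S₁ S₂ : List (IAtom L κ)} (h : UnfoldsTo CT r v S₁ S₂ r') :
    ∀ i ∈ CHR.ids (S₁ ++ S₂), i ∈ r.idSet := by
  obtain ⟨K, _, _, hchr, _⟩ := h
  intro i hi
  obtain ⟨k, hk, rfl⟩ := mem_ids_append.1 hi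
  refine Rule.mem_idSet.2 ⟨k, ?_, rfl⟩
  rw [hchr]
  simp only [Multiset.mem_add, Multiset.mem_coe]
  tauto

theorem UnfoldsTo.token_not_mem {CT : L.Theory} {r v r' : Rule L κ ν}
    {S₁ S₂ : List (IAtom L κ)} (h : UnfoldsTo CT r v S₁ S₂ r') :
    (v.name, CHR.ids (S₁ ++ S₂)) ∉ r.tokens := by
  obtain ⟨_, _, _, _, _, _, _, _, h, _⟩ := h
  exact h

theorem UnfoldsTo.ids_ne_nil {CT : L.Theory} {r v r' : Rule L κ ν} (hv : v.WellFormed)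
    {S₁ S₂ : List (IAtom L κ)} (h : UnfoldsTo CT r v S₁ S₂ r') : CHR.ids (S₁ ++ S₂) ≠ [] := by
  obtain ⟨_, _, _, _, _, hc₁, hc₂, _⟩ := h
  exact CHR.ids_ne_nil hv hc₁ hc₂

/-- A firing of an unfolded rule is simulated by firing `r`, solving the built-in constraints of its
body and firing the rule used in the unfolding. -/
theorem exists_steps_of_unfolded {CT : L.Theory} (hCT : ContainsClarkEquality CT)
    {P : Set (Rule L κ ν)} (hP : IsAnnotatedProgram P) {r : Rule L κ ν} (hr : r ∈ P)
    (hg : ∀ r' ∈ Unf CT P r, Conj.Equivalent CT r.guard r'.guard) {V : Finset Var}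
    {r' : Rule L κ ν} (hr' : r' ∈ Unf CT P r) {π : Equiv.Perm Var} {ι : ℕ → ℕ}
    {H₁ H₂ : List (IAtom L κ)} {S : Multiset (IAtom L κ)} {B C : Conj L} {T : Finset (Token ν)}
    {U U' : Finset Var} {I I' : Finset ℕ}
    (hτ : LGood V ⟨⟨Multiset.ofList H₁ + Multiset.ofList H₂ + S, B, C, T⟩, U, I⟩)
    (hvars : ∀ x ∈ r'.vars, π x ∉ U) (hinj : Set.InjOn ι ↑(r'.idSet ∪ r.idSet))
    (hids : ∀ i ∈ r'.idSet ∪ r.idSet, ι i ∉ I) (can : CanFire CT C (chrs H₁) (chrs H₂) r')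
    (htok : (r'.name, CHR.ids (H₁ ++ H₂)) ∉ T) (hU' : U ∪ r'.vars.image π ⊆ U')
    (hI' : I ∪ (r'.idSet ∪ r.idSet).image ι ⊆ I') :
    ∃ τ', Relation.ReflTransGen (LStep CT Rule.coreVars Rule.idSet P)
        ⟨⟨Multiset.ofList H₁ + Multiset.ofList H₂ + S, B, C, T⟩, U, I⟩ τ' ∧
      Ahead ⟨fired r' π ι H₁ H₂ S B C T, U', I'⟩ τ' := by
  have hgr := hg r' hr'
  obtain ⟨v, S₁, S₂, ⟨⟨v₀, hv₀, πv, rfl⟩, hapart⟩, hu⟩ := hr'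
  have hwr := hP r hr
  have hwv := hP v₀ hv₀
  obtain ⟨hname, hkeep, hrem⟩ := hu.head
  have hcore := hu.coreVars
  have hcr : ∀ x ∈ r.coreVars, x ∈ r'.vars := fun x hx =>
    r'.coreVars_subset_vars (hcore ▸ Finset.mem_union_left _ hx)
  have hcv : ∀ x ∈ v₀.coreVars, πv x ∈ r'.vars := fun x hx =>
    r'.coreVars_subset_vars (hcore ▸ Finset.mem_union_right _
      (Rule.coreVars_rename v₀ πv ▸ Finset.mem_image_of_mem _ hx))
  have hsh : ∀ j ∈ v₀.idSet, j + maxId r.chr r.tokens ∈ r'.idSet := fun j hj =>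
    hu.shift_mem_idSet (by simpa [Rule.idSet, Rule.rename, Multiset.map_map] using hj)
  have hinjr : Set.InjOn ι r.idSet := hinj.mono (by simp)
  have hsep : ∀ i ∈ r.idSet, ∀ j ∈ v₀.idSet, ι i ≠ ι (j + maxId r.chr r.tokens) := by
    intro i hi j hj he
    have := hinj (by simp [hi]) (by simp [hsh j hj]) he
    have h1 := le_maxId_of_mem_idSet hi
    have h2 := hwv.pos hj
    omega
  have hidr : ∀ i ∈ r.idSet, ι i ∉ I := fun i hi => hids i (Finset.mem_union_right _ hi)
  have hTr : ∀ i ∈ r.idSet, ∀ t ∈ T, ι i ∉ t.2 := fun i hi t ht hm =>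
    hidr i hi (hτ.tokens t ht _ hm)
  have hHr : ∀ i ∈ r.idSet, ∀ k, (k ∈ H₁ ∨ k ∈ H₂ ∨ k ∈ S) → k.2 ≠ ι i := fun i hi k hk he =>
    hidr i hi (he ▸ hτ.ids k (by simp only [Multiset.mem_add, Multiset.mem_coe]; tauto))
  have hcan_r : CanFire CT C (chrs H₁) (chrs H₂) r :=
    can.of_guard hkeep.symm hrem.symm hgr.2
  obtain ⟨K, hchr, f1, f2, f3⟩ := hu.fired hwr hwv π (ι := ι) (ι' := ι)
    (ιw := fun j => ι (j + maxId r.chr r.tokens)) H₁ H₂ S B C T (fun _ _ => rfl)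
    (fun _ _ => rfl) hinjr hsep (fun i hi k hk => hHr i hi k (by tauto))
  -- The state after the firing of `r` and the solving of its built-in constraints.
  have step₁ := LStep.apply (CT := CT) (fr := Rule.coreVars) (fi := Rule.idSet) r hr π ι H₁ H₂ S
    B C T U I (fun x hx => hvars x (hcr x hx)) hinjr hidr hcan_r (hname ▸ htok)
  have step₂ := reflTransGen_solve (CT := CT) (fr := Rule.coreVars) (fi := Rule.idSet) (P := P)
    (fired r π ι H₁ H₂ S B C T).chr (r.builtin.map (Builtin.rename π)) B
    (fired r π ι H₁ H₂ S B C T).history (U ∪ r.coreVars.image π) (I ∪ r.idSet.image ι)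
    (fired r π ι H₁ H₂ S B C T).store
  have hchr₁ : (fired r π ι H₁ H₂ S B C T).chr
      = Multiset.ofList (S₁.map (instAtom π ι)) + Multiset.ofList (S₂.map (instAtom π ι))
        + (K.map (instAtom π ι) + (↑H₁ + S)) := by
    simp only [fired, hchr, Multiset.map_add, Multiset.map_coe]
    abel
  have hcan_v : CanFire CT
      (r.builtin.map (Builtin.rename π) + (fired r π ι H₁ H₂ S B C T).store)
      (chrs (S₁.map (instAtom π ι))) (chrs (S₂.map (instAtom π ι))) v₀ := by
    rw [chrs_map_instAtom, chrs_map_instAtom]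
    refine (canFire_rename πv).1 (hu.canFire hgr hapart fun M a ha => ?_)
    obtain ⟨hb, hs⟩ := Conj.realize_add.1 ha
    obtain ⟨he, hC⟩ := Conj.realize_add.1 hs
    refine Conj.realize_add.2 ⟨(Conj.realize_rename π).1 hb, ?_⟩
    exact guard_of_eqns hCT hcan_r π M a (by simpa [chrs] using he) hC
  have htok_v : (v₀.name, CHR.ids (S₁.map (instAtom π ι) ++ S₂.map (instAtom π ι)))
      ∉ (fired r π ι H₁ H₂ S B C T).history := by
    intro hm
    rw [← List.map_append, ids_map_instAtom] at hm
    exact hu.token_not_mem (mem_tokens_of_mem_fired hwr hinjr hTr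
      (fun i hi k hk => hHr i hi k (by tauto)) (hu.ids_ne_nil (hwv.rename πv)) hu.ids_mem hm)
  have step₃ := LStep.apply (CT := CT) (fr := Rule.coreVars) (fi := Rule.idSet) v₀ hv₀
    (πv.trans π) (fun j => ι (j + maxId r.chr r.tokens)) (S₁.map (instAtom π ι))
    (S₂.map (instAtom π ι)) (K.map (instAtom π ι) + (↑H₁ + S)) B
    (r.builtin.map (Builtin.rename π) + (fired r π ι H₁ H₂ S B C T).store)
    (fired r π ι H₁ H₂ S B C T).history (U ∪ r.coreVars.image π) (I ∪ r.idSet.image ι)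
    (fun x hx hm => by
      rcases Finset.mem_union.1 hm with hm | hm
      · exact hvars _ (hcv x hx) hm
      · obtain ⟨y, hy, he⟩ := Finset.mem_image.1 hm
        have hyx : y = πv x := π.injective he
        refine Finset.disjoint_left.1 hapart ?_ (r.coreVars_subset_vars hy)
        rw [hyx, Rule.vars_rename]
        exact Finset.mem_image_of_mem _ (v₀.coreVars_subset_vars hx))
    (fun i hi j hj hij => Nat.add_right_cancel
      (hinj (by simp [hsh i hi]) (by simp [hsh j hj]) hij))
    (fun j hj hm => by
      rcases Finset.mem_union.1 hm with hm | hm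
      · exact hids _ (Finset.mem_union_left _ (hsh j hj)) hm
      · obtain ⟨i, hi, he⟩ := Finset.mem_image.1 hm
        exact hsep i hi j hj he)
    hcan_v htok_v
  rw [← hchr₁] at step₃
  refine ⟨_, (Relation.ReflTransGen.head step₁ step₂).tail step₃, ?_⟩
  refine ⟨?_, ⟨eqns (chrs (S₁.map (instAtom π ι) ++ S₂.map (instAtom π ι)))
    ((v₀.keep ++ v₀.remove).map (Atom.rename (πv.trans π))) + r.builtin.map (Builtin.rename π),
    ?_, ?_⟩, f3, ?_, ?_⟩
  · exact f1.symm
  · refine f2.trans ?_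
    simp only [fired]
    abel
  · simp only [fired, hkeep, hrem]
    abel
  · refine Finset.union_subset (Finset.union_subset (Finset.subset_union_left.trans hU') ?_) ?_
    · exact (Finset.image_subset_image hcr).trans (Finset.subset_union_right.trans hU')
    · refine fun y hy => hU' (Finset.mem_union_right _ ?_)
      obtain ⟨x, hx, rfl⟩ := Finset.mem_image.1 hy
      exact Finset.mem_image_of_mem π (hcv x hx)
  · refine Finset.union_subset (Finset.union_subset (Finset.subset_union_left.trans hI') ?_) ?_
    · exact (Finset.image_subset_image Finset.subset_union_right).trans
        (Finset.subset_union_right.trans hI')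
    · refine fun y hy => hI' (Finset.mem_union_right _ ?_)
      obtain ⟨j, hj, rfl⟩ := Finset.mem_image.1 hy
      exact Finset.mem_image_of_mem ι (Finset.mem_union_left _ (hsh j hj))

/-- The original program keeps ahead of the unfolded one. -/
theorem Ahead.exists_steps_original {CT : L.Theory} (hCT : ContainsClarkEquality CT)
    {P : Set (Rule L κ ν)} (hP : IsAnnotatedProgram P) {r : Rule L κ ν} (hr : r ∈ P)
    (hg : ∀ r' ∈ Unf CT P r, Conj.Equivalent CT r.guard r'.guard) {V : Finset Var}
    {σ τ σ' : LState L κ ν} (h : Ahead σ τ) (hσ : LGood V σ) (hτ : LGood V τ)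
    (hs : LStep CT Rule.vars (fun r₀ => r₀.idSet ∪ r.idSet) ((P \ {r}) ∪ Unf CT P r) σ σ') :
    ∃ τ', Relation.ReflTransGen (LStep CT Rule.coreVars Rule.idSet P) τ τ' ∧ Ahead σ' τ' := by
  cases hs with
  | solve S c B C T U I => exact h.solve
  | apply r' hr' π ι H₁ H₂ S B C T U I hvars hinj hids can htok =>
    obtain ⟨⟨Q, B', C', T'⟩, U', I'⟩ := τ
    have hw := isAnnotatedProgram_unf (CT := CT) hP hr r' hr'
    obtain ⟨can', htok'⟩ := h.can hw can htok
    obtain rfl : Q = Multiset.ofList H₁ + Multiset.ofList H₂ + S := h.chr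
    have hvars' : ∀ x ∈ r'.vars, π x ∉ U' := fun x hx hm => hvars x hx (h.usedVars hm)
    have hids' : ∀ i ∈ r'.idSet ∪ r.idSet, ι i ∉ I' := fun i hi hm => hids i hi (h.usedIds hm)
    have hι : ∀ i ∈ r'.idSet, ι i ∉ I := fun i hi => hids i (Finset.mem_union_left _ hi)
    rcases hr' with hr' | hr'
    · refine ⟨_, .single (LStep.apply r' hr'.1 π ι H₁ H₂ S B' C' T' U' I'
        (fun x hx => hvars' x (r'.coreVars_subset_vars hx)) (hinj.mono (by simp))
        (fun i hi => hids' i (Finset.mem_union_left _ hi)) can' htok'), ?_⟩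
      refine h.fired hσ hτ hι ?_ ?_
      · exact Finset.union_subset_union h.usedVars
          (Finset.image_subset_image r'.coreVars_subset_vars)
      · exact Finset.union_subset_union h.usedIds
          (Finset.image_subset_image Finset.subset_union_left)
    · obtain ⟨τ', hsteps, hah⟩ := exists_steps_of_unfolded hCT hP hr hg hr' hτ hvars' hinj hids'
        can' htok' (Finset.Subset.refl _) (Finset.Subset.refl _)
      refine ⟨τ', hsteps, ?_⟩
      have h1 := h.fired hσ hτ (π := π) hι
        (Finset.union_subset_union h.usedVars (Finset.Subset.refl (r'.vars.image π)))
        (Finset.union_subset_union h.usedIds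
          (Finset.Subset.refl ((r'.idSet ∪ r.idSet).image ι)))
      obtain ⟨X, hX, hX'⟩ := h1.solved
      obtain ⟨Y, hY, hY'⟩ := hah.solved
      refine ⟨hah.chr, ⟨X + Y, ?_, ?_⟩, h1.live.trans hah.live, hah.usedVars.trans h1.usedVars,
        hah.usedIds.trans h1.usedIds⟩
      · rw [hX, hY, add_assoc]
      · rw [hY', hX', ← add_assoc, add_comm Y X]

theorem isPolicy_vars_union (r : Rule L κ ν) :
    IsPolicy (Rule.vars : Rule L κ ν → Finset Var) fun r₀ => r₀.idSet ∪ r.idSet :=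
  ⟨Rule.coreVars_subset_vars, fun _ => Finset.subset_union_left⟩

theorem isPolicy_core : IsPolicy (Rule.coreVars : Rule L κ ν → Finset Var) Rule.idSet :=
  ⟨fun _ => Finset.Subset.refl _, fun _ => Finset.Subset.refl _⟩

/-- Every qualified answer of the unfolded program is one of the original program. -/
theorem QA_unf_subset {CT : L.Theory} (hCT : ContainsClarkEquality CT) {P : Set (Rule L κ ν)}
    (hP : IsAnnotatedProgram P) {r : Rule L κ ν} (hr : SafelyReplaceable CT P r) (G : Goal L κ) :
    QA CT ((P \ {r}) ∪ Unf CT P r) G ⊆ QA CT P G := by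
  have hP' := isAnnotatedProgram_unf (CT := CT) hP hr.mem
  intro A hA
  obtain ⟨σ, hσ, hans⟩ := (mem_QA_iff_machine hP' (isPolicy_vars_union r)).1 hA
  refine (mem_QA_iff_machine hP isPolicy_core).2 ?_
  have : ∃ τ, Relation.ReflTransGen (LStep CT Rule.coreVars Rule.idSet P) (G.linit ν) τ ∧
      Ahead σ τ ∧ LGood G.fv σ ∧ LGood G.fv τ := by
    clear hans
    induction hσ with
    | refl => exact ⟨_, .refl, Ahead.refl _, G.lgood, G.lgood⟩
    | tail _ hs ih =>
      obtain ⟨τ, hτ, hah, hgσ, hgτ⟩ := ih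
      obtain ⟨τ', hτ', hah'⟩ := hah.exists_steps_original hCT hP hr.mem hr.guard_equiv hgσ hgτ hs
      exact ⟨τ', hτ.trans hτ', hah', hgσ.step hP' (isPolicy_vars_union r) hs,
        hgτ.steps hP isPolicy_core hτ'⟩
  obtain ⟨τ, hτ, hah, _⟩ := this
  refine ⟨τ, hτ, hah.isAnswer hans fun r₀ hr₀ => ⟨hP r₀ hr₀, fun C K₁ K₂ hcan => ?_⟩⟩
  by_cases h : r₀ = r
  · subst h
    -- Where `r` can fire, so can each of its unfolded versions, and there is at least one.
    obtain ⟨⟨v, is⟩, hv, S₁, S₂, r', _, hu⟩ := hr.uPlus_nonempty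
    have hmem := hu.mem_unf hv
    obtain ⟨hname, hkeep, hrem⟩ := hu.head
    exact ⟨r', Or.inr hmem, hname, hcan.of_guard hkeep hrem (hr.guard_equiv r' hmem).1⟩
  · exact ⟨r₀, Or.inl ⟨hr₀, h⟩, rfl, hcan⟩

end Soundness

/-! ### Moving the first use of the body of a fired rule to the front -/

section Commutation

variable {L : FirstOrder.Language.{u, v}} {κ : Type w} {ν : Type z}

/-- The instances of the body atoms of `r`, fired with `π` and `ι`, are all still present in `σ`,
next to the atoms in `R`, and have not been used since. -/
structure Pending (CT : L.Theory) (r : Rule L κ ν) (π : Equiv.Perm Var) (ι : ℕ → ℕ)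
    (σ : LState L κ ν) (R : Multiset (IAtom L κ)) : Prop where
  chr : σ.chr = r.chr.map (instAtom π ι) + R
  builtin : r.builtin.map (Builtin.rename π) ≤ σ.builtin + σ.store
  guard : ∀ (M : Model CT) (a : Var → M), σ.store.Realize a → r.guard.Realize (a ∘ π)
  tokens_mem : ∀ t ∈ r.tokens, (t.1, t.2.map ι) ∈ σ.history
  mem_tokens : ∀ (name : ν) (l : List ℕ), l ≠ [] → (∀ i ∈ l, i ∈ r.idSet) →
    (name, l.map ι) ∈ σ.history → (name, l) ∈ r.tokens

theorem exists_add_refinement {α : Type*} {A B C D : Multiset α} (h : A + B = C + D) :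
    ∃ a b c d : Multiset α, A = a + b ∧ B = c + d ∧ C = a + c ∧ D = b + d := by
  classical
  have hc : ∀ x, A.count x + B.count x = C.count x + D.count x := fun x => by
    rw [← Multiset.count_add, ← Multiset.count_add, h]
  refine ⟨A ∩ C, A - C, C - A, D - (A - C), ?_, ?_, ?_, ?_⟩ <;> ext x <;> have := hc x <;>
    simp only [Multiset.count_add, Multiset.count_inter, Multiset.count_sub] <;> omega

variable [DecidableEq ν]

/-- Paths of a given length. -/
def LPath (CT : L.Theory) (fr : Rule L κ ν → Finset Var) (fi : Rule L κ ν → Finset ℕ)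
    (P : Set (Rule L κ ν)) : ℕ → LState L κ ν → LState L κ ν → Prop
  | 0, l, l' => l = l'
  | n + 1, l, l' => ∃ l₁, LStep CT fr fi P l l₁ ∧ LPath CT fr fi P n l₁ l'

theorem exists_lpath {CT : L.Theory} {fr : Rule L κ ν → Finset Var} {fi : Rule L κ ν → Finset ℕ}
    {P : Set (Rule L κ ν)} {l l' : LState L κ ν}
    (h : Relation.ReflTransGen (LStep CT fr fi P) l l') : ∃ n, LPath CT fr fi P n l l' := by
  induction h using Relation.ReflTransGen.head_induction_on with
  | refl => exact ⟨0, rfl⟩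
  | head hs _ ih =>
    obtain ⟨n, hn⟩ := ih
    exact ⟨n + 1, _, hs, hn⟩

theorem LStep.store_realize {CT : L.Theory} {fr : Rule L κ ν → Finset Var}
    {fi : Rule L κ ν → Finset ℕ} {P : Set (Rule L κ ν)} {l l' : LState L κ ν}
    (h : LStep CT fr fi P l l') {M : Type*} [L.Structure M] {a : Var → M}
    (ha : l'.store.Realize a) : l.store.Realize a := by
  cases h with
  | solve => exact (Conj.realize_cons.1 ha).2
  | apply => exact (Conj.realize_add.1 ha).2

theorem LPath.store_realize {CT : L.Theory} {fr : Rule L κ ν → Finset Var}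
    {fi : Rule L κ ν → Finset ℕ} {P : Set (Rule L κ ν)} {M : Type*} [L.Structure M]
    {a : Var → M} : ∀ {n : ℕ} {l l' : LState L κ ν}, LPath CT fr fi P n l l' →
      l'.store.Realize a → l.store.Realize a
  | 0, _, _, h, ha => by cases h; exact ha
  | _ + 1, _, _, ⟨_, h₁, h⟩, ha => h₁.store_realize (h.store_realize ha)

/-- An answer read off from a state with an unsatisfiable store is `false`. -/
theorem State.IsAnswer.not_satisfiable {CT : L.Theory} {P : Set (Rule L κ ν)} {V : Finset Var}
    {s : State L κ ν} {A : Answer L κ} (h : s.IsAnswer CT P V A)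
    (hs : ¬ s.store.Satisfiable CT) : ¬ A.store.Satisfiable CT := by
  rcases h with ⟨_, h⟩ | ⟨_, h⟩
  · rintro ⟨M, a, ha⟩
    have hm : A.chr.map (fun h => (h.pred, h.args.map fun t => t.realize a)) ∈ A.meaning V a :=
      ⟨a, fun _ _ => rfl, ha, rfl⟩
    rw [h M a] at hm
    obtain ⟨b, _, hb, _⟩ := hm
    exact hs ⟨M, b, hb⟩
  · exact h

/-- The state after firing `w` in `σ`; the atoms of `σ` are `H₁`, `H₂` and those in `R`, and the
variables in `W` are recorded as used. -/
def LState.fire (σ : LState L κ ν) (w : Rule L κ ν) (π : Equiv.Perm Var) (ι : ℕ → ℕ)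
    (H₁ H₂ : List (IAtom L κ)) (R : Multiset (IAtom L κ)) (W : Finset Var) : LState L κ ν :=
  ⟨fired w π ι H₁ H₂ R σ.builtin σ.store σ.history, σ.usedVars ∪ W,
    σ.usedIds ∪ w.idSet.image ι⟩

/-- Solving a constraint commutes with a firing. -/
theorem LState.fire_solve {CT : L.Theory} {fr : Rule L κ ν → Finset Var}
    {fi : Rule L κ ν → Finset ℕ} {P : Set (Rule L κ ν)} {Q : Multiset (IAtom L κ)} {c : Builtin L}
    {B C : Conj L} {T : Finset (Token ν)} {U : Finset Var} {I : Finset ℕ} (w : Rule L κ ν)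
    (π : Equiv.Perm Var) (ι : ℕ → ℕ) (H₁ H₂ : List (IAtom L κ)) (R : Multiset (IAtom L κ))
    (W : Finset Var) :
    LStep CT fr fi P (LState.fire ⟨⟨Q, c ::ₘ B, C, T⟩, U, I⟩ w π ι H₁ H₂ R W)
      (LState.fire ⟨⟨Q, B, c ::ₘ C, T⟩, U, I⟩ w π ι H₁ H₂ R W) := by
  simp only [LState.fire, fired, Multiset.add_cons]
  exact LStep.solve _ _ _ _ _ _ _

/-- Two firings on disjoint sets of atoms commute. -/
theorem LState.fire_apply {CT : L.Theory} {fr : Rule L κ ν → Finset Var}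
    {fi : Rule L κ ν → Finset ℕ} {P : Set (Rule L κ ν)} {Q Q' : Multiset (IAtom L κ)}
    {B C : Conj L} {T : Finset (Token ν)} {U : Finset Var} {I : Finset ℕ} (w : Rule L κ ν)
    (πw : Equiv.Perm Var) (ιw : ℕ → ℕ) (S₁ S₂ : List (IAtom L κ)) (W : Finset Var) {r : Rule L κ ν}
    (hr : r ∈ P) {π : Equiv.Perm Var} {ι : ℕ → ℕ} {H₁ H₂ : List (IAtom L κ)}
    {R : Multiset (IAtom L κ)} (hvars : ∀ x ∈ fr r, π x ∉ U ∪ W) (hinj : Set.InjOn ι (fi r))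
    (hids : ∀ i ∈ fi r, ι i ∉ I ∪ w.idSet.image ιw) (can : CanFire CT C (chrs H₁) (chrs H₂) r)
    (htok : (r.name, CHR.ids (H₁ ++ H₂)) ∉ T ∪ firedToken w (CHR.ids (S₁ ++ S₂)) ∪
      w.tokens.image fun t => (t.1, t.2.map ιw)) :
    LStep CT fr fi P
      (LState.fire ⟨⟨Q, B, C, T⟩, U, I⟩ w πw ιw S₁ S₂
        (Multiset.ofList H₁ + Multiset.ofList H₂ + R) W)
      (LState.fire ⟨fired r π ι H₁ H₂ Q' B C T, U ∪ (fr r).image π, I ∪ (fi r).image ι⟩ w πw ιw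
        S₁ S₂ (r.chr.map (instAtom π ι) + Multiset.ofList H₁ + R) W) := by
  have h := LStep.apply (CT := CT) (fr := fr) (fi := fi) r hr π ι H₁ H₂
    (w.chr.map (instAtom πw ιw) + Multiset.ofList S₁ + R) (w.builtin.map (Builtin.rename πw) + B)
    (eqns (chrs (S₁ ++ S₂)) ((w.keep ++ w.remove).map (Atom.rename πw)) + C)
    (T ∪ firedToken w (CHR.ids (S₁ ++ S₂)) ∪ w.tokens.image fun t => (t.1, t.2.map ιw))
    (U ∪ W) (I ∪ w.idSet.image ιw) hvars hinj hids
    (can.mono fun M a ha => (Conj.realize_add.1 ha).2) htok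
  have e1 : Multiset.ofList H₁ + Multiset.ofList H₂
      + (w.chr.map (instAtom πw ιw) + Multiset.ofList S₁ + R)
      = w.chr.map (instAtom πw ιw) + Multiset.ofList S₁
        + (Multiset.ofList H₁ + Multiset.ofList H₂ + R) := by abel
  rw [e1] at h
  refine cast (congrArg (LStep CT fr fi P _) ?_) h
  simp only [LState.fire, fired, LState.mk.injEq, State.mk.injEq]
  refine ⟨⟨by abel, by abel, by abel, ?_⟩, Finset.union_right_comm _ _ _,
    Finset.union_right_comm _ _ _⟩
  ext t
  simp only [Finset.mem_union]
  constructor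
  · rintro ((((h | h) | h) | h) | h)
    exacts [Or.inl (Or.inl (Or.inl (Or.inl h))), Or.inl (Or.inr h), Or.inr h,
      Or.inl (Or.inl (Or.inl (Or.inr h))), Or.inl (Or.inl (Or.inr h))]
  · rintro ((((h | h) | h) | h) | h)
    exacts [Or.inl (Or.inl (Or.inl (Or.inl h))), Or.inl (Or.inr h), Or.inr h,
      Or.inl (Or.inl (Or.inl (Or.inr h))), Or.inl (Or.inl (Or.inr h))]

theorem Pending.solve {CT : L.Theory} {r : Rule L κ ν} {π : Equiv.Perm Var} {ι : ℕ → ℕ}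
    {Q R : Multiset (IAtom L κ)} {c : Builtin L} {B C : Conj L} {T : Finset (Token ν)}
    {U : Finset Var} {I : Finset ℕ} (h : Pending CT r π ι ⟨⟨Q, c ::ₘ B, C, T⟩, U, I⟩ R) :
    Pending CT r π ι ⟨⟨Q, B, c ::ₘ C, T⟩, U, I⟩ R := by
  refine ⟨h.chr, ?_, fun M a ha => h.guard M a (Conj.realize_cons.1 ha).2, h.tokens_mem,
    h.mem_tokens⟩
  have := h.builtin
  simpa [Multiset.cons_add, Multiset.add_cons] using this

theorem Pending.apply {CT : L.Theory} {r : Rule L κ ν} {π : Equiv.Perm Var} {ι : ℕ → ℕ}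
    {V : Finset Var} {Q R : Multiset (IAtom L κ)} {B C : Conj L} {T : Finset (Token ν)}
    {U U' : Finset Var} {I I' : Finset ℕ} {r₀ : Rule L κ ν} {π₀ : Equiv.Perm Var} {ι₀ : ℕ → ℕ}
    (hr₀ : r₀.WellFormed)
    {H₁ H₂ : List (IAtom L κ)}
    (h : Pending CT r π ι ⟨⟨Q, B, C, T⟩, U, I⟩ (Multiset.ofList H₁ + Multiset.ofList H₂ + R))
    (hσ : LGood V ⟨⟨Q, B, C, T⟩, U, I⟩) (hids : ∀ i ∈ r₀.idSet, ι₀ i ∉ I) :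
    Pending CT r π ι ⟨fired r₀ π₀ ι₀ H₁ H₂ (r.chr.map (instAtom π ι) + R) B C T, U', I'⟩
      (r₀.chr.map (instAtom π₀ ι₀) + Multiset.ofList H₁ + R) := by
  obtain rfl : Q = _ := h.chr
  refine ⟨?_, ?_, fun M a ha => h.guard M a (Conj.realize_add.1 ha).2, fun t ht => ?_,
    fun name l hl hlr hm => ?_⟩
  · simp only [fired]; abel
  · refine h.builtin.trans ?_
    simp only [fired]
    exact add_le_add (Multiset.le_add_left _ _) (Multiset.le_add_left _ _)
  · simp only [fired, Finset.mem_union]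
    exact Or.inl (Or.inl (h.tokens_mem t ht))
  · obtain ⟨i, hi⟩ := List.exists_mem_of_ne_nil l hl
    have hil : ι i ∈ l.map ι := List.mem_map_of_mem hi
    obtain ⟨k, hk, rfl⟩ := Rule.mem_idSet.1 (hlr i hi)
    have hkF : instAtom π ι k ∈ r.chr.map (instAtom π ι) := Multiset.mem_map_of_mem _ hk
    simp only [fired, Finset.mem_union, Finset.mem_image] at hm
    rcases hm with (hm | hm) | ⟨t, ht, hm⟩
    · exact h.mem_tokens name l hl hlr hm
    · exfalso
      have := mem_firedToken hm
      simp only [Prod.mk.injEq] at this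
      rw [this.2] at hil
      obtain ⟨k', hk', he⟩ := mem_ids_append.1 hil
      have hn := hσ.nodup
      simp only at hn
      rw [Multiset.map_add, Multiset.nodup_add, Multiset.disjoint_left] at hn
      refine hn.2.2 (Multiset.mem_map_of_mem _ hkF) (Multiset.mem_map.2 ⟨k', ?_, he⟩)
      simp only [Multiset.mem_add, Multiset.mem_coe]
      exact Or.inl hk'
    · exfalso
      simp only [Prod.mk.injEq] at hm
      rw [← hm.2] at hil
      obtain ⟨j, hj, he⟩ := List.mem_map.1 hil
      exact hids j (hr₀.mem_idSet ht hj)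
        (he ▸ hσ.ids (instAtom π ι k) (Multiset.mem_add.2 (Or.inl hkF)))

/-- This is where `U^# = ∅` enters. A rule `r₀` which fires, under a satisfiable store, on atoms
some of which stem from the body of `r`, uses only atoms of this body, and its firing is an instance
of an unfolding of `r`. -/
theorem Pending.exists_unfoldsTo {CT : L.Theory} {P : Set (Rule L κ ν)} {r : Rule L κ ν}
    (hr : SafelyReplaceable CT P r) {π : Equiv.Perm Var} {ι : ℕ → ℕ} {V : Finset Var}
    (hinj : Set.InjOn ι r.idSet) {σ : LState L κ ν} {R : Multiset (IAtom L κ)}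
    (h : Pending CT r π ι σ R) (hσ : LGood V σ) (hU : r.vars.image π ⊆ σ.usedVars)
    (hsat : σ.store.Satisfiable CT) {r₀ : Rule L κ ν} (hr₀ : r₀ ∈ P) {π₀ : Equiv.Perm Var}
    (hvars : ∀ x ∈ r₀.vars, π₀ x ∉ σ.usedVars) {H₁ H₂ : List (IAtom L κ)}
    (can : CanFire CT σ.store (chrs H₁) (chrs H₂) r₀)
    (htok : (r₀.name, CHR.ids (H₁ ++ H₂)) ∉ σ.history)
    (hH : Multiset.ofList H₁ + Multiset.ofList H₂ ≤ σ.chr) {a b : Multiset (IAtom L κ)}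
    (hab : Multiset.ofList H₁ + Multiset.ofList H₂ = a + b)
    (haF : a ≤ r.chr.map (instAtom π ι)) (ha : a ≠ 0) :
    IsApartVariant P r (r₀.rename (π₀.trans π.symm)) ∧ ∃ S₁ S₂ r',
      UnfoldsTo CT r (r₀.rename (π₀.trans π.symm)) S₁ S₂ r' ∧
        H₁ = S₁.map (instAtom π ι) ∧ H₂ = S₂.map (instAtom π ι) := by
  set v := r₀.rename (π₀.trans π.symm) with hv
  have hvv : ∀ y ∈ v.vars, π y ∉ σ.usedVars := by
    intro y hy
    rw [hv, Rule.vars_rename] at hy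
    obtain ⟨x, hx, rfl⟩ := Finset.mem_image.1 hy
    simpa using hvars x hx
  have hapart : IsApartVariant P r v := by
    refine ⟨⟨r₀, hr₀, _, rfl⟩, Finset.disjoint_left.2 fun y hy hyr => hvv y hy ?_⟩
    exact hU (Finset.mem_image_of_mem _ hyr)
  set C' : Conj L := σ.store.map (Builtin.rename π.symm) with hC'
  have hdisj : Disjoint C'.fv v.vars := by
    refine Finset.disjoint_left.2 fun y hy hyv => hvv y hyv (hσ.vars ?_)
    rw [hC', Conj.fv_rename] at hy
    obtain ⟨x, hx, rfl⟩ := Finset.mem_image.1 hy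
    simp [State.vars, hx]
  have hsat' : Conj.Satisfiable CT (r.guard + C') := by
    obtain ⟨M, e, he⟩ := hsat
    refine ⟨M, e ∘ π, Conj.realize_add.2 ⟨h.guard M e he, (Conj.realize_rename _).2 ?_⟩⟩
    have : (e ∘ π) ∘ π.symm = e := by funext x; simp
    rw [this]
    exact he
  have hEF : EntailsFiring CT (r.guard + C') ((chrs H₁).map (Atom.rename π.symm))
      ((chrs H₂).map (Atom.rename π.symm)) v := by
    refine (entailsFiring_iff_canFire ?_ ?_).2 ((canFire_rename _).2
      ((can.rename_store π.symm).mono fun M e he => (Conj.realize_add.1 he).2))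
    · rw [Conj.fv_add, Finset.disjoint_union_right]
      refine ⟨hapart.2.mono_right fun x hx => ?_, hdisj.symm⟩
      simp [Rule.vars, hx]
    · refine Finset.disjoint_left.2 fun y hyv hy => hvv y hyv (hσ.vars ?_)
      rw [← List.map_append, listVars_rename] at hy
      obtain ⟨x, hx, rfl⟩ := Finset.mem_image.1 hy
      obtain ⟨h', hh', hx⟩ := mem_listVars.1 hx
      have : ∃ k, k ∈ σ.chr ∧ k.1 = h' := by
        simp only [chrs, List.mem_append, List.mem_map] at hh'
        rcases hh' with ⟨k, hk, rfl⟩ | ⟨k, hk, rfl⟩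
        · exact ⟨k, Multiset.mem_of_le hH (Multiset.mem_add.2 (Or.inl (by simpa using hk))), rfl⟩
        · exact ⟨k, Multiset.mem_of_le hH (Multiset.mem_add.2 (Or.inr (by simpa using hk))), rfl⟩
      obtain ⟨k, hk, rfl⟩ := this
      have := mem_storeVars.2 ⟨k, hk, hx⟩
      simp only [Equiv.apply_symm_apply, State.vars, Finset.mem_union]
      exact Or.inl (Or.inl this)
  -- The inverse of the instantiation of the body atoms.
  set g : IAtom L κ → IAtom L κ := fun k =>
    (k.1.rename π.symm, Function.invFunOn ι r.idSet k.2) with hgdef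
  have hg : ∀ k ∈ r.chr, g (instAtom π ι k) = k := by
    intro k hk
    have hki : k.2 ∈ (r.idSet : Set ℕ) := Rule.mem_idSet.2 ⟨k, hk, rfl⟩
    simp only [hgdef, instAtom, Atom.rename_symm]
    rw [hinj.leftInvOn_invFunOn hki]
  have hag : a.map g ≤ r.chr := by
    refine (Multiset.map_le_map haF).trans (le_of_eq ?_)
    rw [Multiset.map_map]
    conv_rhs => rw [← Multiset.map_id r.chr]
    exact Multiset.map_congr rfl fun k hk => hg k hk
  have hnot : v ∉ USharp CT P r := by rw [hr.uSharp_empty]; simp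
  -- Otherwise `v` would use atoms of the body together with other constraints.
  have hb : b = 0 := by
    by_contra hb
    refine hnot ⟨hapart, Or.inr ⟨a.map g, b.map fun k => k.1.rename π.symm, _, _, C', hag,
      by simpa using ha, by simpa using hb, hdisj, hsat', ?_, hEF⟩⟩
    have e : (Multiset.ofList H₁ + Multiset.ofList H₂).map (fun k => k.1.rename π.symm)
        = a.map (fun k => k.1.rename π.symm) + b.map fun k => k.1.rename π.symm := by
      rw [hab, Multiset.map_add]
    rw [Multiset.map_map]
    refine Eq.trans e.symm ?_
    simp [chrs, Function.comp_def]
  subst hb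
  rw [add_zero] at hab
  have hmemF : ∀ k, k ∈ H₁ ∨ k ∈ H₂ → ∃ k₀ ∈ r.chr, instAtom π ι k₀ = k := by
    intro k hk
    refine Multiset.mem_map.1 (Multiset.mem_of_le haF ?_)
    rw [← hab]
    simpa using hk
  have hback : ∀ k, k ∈ H₁ ∨ k ∈ H₂ → instAtom π ι (g k) = k := by
    intro k hk
    obtain ⟨k₀, hk₀, rfl⟩ := hmemF k hk
    rw [hg k₀ hk₀]
  have hH₁ : (H₁.map g).map (instAtom π ι) = H₁ := by
    rw [List.map_map]
    conv_rhs => rw [← List.map_id H₁]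
    exact List.map_congr_left fun k hk => hback k (Or.inl hk)
  have hH₂ : (H₂.map g).map (instAtom π ι) = H₂ := by
    rw [List.map_map]
    conv_rhs => rw [← List.map_id H₂]
    exact List.map_congr_left fun k hk => hback k (Or.inr hk)
  have hchrs : ∀ H : List (IAtom L κ), chrs (H.map g) = (chrs H).map (Atom.rename π.symm) := by
    intro H
    simp [chrs, hgdef]
  have hle : (Multiset.ofList (H₁.map g) + Multiset.ofList (H₂.map g)) ≤ r.chr := by
    rw [← Multiset.map_coe, ← Multiset.map_coe, ← Multiset.map_add, hab]
    exact hag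
  -- Otherwise `v` could fire on atoms of the body without giving an unfolding.
  have hUP : (v, CHR.ids (H₁.map g ++ H₂.map g)) ∈ UPlus CT P r := by
    by_contra hU
    refine hnot ⟨hapart, Or.inl ⟨H₁.map g, H₂.map g, C', hle, hdisj, hsat', ?_, fun ht => ?_, hU⟩⟩
    · rw [hchrs, hchrs]
      exact hEF
    · refine htok ?_
      have := h.tokens_mem _ ht
      simp only at this
      rwa [← ids_map_instAtom π, List.map_append, hH₁, hH₂] at this
  -- The set `U⁺` records only identifiers, which determine the atoms of the body.
  obtain ⟨_, S₁, S₂, r', hids, hu⟩ := hUP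
  simp only at hids hu
  refine ⟨hapart, S₁, S₂, r', hu, ?_⟩
  have hnd : ∀ k ∈ r.chr, ∀ k' ∈ r.chr, k.2 = k'.2 → k = k' := by
    intro k hk k' hk' he
    have hn := hσ.nodup
    rw [h.chr, Multiset.map_add, Multiset.nodup_add, Multiset.map_map] at hn
    exact Multiset.inj_on_of_nodup_map hn.1 k hk k' hk' (congrArg ι he)
  have hl : H₁.map g ++ H₂.map g = S₁ ++ S₂ := by
    refine list_eq_of_map_eq (f := Prod.snd) (s := {k | k ∈ r.chr})
      (fun k hk k' hk' he => hnd k hk k' hk' he) (fun k hk => ?_) (fun k hk => ?_) hids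
    · exact Multiset.mem_of_le hle (by simpa using hk)
    · obtain ⟨K, _, _, hchr, _⟩ := hu
      show k ∈ r.chr
      rw [hchr]
      simp only [Multiset.mem_add, Multiset.mem_coe]
      rw [List.mem_append] at hk
      tauto
  obtain ⟨h1, h2⟩ := List.append_inj hl (by
    have e1 := hEF.1.length_eq
    obtain ⟨_, _, _, _, _, hc, _⟩ := hu
    have e2 := hc.length_eq
    simp only [chrs, List.length_map] at e1 e2 ⊢
    omega)
  exact ⟨by rw [← h1, hH₁], by rw [← h2, hH₂]⟩

end Commutation

section FrontFiring

variable {L : FirstOrder.Language.{u, v}} {κ : Type w} {ν : Type z} [DecidableEq ν]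

/-- In the state `σ`, in which the instances under `π` and `ι` of the body atoms of `r` are
present next to the atoms in `R`, a rule `v₀` which yields an unfolding of `r` may be fired at
once on such instances, and the answer `A` is then still reached in at most `n` steps. The
variables in `W`, which are recorded for this firing, avoid `U₀`, and those already used in `σ` are
in `U₁`. -/
structure FrontFiring (CT : L.Theory) (fr : Rule L κ ν → Finset Var) (P : Set (Rule L κ ν))
    (V : Finset Var) (A : Answer L κ) (r : Rule L κ ν) (π : Equiv.Perm Var) (ι : ℕ → ℕ)
    (U₀ U₁ : Finset Var) (n : ℕ) (σ : LState L κ ν) (R : Multiset (IAtom L κ))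
    (v₀ : Rule L κ ν) (πv : Equiv.Perm Var) (S₁ S₂ : List (IAtom L κ)) (r' : Rule L κ ν)
    (K : Multiset (IAtom L κ)) (ιw : ℕ → ℕ) (W : Finset Var) : Prop where
  mem : v₀ ∈ P
  apart : IsApartVariant P r (v₀.rename πv)
  unfolds : UnfoldsTo CT r (v₀.rename πv) S₁ S₂ r'
  chr : r.chr = K + Multiset.ofList S₁ + Multiset.ofList S₂
  inj : Set.InjOn ιw v₀.idSet
  ids : ∀ j ∈ v₀.idSet, ιw j ∉ σ.usedIds
  vars : (v₀.rename πv).coreVars.image π ⊆ W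
  fresh : ∀ x ∈ W, x ∉ U₀
  used : ∀ x ∈ W, x ∈ σ.usedVars → x ∈ U₁
  path : ∃ k ≤ n, ∃ σe, LPath CT fr Rule.idSet P k
    (σ.fire v₀ (πv.trans π) ιw (S₁.map (instAtom π ι)) (S₂.map (instAtom π ι))
      (K.map (instAtom π ι) + R) W) σe ∧ σe.toState.IsAnswer CT P V A

/-- While the body of `r` is pending, a rule that yields an unfolding of `r` can fire on it. -/
theorem Pending.canFire {CT : L.Theory} {P : Set (Rule L κ ν)} {r : Rule L κ ν}
    (hr : SafelyReplaceable CT P r) {π : Equiv.Perm Var} {ι : ℕ → ℕ} {σ : LState L κ ν}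
    {R : Multiset (IAtom L κ)} (h : Pending CT r π ι σ R) (hb : σ.builtin = 0) {v r' : Rule L κ ν}
    {S₁ S₂ : List (IAtom L κ)} (hv : IsApartVariant P r v) (hu : UnfoldsTo CT r v S₁ S₂ r') :
    CanFire CT σ.store (chrs (S₁.map (instAtom π ι))) (chrs (S₂.map (instAtom π ι))) v := by
  rw [chrs_map_instAtom, chrs_map_instAtom]
  refine hu.canFire (hr.guard_equiv r' (hu.mem_unf hv)) hv.2 fun M a ha => ?_
  refine Conj.realize_add.2 ⟨(Conj.realize_rename π).1 fun c hc => ha c ?_, h.guard M a ha⟩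
  have := Multiset.mem_of_le h.builtin hc
  rwa [hb, zero_add] at this

theorem UnfoldsTo.exists_chr {CT : L.Theory} {r v r' : Rule L κ ν} {S₁ S₂ : List (IAtom L κ)}
    (h : UnfoldsTo CT r v S₁ S₂ r') :
    ∃ K, r.chr = K + Multiset.ofList S₁ + Multiset.ofList S₂ := by
  obtain ⟨K, _, _, hK, _⟩ := h
  exact ⟨K, hK⟩

/-- If the store is unsatisfiable, any rule may be fired in addition, since the answer is `false`
anyway. -/
theorem exists_frontFiring_of_not_satisfiable {CT : L.Theory} {fr : Rule L κ ν → Finset Var}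
    {P : Set (Rule L κ ν)} {r vs rs : Rule L κ ν} {Ss₁ Ss₂ : List (IAtom L κ)}
    (hvs : IsApartVariant P r vs) (hus : UnfoldsTo CT r vs Ss₁ Ss₂ rs) {V : Finset Var}
    {A : Answer L κ} {π : Equiv.Perm Var} {ι : ℕ → ℕ} {U₀ U₁ : Finset Var}
    (h₁ : vs.vars.image π ⊆ U₁) (h₀ : ∀ x ∈ vs.vars, π x ∉ U₀) (n : ℕ) {σ : LState L κ ν}
    (R : Multiset (IAtom L κ)) (hσ : ¬ σ.store.Satisfiable CT) (hA : ¬ A.store.Satisfiable CT) :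
    ∃ v₀ πv S₁ S₂ r' K ιw W, FrontFiring CT fr P V A r π ι U₀ U₁ n σ R
      v₀ πv S₁ S₂ r' K ιw W := by
  obtain ⟨v₀, hv₀, πv, rfl⟩ := hvs.1
  obtain ⟨K, hK⟩ := hus.exists_chr
  refine ⟨v₀, πv, Ss₁, Ss₂, rs, K, (· + (σ.usedIds.sup id + 1)), (v₀.rename πv).vars.image π, hv₀,
    hvs, hus, hK, fun i _ j _ hij => Nat.add_right_cancel hij, fun j _ hj => ?_,
    Finset.image_subset_image (Rule.coreVars_subset_vars _), fun x hx => ?_, fun x hx _ => h₁ hx, 0,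
    Nat.zero_le n, _, rfl, Or.inr ⟨?_, hA⟩⟩
  · have : j + (σ.usedIds.sup id + 1) ≤ σ.usedIds.sup id := Finset.le_sup (f := id) hj
    omega
  · obtain ⟨y, hy, rfl⟩ := Finset.mem_image.1 hx
    exact h₀ y hy
  · rintro ⟨M, a, ha⟩
    exact hσ ⟨M, a, (Conj.realize_add.1 ha).2⟩

/-- A computation that leads from a state with a pending body of `r` to an answer can be rearranged
so that it starts with a firing that corresponds to an unfolding of `r`. If the computation never
uses the body, its store must become unsatisfiable, since otherwise the last state would not be
final; then the rule `vs` is fired in addition. -/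
theorem Pending.exists_frontFiring {CT : L.Theory} {P : Set (Rule L κ ν)}
    (hP : IsAnnotatedProgram P) {r : Rule L κ ν}
    (hr : SafelyReplaceable CT P r) {vs rs : Rule L κ ν} {Ss₁ Ss₂ : List (IAtom L κ)}
    (hvs : IsApartVariant P r vs) (hus : UnfoldsTo CT r vs Ss₁ Ss₂ rs) {V : Finset Var}
    {A : Answer L κ} {π : Equiv.Perm Var} {ι : ℕ → ℕ} (hinj : Set.InjOn ι r.idSet)
    {U₀ U₁ : Finset Var} (h₁ : (r.vars ∪ vs.vars).image π ⊆ U₁)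
    (h₀ : ∀ x ∈ r.vars ∪ vs.vars, π x ∉ U₀) (hU₀ : U₀ ⊆ U₁) {σe : LState L κ ν}
    (hA : σe.toState.IsAnswer CT P V A) :
    ∀ (n : ℕ) (σ : LState L κ ν) (R : Multiset (IAtom L κ)), Pending CT r π ι σ R → LGood V σ →
      U₁ ⊆ σ.usedVars → LPath CT (fun r₀ => r₀.vars ∪ vs.vars) Rule.idSet P n σ σe →
      ∃ v₀ πv S₁ S₂ r' K ιw W, FrontFiring CT (fun r₀ => r₀.vars ∪ vs.vars) P V A r π ι U₀ U₁ n σ R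
        v₀ πv S₁ S₂ r' K ιw W := by
  have hpol : IsPolicy (fun r₀ : Rule L κ ν => r₀.vars ∪ vs.vars) Rule.idSet :=
    ⟨fun r₀ => r₀.coreVars_subset_vars.trans Finset.subset_union_left,
      fun _ => Finset.Subset.refl _⟩
  have hfalse : ∀ (n : ℕ) (σ : LState L κ ν) (R : Multiset (IAtom L κ)),
      ¬ σ.store.Satisfiable CT → LPath CT (fun r₀ => r₀.vars ∪ vs.vars) Rule.idSet P n σ σe →
      ∃ v₀ πv S₁ S₂ r' K ιw W, FrontFiring CT (fun r₀ => r₀.vars ∪ vs.vars) P V A r π ι U₀ U₁ n σ R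
        v₀ πv S₁ S₂ r' K ιw W := fun n σ R hsat hpath =>
    exists_frontFiring_of_not_satisfiable hvs hus
      ((Finset.image_subset_image Finset.subset_union_right).trans h₁)
      (fun x hx => h₀ x (Finset.mem_union_right _ hx)) n R hsat
      (hA.not_satisfiable fun ⟨M, a, ha⟩ => hsat ⟨M, a, hpath.store_realize ha⟩)
  intro n
  induction n with
  | zero =>
    intro σ R h hσ hU hpath
    by_cases hsat : σ.store.Satisfiable CT
    swap
    · exact hfalse _ _ _ hsat hpath
    exfalso
    obtain rfl : σ = σe := hpath
    -- The rule `vs` could still fire on the body of `r`.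
    rcases hA with ⟨⟨hb, hf⟩, _⟩ | ⟨hns, _⟩
    swap
    · exact hns hsat
    have hcan := h.canFire hr hb hvs hus
    obtain ⟨v₀, hv₀, πv, rfl⟩ := hvs.1
    obtain ⟨K, hK⟩ := hus.exists_chr
    have htok := hf v₀ hv₀ (Ss₁.map (instAtom π ι)) (Ss₂.map (instAtom π ι))
      (K.map (instAtom π ι) + R) (by
        rw [h.chr, hK, Multiset.map_add, Multiset.map_add, Multiset.map_coe, Multiset.map_coe]
        abel) ((canFire_rename πv).1 hcan)
    rw [← List.map_append, ids_map_instAtom] at htok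
    exact hus.token_not_mem (h.mem_tokens _ _ (hus.ids_ne_nil ((hP v₀ hv₀).rename πv)) hus.ids_mem
      htok)
  | succ n ih =>
    intro σ R h hσ hU hpath
    by_cases hsat : σ.store.Satisfiable CT
    swap
    · exact hfalse _ _ _ hsat hpath
    obtain ⟨σ₁, hs, hpath⟩ := hpath
    cases hs with
    | solve S c B C T U I =>
      obtain ⟨v₀, πv, S₁, S₂, r', K, ιw, W, hf⟩ := ih _ R h.solve
        (hσ.step hP hpol (LStep.solve (CT := CT) (P := P) S c B C T U I))
        hU hpath
      obtain ⟨k, hk, σe', hpath', hA'⟩ := hf.path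
      exact ⟨v₀, πv, S₁, S₂, r', K, ιw, W, hf.mem, hf.apart, hf.unfolds, hf.chr, hf.inj, hf.ids,
        hf.vars, hf.fresh, hf.used, k + 1, Nat.succ_le_succ hk, σe',
        ⟨_, LState.fire_solve _ _ _ _ _ _ _, hpath'⟩, hA'⟩
    | apply r₀ hr₀ π₀ ι₀ H₁ H₂ S B C T U I hvars hids_inj hids can htok =>
      have hchr := h.chr
      simp only at hchr
      obtain ⟨a, b, c, d, hab, hS, hF, hR⟩ := exists_add_refinement hchr
      have hvars₀ : ∀ x ∈ r₀.vars, π₀ x ∉ U := fun x hx =>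
        hvars x (Finset.mem_union_left _ hx)
      by_cases ha : a = 0
      · -- The firing does not use the body of `r` and is postponed.
        subst ha
        rw [zero_add] at hab hF
        subst hab hF hR hS
        rw [← add_assoc] at hchr
        have hI : ∀ k, k ∈ H₁ ∨ k ∈ H₂ → k.2 ∈ I := fun k hk => hσ.ids k (by
          simp only [Multiset.mem_add, Multiset.mem_coe]
          exact Or.inl hk)
        have hp := h.apply (π₀ := π₀) (ι₀ := ι₀) (U' := U ∪ (r₀.vars ∪ vs.vars).image π₀)
          (I' := I ∪ r₀.idSet.image ι₀) (hP r₀ hr₀) hσ hids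
        have hσ' := hσ.step hP hpol (LStep.apply (CT := CT) (P := P) r₀ hr₀ π₀ ι₀ H₁ H₂ _ B C T U I
          hvars hids_inj hids can htok)
        obtain ⟨v₀, πv, S₁, S₂, r', K, ιw, W, hf⟩ := ih _ _ hp hσ'
          (hU.trans Finset.subset_union_left) hpath
        obtain ⟨k, hk, σe', hpath', hA'⟩ := hf.path
        have hιw : ∀ j ∈ v₀.idSet, ιw j ∉ I ∧ ιw j ∉ r₀.idSet.image ι₀ := fun j hj => by
          simpa [not_or] using hf.ids j hj
        have htok₀ : (r₀.name, CHR.ids (H₁ ++ H₂)) ∉ T ∪ firedToken v₀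
            (CHR.ids (S₁.map (instAtom π ι) ++ S₂.map (instAtom π ι))) ∪
              v₀.tokens.image fun t => (t.1, t.2.map ιw) := by
          intro hm
          obtain ⟨i, hi⟩ := List.exists_mem_of_ne_nil _ (can.ids_ne_nil (hP r₀ hr₀))
          simp only [Finset.mem_union, Finset.mem_image] at hm
          rcases hm with (hm | hm) | ⟨t, ht, hm⟩
          · exact htok hm
          · -- The atoms `H₁`, `H₂` are not instances of body atoms of `r`.
            have := mem_firedToken hm
            simp only [Prod.mk.injEq] at this
            have hi' := this.2 ▸ hi
            rw [← List.map_append, ids_map_instAtom] at hi'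
            obtain ⟨j, hj, rfl⟩ := List.mem_map.1 hi'
            obtain ⟨q, hq, rfl⟩ := Rule.mem_idSet.1 (hf.unfolds.ids_mem j hj)
            obtain ⟨q', hq', he⟩ := mem_ids_append.1 hi
            have hn := hσ.nodup
            simp only at hn
            rw [Multiset.map_add, Multiset.nodup_add, Multiset.disjoint_left] at hn
            refine hn.2.2 (Multiset.mem_map.2 ⟨q', ?_, he⟩)
              (Multiset.mem_map.2 ⟨instAtom π ι q, ?_, rfl⟩)
            · simpa using hq'
            · exact Multiset.mem_add.2 (Or.inl (Multiset.mem_map_of_mem _ hq))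
          · simp only [Prod.mk.injEq] at hm
            obtain ⟨q, hq, hqi⟩ := mem_ids_append.1 hi
            rw [← hm.2] at hi
            obtain ⟨j, hj, he⟩ := List.mem_map.1 hi
            exact (hιw j ((hP v₀ hf.mem).mem_idSet ht hj)).1 (he ▸ hqi ▸ hI q hq)
        have hstep := LState.fire_apply (CT := CT) (fr := fun r₀ : Rule L κ ν => r₀.vars ∪ vs.vars)
          (fi := Rule.idSet) (P := P)
          (Q := Multiset.ofList H₁ + Multiset.ofList H₂ + (r.chr.map (instAtom π ι) + d))
          (Q' := r.chr.map (instAtom π ι) + d) (B := B) (C := C) (T := T) (U := U) (I := I) v₀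
          (πv.trans π) ιw (S₁.map (instAtom π ι)) (S₂.map (instAtom π ι)) W hr₀
          (R := K.map (instAtom π ι) + d)
          (fun x hx hm => by
            rcases Finset.mem_union.1 hm with hm | hm
            · exact hvars x hx hm
            · refine hvars x hx (hU (hf.used _ hm ?_))
              exact Finset.mem_union_right _ (Finset.mem_image_of_mem π₀ hx))
          hids_inj
          (fun i hi hm => by
            rcases Finset.mem_union.1 hm with hm | hm
            · exact hids i hi hm
            · obtain ⟨j, hj, he⟩ := Finset.mem_image.1 hm
              exact (hιw j hj).2 (he ▸ Finset.mem_image_of_mem ι₀ hi))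
          can htok₀
        have e : Multiset.ofList H₁ + Multiset.ofList H₂ + (K.map (instAtom π ι) + d)
            = K.map (instAtom π ι) + (Multiset.ofList H₁ + Multiset.ofList H₂ + d) := by abel
        have e' : r₀.chr.map (instAtom π₀ ι₀) + Multiset.ofList H₁ + (K.map (instAtom π ι) + d)
            = K.map (instAtom π ι) + (r₀.chr.map (instAtom π₀ ι₀) + Multiset.ofList H₁ + d) := by
          abel
        rw [e, e'] at hstep
        exact ⟨v₀, πv, S₁, S₂, r', K, ιw, W, hf.mem, hf.apart, hf.unfolds, hf.chr, hf.inj,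
          fun j hj => (hιw j hj).1, hf.vars, hf.fresh,
          fun x hx hxU => hf.used x hx (Finset.mem_union_left _ hxU), k + 1, Nat.succ_le_succ hk,
          σe', ⟨_, hstep, hpath'⟩, hA'⟩
      · obtain ⟨hap, S₁, S₂, r', hu, rfl, rfl⟩ := h.exists_unfoldsTo hr hinj hσ
          (((Finset.image_subset_image Finset.subset_union_left).trans h₁).trans hU) hsat hr₀
          hvars₀ can htok (Multiset.le_add_right _ _) hab (hF ▸ Multiset.le_add_right _ _) ha
        obtain ⟨K, hK⟩ := hu.exists_chr
        have hSR : S = K.map (instAtom π ι) + R := by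
          rw [hK, Multiset.map_add, Multiset.map_add, Multiset.map_coe, Multiset.map_coe] at hchr
          refine add_left_cancel (hchr.trans ?_)
          abel
        have hπ : (π₀.trans π.symm).trans π = π₀ := by ext x; simp
        refine ⟨r₀, π₀.trans π.symm, S₁, S₂, r', K, ι₀, (r₀.vars ∪ vs.vars).image π₀, hr₀, hap, hu,
          hK, hids_inj, hids, ?_, ?_, ?_, n, Nat.le_succ n, σe, ?_, hA⟩
        · rw [Rule.coreVars_rename, Finset.image_image, ← Equiv.coe_trans, hπ]
          exact Finset.image_subset_image (hpol.vars r₀)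
        · intro x hx hx0
          obtain ⟨y, hy, rfl⟩ := Finset.mem_image.1 hx
          exact hvars y hy (hU (hU₀ hx0))
        · intro x hx hxU
          obtain ⟨y, hy, rfl⟩ := Finset.mem_image.1 hx
          exact absurd hxU (hvars y hy)
        · rw [hπ, ← hSR]
          exact hpath

end FrontFiring

/-! ### Simulation of the original program by the unfolded one -/

section Completeness

variable {L : FirstOrder.Language.{u, v}} {κ : Type w} {ν : Type z} [DecidableEq ν]

/-- After the firing of `r`, its body is pending. -/
theorem pending_fired {CT : L.Theory} (hCT : ContainsClarkEquality CT) {r : Rule L κ ν}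
    (hr : r.WellFormed) {V : Finset Var} {π : Equiv.Perm Var} {ι : ℕ → ℕ} {H₁ H₂ : List (IAtom L κ)}
    {S : Multiset (IAtom L κ)} {B C : Conj L} {T : Finset (Token ν)} {U U' : Finset Var}
    {I I' : Finset ℕ}
    (hσ : LGood V ⟨⟨Multiset.ofList H₁ + Multiset.ofList H₂ + S, B, C, T⟩, U, I⟩)
    (hinj : Set.InjOn ι r.idSet) (hids : ∀ i ∈ r.idSet, ι i ∉ I)
    (can : CanFire CT C (chrs H₁) (chrs H₂) r) :
    Pending CT r π ι ⟨fired r π ι H₁ H₂ S B C T, U', I'⟩ (Multiset.ofList H₁ + S) := by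
  refine ⟨add_assoc _ _ _, (Multiset.le_add_right _ _).trans (Multiset.le_add_right _ _),
    fun M a ha => ?_, fun t ht => ?_, fun name l hl hlr h => ?_⟩
  · obtain ⟨he, hC⟩ := Conj.realize_add.1 ha
    exact guard_of_eqns hCT can π M a (by simpa [chrs] using he) hC
  · exact Finset.mem_union_right _ (Finset.mem_image_of_mem (fun t : Token ν => (t.1, t.2.map ι))
      ht)
  · refine mem_tokens_of_mem_fired hr hinj (fun i hi t ht hm => hids i hi (hσ.tokens t ht _ hm))
      (fun i hi k hk he => hids i hi (he ▸ hσ.ids k ?_)) hl hlr h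
    simp only [Multiset.mem_add, Multiset.mem_coe]
    exact Or.inl hk

/-- An answer of the original program is one of the unfolded program, in any state that is ahead:
wherever an unfolded rule can fire, so can `r`. -/
theorem Ahead.isAnswer_unf {CT : L.Theory} {P : Set (Rule L κ ν)} (hP : IsAnnotatedProgram P)
    {r : Rule L κ ν} (hr : r ∈ P) {V : Finset Var} {σ τ : LState L κ ν} (h : Ahead σ τ)
    {A : Answer L κ} (hA : σ.toState.IsAnswer CT P V A) :
    τ.toState.IsAnswer CT ((P \ {r}) ∪ Unf CT P r) V A := by
  refine h.isAnswer hA fun r' hr' => ⟨isAnnotatedProgram_unf hP hr r' hr', fun C K₁ K₂ hcan => ?_⟩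
  rcases hr' with hr' | ⟨v, S₁, S₂, _, hu⟩
  · exact ⟨r', hr'.1, rfl, hcan⟩
  · obtain ⟨hname, hkeep, hrem⟩ := hu.head
    exact ⟨r, hr, hname.symm, hcan.of_guard hkeep.symm hrem.symm hu.guard_entails⟩

/-- A firing of `r` followed by the firing of an unfolding rule on its body is simulated by the
firing of the unfolded rule. -/
theorem Ahead.exists_steps_unfolded {CT : L.Theory} {P : Set (Rule L κ ν)}
    (hP : IsAnnotatedProgram P) {r : Rule L κ ν} (hr : SafelyReplaceable CT P r)
    {vs : Rule L κ ν} {V : Finset Var} {A : Answer L κ} {π : Equiv.Perm Var} {ι : ℕ → ℕ}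
    {H₁ H₂ : List (IAtom L κ)}
    {S : Multiset (IAtom L κ)} {B C : Conj L} {T : Finset (Token ν)} {U : Finset Var}
    {I : Finset ℕ} {τ : LState L κ ν}
    (h : Ahead ⟨⟨Multiset.ofList H₁ + Multiset.ofList H₂ + S, B, C, T⟩, U, I⟩ τ)
    (hσ : LGood V ⟨⟨Multiset.ofList H₁ + Multiset.ofList H₂ + S, B, C, T⟩, U, I⟩)
    (hτ : LGood V τ) (hvars : ∀ x ∈ r.vars ∪ vs.vars, π x ∉ U) (hinj : Set.InjOn ι r.idSet)
    (hids : ∀ i ∈ r.idSet, ι i ∉ I) (can : CanFire CT C (chrs H₁) (chrs H₂) r)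
    (htok : (r.name, CHR.ids (H₁ ++ H₂)) ∉ T) {n : ℕ} {v₀ : Rule L κ ν} {πv : Equiv.Perm Var}
    {S₁ S₂ : List (IAtom L κ)} {r' : Rule L κ ν} {K : Multiset (IAtom L κ)} {ιw : ℕ → ℕ}
    {W : Finset Var}
    (hf : FrontFiring CT (fun r₀ => r₀.vars ∪ vs.vars) P V A r π ι U
      (U ∪ (r.vars ∪ vs.vars).image π) n ⟨CHR.fired r π ι H₁ H₂ S B C T,
        U ∪ (r.vars ∪ vs.vars).image π, I ∪ r.idSet.image ι⟩ (Multiset.ofList H₁ + S)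
      v₀ πv S₁ S₂ r' K ιw W) :
    ∃ τ', Relation.ReflTransGen (LStep CT Rule.coreVars Rule.idSet ((P \ {r}) ∪ Unf CT P r)) τ τ' ∧
      Ahead (LState.fire ⟨CHR.fired r π ι H₁ H₂ S B C T, U ∪ (r.vars ∪ vs.vars).image π,
        I ∪ r.idSet.image ι⟩ v₀ (πv.trans π) ιw (S₁.map (instAtom π ι)) (S₂.map (instAtom π ι))
          (K.map (instAtom π ι) + (Multiset.ofList H₁ + S)) W) τ' := by
  obtain ⟨⟨Q, B', C', T'⟩, U', I'⟩ := τ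
  obtain ⟨can', htok'⟩ := h.can (hP r hr.mem) can htok
  obtain rfl : Q = Multiset.ofList H₁ + Multiset.ofList H₂ + S := h.chr
  have hwr := hP r hr.mem
  have hwv := hP v₀ hf.mem
  have hu := hf.unfolds
  have hmem := hu.mem_unf hf.apart
  obtain ⟨hname, hkeep, hrem⟩ := hu.head
  have hcore := hu.coreVars
  have hιwI : ∀ j ∈ v₀.idSet, ιw j ∉ I ∧ ιw j ∉ r.idSet.image ι := fun j hj => by
    simpa [not_or] using hf.ids j hj
  -- The identifiers of `r'` are those of `r` and, shifted, those of `v₀`.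
  set m := maxId r.chr r.tokens with hm
  set ι' : ℕ → ℕ := fun i => if i ≤ m then ι i else ιw (i - m) with hι'
  have hι : ∀ i ∈ r.idSet, ι' i = ι i := fun i hi => if_pos (le_maxId_of_mem_idSet hi)
  have hιw : ∀ j ∈ v₀.idSet, ι' (j + m) = ιw j := fun j hj => by
    have := hwv.pos hj
    rw [hι']
    simp only
    rw [if_neg (by omega), Nat.add_sub_cancel]
  have hne : ∀ i ∈ r.idSet, ∀ j ∈ v₀.idSet, ι i ≠ ιw j := fun i hi j hj he =>
    (hιwI j hj).2 (he ▸ Finset.mem_image_of_mem ι hi)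
  have hsplit : ∀ i ∈ r'.idSet, i ∈ r.idSet ∨ ∃ j ∈ v₀.idSet, i = j + m := fun i hi => by
    simpa [Rule.idSet, Rule.rename, Multiset.map_map] using hu.mem_idSet hi
  have hinj' : Set.InjOn ι' r'.idSet := by
    intro i hi j hj hij
    rcases hsplit i hi with hi | ⟨i, hiv, rfl⟩ <;> rcases hsplit j hj with hj | ⟨j, hjv, rfl⟩
    · rw [hι i hi, hι j hj] at hij
      exact hinj hi hj hij
    · rw [hι i hi, hιw j hjv] at hij
      exact absurd hij (hne i hi j hjv)
    · rw [hιw i hiv, hι j hj] at hij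
      exact absurd hij.symm (hne j hj i hiv)
    · rw [hιw i hiv, hιw j hjv] at hij
      rw [hf.inj hiv hjv hij]
  have hids' : ∀ i ∈ r'.idSet, ι' i ∉ I := by
    intro i hi
    rcases hsplit i hi with hi | ⟨i, hiv, rfl⟩
    · rw [hι i hi]; exact hids i hi
    · rw [hιw i hiv]; exact (hιwI i hiv).1
  have hvars' : ∀ x ∈ r'.coreVars, π x ∉ U := by
    intro x hx
    rw [hcore, Finset.mem_union] at hx
    rcases hx with hx | hx
    · exact hvars x (Finset.mem_union_left _ (r.coreVars_subset_vars hx))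
    · exact hf.fresh _ (hf.vars (Finset.mem_image_of_mem π hx))
  have hold : ∀ i ∈ r.idSet, ∀ k, k ∈ H₁ ∨ k ∈ S → k.2 ≠ ι i := fun i hi k hk he =>
    hids i hi (he ▸ hσ.ids k (by simp only [Multiset.mem_add, Multiset.mem_coe]; tauto))
  obtain ⟨K', hK', f1, f2, f3⟩ := hu.fired hwr hwv π H₁ H₂ S B C T hι hιw hinj hne hold
  obtain ⟨_, _, _, f2', _⟩ := hu.fired hwr hwv π H₁ H₂ S B' C' T' hι hιw hinj hne hold
  obtain rfl : K' = K := add_right_cancel (add_right_cancel (hK'.symm.trans hf.chr))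
  have step₁ := LStep.apply (CT := CT) (fr := Rule.coreVars) (fi := Rule.idSet)
    (P := (P \ {r}) ∪ Unf CT P r) r' (Or.inr hmem) π ι' H₁ H₂ S B' C' T' U' I'
    (fun x hx hm => hvars' x hx (h.usedVars hm)) hinj' (fun i hi hm => hids' i hi (h.usedIds hm))
    (can'.of_guard hkeep hrem (hr.guard_equiv r' hmem).1) (hname ▸ htok')
  have step₂ := reflTransGen_solve (CT := CT) (fr := Rule.coreVars) (fi := Rule.idSet)
    (P := (P \ {r}) ∪ Unf CT P r) (CHR.fired r' π ι' H₁ H₂ S B' C' T').chr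
    (eqns (chrs (S₁.map (instAtom π ι) ++ S₂.map (instAtom π ι)))
      ((v₀.keep ++ v₀.remove).map (Atom.rename (πv.trans π))))
    (v₀.builtin.map (Builtin.rename (πv.trans π)) + (r.builtin.map (Builtin.rename π) + B'))
    (CHR.fired r' π ι' H₁ H₂ S B' C' T').history (U' ∪ r'.coreVars.image π) (I' ∪ r'.idSet.image ι')
    (CHR.fired r' π ι' H₁ H₂ S B' C' T').store
  rw [← f2'] at step₂
  refine ⟨_, .head step₁ step₂, ?_⟩
  have hfired := h.fired hσ hτ (π := π) hids' 
    (U₁ := U' ∪ r'.coreVars.image π) (I₁ := I' ∪ r'.idSet.image ι') (Finset.Subset.refl _)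
    (Finset.Subset.refl _)
  obtain ⟨X, hB, hC⟩ := h.solved
  simp only at hB hC
  refine ⟨f1, ⟨X, ?_, ?_⟩, ?_, ?_, ?_⟩
  · simp only [LState.fire, CHR.fired, hB]
    abel
  · simp only [LState.fire, CHR.fired, hC, hkeep, hrem]
    abel
  · have hl := f3.symm.trans hfired.live
    rw [f1] at hl
    exact hl
  · refine Finset.union_subset
      ((h.usedVars.trans Finset.subset_union_left).trans Finset.subset_union_left) ?_
    rw [hcore, Finset.image_union]
    refine Finset.union_subset ?_ (hf.vars.trans Finset.subset_union_right)
    refine Finset.Subset.trans ?_ Finset.subset_union_left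
    refine Finset.Subset.trans ?_ Finset.subset_union_right
    exact Finset.image_subset_image (r.coreVars_subset_vars.trans Finset.subset_union_left)
  · refine Finset.union_subset
      ((h.usedIds.trans Finset.subset_union_left).trans Finset.subset_union_left) fun y hy => ?_
    obtain ⟨i, hi, rfl⟩ := Finset.mem_image.1 hy
    rcases hsplit i hi with hi | ⟨i, hiv, rfl⟩
    · rw [hι i hi]
      exact Finset.mem_union_left _ (Finset.mem_union_right _ (Finset.mem_image_of_mem ι hi))
    · rw [hιw i hiv]
      exact Finset.mem_union_right _ (Finset.mem_image_of_mem ιw hiv)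

/-- The simulation of a whole computation. It proceeds by induction on the length of the
computation, which does not grow when a firing is moved to the front. -/
theorem Ahead.exists_answer_unfolded {CT : L.Theory} (hCT : ContainsClarkEquality CT)
    {P : Set (Rule L κ ν)} (hP : IsAnnotatedProgram P) {r : Rule L κ ν}
    (hr : SafelyReplaceable CT P r) {vs rs : Rule L κ ν} {Ss₁ Ss₂ : List (IAtom L κ)}
    (hvs : IsApartVariant P r vs) (hus : UnfoldsTo CT r vs Ss₁ Ss₂ rs) {V : Finset Var}
    {A : Answer L κ} : ∀ (n : ℕ) {σ σe τ : LState L κ ν},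
      LPath CT (fun r₀ => r₀.vars ∪ vs.vars) Rule.idSet P n σ σe → Ahead σ τ → LGood V σ →
      LGood V τ → σe.toState.IsAnswer CT P V A →
      ∃ τe, Relation.ReflTransGen
          (LStep CT Rule.coreVars Rule.idSet ((P \ {r}) ∪ Unf CT P r)) τ τe ∧
        τe.toState.IsAnswer CT ((P \ {r}) ∪ Unf CT P r) V A := by
  have hP' := isAnnotatedProgram_unf (CT := CT) hP hr.mem
  have hpol : IsPolicy (fun r₀ : Rule L κ ν => r₀.vars ∪ vs.vars) Rule.idSet :=
    ⟨fun r₀ => r₀.coreVars_subset_vars.trans Finset.subset_union_left,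
      fun _ => Finset.Subset.refl _⟩
  intro n
  induction n using Nat.strong_induction_on with
  | _ n ih =>
  intro σ σe τ hpath h hσ hτ hA
  rcases n with _ | n
  · obtain rfl : σ = σe := hpath
    exact ⟨τ, .refl, h.isAnswer_unf hP hr.mem hA⟩
  obtain ⟨σ₁, hs, hpath⟩ := hpath
  have hσ₁ := hσ.step hP hpol hs
  -- It is enough to simulate the first transition.
  have next : ∀ {k : ℕ} {σ₁ σe τ₁ : LState L κ ν}, k ≤ n →
      LPath CT (fun r₀ => r₀.vars ∪ vs.vars) Rule.idSet P k σ₁ σe → LGood V σ₁ →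
      Relation.ReflTransGen (LStep CT Rule.coreVars Rule.idSet ((P \ {r}) ∪ Unf CT P r)) τ τ₁ →
      Ahead σ₁ τ₁ → σe.toState.IsAnswer CT P V A →
      ∃ τe, Relation.ReflTransGen
          (LStep CT Rule.coreVars Rule.idSet ((P \ {r}) ∪ Unf CT P r)) τ τe ∧
        τe.toState.IsAnswer CT ((P \ {r}) ∪ Unf CT P r) V A := by
    intro k σ₁ σe τ₁ hk hp hσ₁ hτ₁ hah hA
    obtain ⟨τe, hτe, hans⟩ := ih k (Nat.lt_succ_of_le hk) hp hah hσ₁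
      (hτ.steps hP' isPolicy_core hτ₁) hA
    exact ⟨τe, hτ₁.trans hτe, hans⟩
  cases hs with
  | solve S c B C T U I =>
    obtain ⟨τ₁, hτ₁, hah⟩ := h.solve
    exact next le_rfl hpath hσ₁ hτ₁ hah hA
  | apply r₀ hr₀ π ι H₁ H₂ S B C T U I hvars hinj hids can htok =>
    by_cases hrr : r₀ = r
    · subst hrr
      have hpend := pending_fired (U' := U ∪ (r₀.vars ∪ vs.vars).image π)
        (I' := I ∪ r₀.idSet.image ι) (π := π) hCT (hP r₀ hr₀) hσ hinj hids can
      obtain ⟨v₀, πv, S₁, S₂, r', K, ιw, W, hf⟩ := Pending.exists_frontFiring hP hr hvs hus hinj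
        (U₀ := U) Finset.subset_union_right hvars Finset.subset_union_left hA n _ _ hpend hσ₁
        (Finset.Subset.refl _) hpath
      obtain ⟨k, hk, σe', hpath', hA'⟩ := hf.path
      obtain ⟨τ₁, hτ₁, hah⟩ := h.exists_steps_unfolded hP hr hσ hτ hvars hinj hids can htok hf
      refine next hk hpath' ?_ hτ₁ hah hA'
      have e : (CHR.fired r₀ π ι H₁ H₂ S B C T).chr
          = Multiset.ofList (S₁.map (instAtom π ι)) + Multiset.ofList (S₂.map (instAtom π ι))
            + (K.map (instAtom π ι) + (↑H₁ + S)) := by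
        simp only [CHR.fired, hf.chr, Multiset.map_add, Multiset.map_coe]
        abel
      have hg : LGood V ⟨⟨(CHR.fired r₀ π ι H₁ H₂ S B C T).chr,
          (CHR.fired r₀ π ι H₁ H₂ S B C T).builtin,
        (CHR.fired r₀ π ι H₁ H₂ S B C T).store, (CHR.fired r₀ π ι H₁ H₂ S B C T).history⟩, _, _⟩ :=
            hσ₁
      rw [e] at hg
      refine hg.fired (hP v₀ hf.mem) hf.inj hf.ids Finset.subset_union_left
        Finset.subset_union_left ?_ Finset.subset_union_right
      refine Finset.Subset.trans ?_ (hf.vars.trans Finset.subset_union_right)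
      rw [Rule.coreVars_rename, Finset.image_image, ← Equiv.coe_trans]
    · obtain ⟨⟨Q, B', C', T'⟩, U', I'⟩ := τ
      obtain ⟨can', htok'⟩ := h.can (hP r₀ hr₀) can htok
      obtain rfl : Q = Multiset.ofList H₁ + Multiset.ofList H₂ + S := h.chr
      refine next le_rfl hpath hσ₁ (.single (LStep.apply r₀ (Or.inl ⟨hr₀, hrr⟩) π ι H₁ H₂ S B' C' T'
        U' I' (fun x hx hm => hvars x (hpol.vars r₀ hx) (h.usedVars hm)) hinj
        (fun i hi hm => hids i hi (h.usedIds hm)) can' htok')) ?_ hA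
      exact h.fired hσ hτ hids
        (Finset.union_subset_union h.usedVars (Finset.image_subset_image (hpol.vars r₀)))
        (Finset.union_subset_union h.usedIds (Finset.Subset.refl _))

/-- Every qualified answer of the original program is one of the unfolded program. -/
theorem QA_subset_unf {CT : L.Theory} (hCT : ContainsClarkEquality CT) {P : Set (Rule L κ ν)}
    (hP : IsAnnotatedProgram P) {r : Rule L κ ν} (hr : SafelyReplaceable CT P r) (G : Goal L κ) :
    QA CT P G ⊆ QA CT ((P \ {r}) ∪ Unf CT P r) G := by
  obtain ⟨⟨vs, is⟩, hvs, Ss₁, Ss₂, rs, _, hus⟩ := hr.uPlus_nonempty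
  intro A hA
  obtain ⟨σ, hσ, hans⟩ := (mem_QA_iff_machine hP (fr := fun r₀ => r₀.vars ∪ vs.vars)
    (fi := Rule.idSet) ⟨fun r₀ => r₀.coreVars_subset_vars.trans Finset.subset_union_left,
      fun _ => Finset.Subset.refl _⟩).1 hA
  obtain ⟨n, hn⟩ := exists_lpath hσ
  exact (mem_QA_iff_machine (isAnnotatedProgram_unf hP hr.mem) isPolicy_core).2
    (Ahead.exists_answer_unfolded hCT hP hr hvs hus n hn (Ahead.refl _) G.lgood G.lgood hans)

end Completeness

end CHR

theorem mainTheorem2 {L : FirstOrder.Language.{u, v}} {κ : Type w} {ν : Type z} [DecidableEq ν]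
    (CT : L.Theory) (hCT : CHR.ContainsClarkEquality CT)
    (P : Set (CHR.Rule L κ ν)) (hP : CHR.IsAnnotatedProgram P)
    (r : CHR.Rule L κ ν) (hr : CHR.SafelyReplaceable CT P r) (G : CHR.Goal L κ) :
    CHR.QA CT P G = CHR.QA CT ((P \ {r}) ∪ CHR.Unf CT P r) G :=
  (CHR.QA_subset_unf hCT hP hr G).antisymm (CHR.QA_unf_subset hCT hP hr G)
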